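/- For $n\ge 1$ write $[n]=\{1,\dots,n\}$, and order the $k$-element subsets of $[n]$ lexicographically: $A<B$ if and only if $\min(A\,\triangle\,B)\in A$. Let $\mathcal L_{n,k}(m)$ be the family of the first $m$ sets of $\binom{[n]}{k}$ in this order. A family of sets is intersecting if every two of its members have non-empty intersection, and $\mathrm{int}(\mathcal F,t)$ denotes the number of intersecting subfamilies of $\mathcal F$ that consist of exactly $t$ sets. Proposition 3.3. For all non-negative integers $k$ and $\ell$ there is an integer $n_0=n_0(k,\ell)$ such that the following holds for every $n\ge n_0$ and every integer $m$ with $$\binom nk-\binom{n-\ell}k\ \le\ m\ \le\ \binom nk-\binom{n-\ell}k+n-\ell-k+1.$$ If $\mathcal F$ is a family of $k$-element subsets of $[n]$ with $|\mathcal F|=m$, then $$\mathrm{int}(\mathcal F,t)\ \le\ \mathrm{int}(\mathcal L_{n,k}(m),t)\qquad\text{for every integer } t\ge 0.$$ -/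

import Mathlib

namespace MostProbablyIntersecting

/-- The lexicographic order on finite sets: `A < B` if and only if `min (A ∆ B) ∈ A`, that is, the
least element `i` lying in exactly one of the two sets lies in `A`. Sets with smaller elements come
first. -/
def LexLT {n : ℕ} (A B : Finset (Fin n)) : Prop :=
  ∃ i ∈ A, i ∉ B ∧ ∀ j < i, (j ∈ A ↔ j ∈ B)

instance {n : ℕ} (A B : Finset (Fin n)) : Decidable (LexLT A B) := by
  unfold LexLT; infer_instance

/-- `lexFamily n k m` is the family of the first `m` sets, in the lexicographic order, among the
`k`-element subsets of the `n`-element ground set `Fin n`: those `k`-sets that have fewer than `m`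
predecessors. (All the `k`-sets, if there are fewer than `m` of them.) -/
def lexFamily (n k m : ℕ) : Finset (Finset (Fin n)) :=
  {A ∈ Finset.powersetCard k (Finset.univ : Finset (Fin n)) |
    Finset.card {B ∈ Finset.powersetCard k (Finset.univ : Finset (Fin n)) | LexLT B A} < m}

instance {n : ℕ} (G : Finset (Finset (Fin n))) :
    Decidable ((G : Set (Finset (Fin n))).Intersecting) :=
  decidable_of_iff (∀ A ∈ G, ∀ B ∈ G, ¬ Disjoint A B) Iff.rfl

/-- The number of intersecting subfamilies of `F` that consist of exactly `t` sets. -/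
def intersectingCount {n : ℕ} (F : Finset (Finset (Fin n))) (t : ℕ) : ℕ :=
  ((F.powersetCard t).filter fun G : Finset (Finset (Fin n)) =>
    (G : Set (Finset (Fin n))).Intersecting).card

end MostProbablyIntersecting

/-! For `k ≥ 2` and large `n` the lexicographic family consists of all `k`-sets meeting the set `X`
of the first `l` points, together with a remainder that is a sunflower: `k`-sets off `X` sharing one
`(k-1)`-set `K` (`lexFamily_eq_union`). The claim becomes that no family of the same size beats
`touching k X ∪ R`. The cases `k ≤ 1` and `t ≤ 1` are immediate. Write D = C(n-1,k-1), the size of a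
full star, and E = C(n-2,k-2), which for `k ≥ 3` is at least of order n and is small compared with
D.

Uniformity at least three. Intersecting subfamilies with no common point are negligible beside
C(D,t) (`mul_card_nontrivialSubfamilies_le`), so the count is essentially the sum of C(deg x, t). A
bounded set of vertices has total degree at most |F| + O(E), and C(d,t) is convex in d. Hence a
family that beats `l` full stars contains all but O(E) members of some union of `l` full stars
(`exists_star_cover`). A member off that `l`-set meets only O(E) others, whereas a member restored
to a full star is worth far more, so one may exchange until the family contains every `k`-set
meeting the `l`-set (`intersectingCount_le_touching_union`).

It remains to choose the remainder. Sort the subfamilies by their trace T on the remainder; what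
counts is the set of members of `touching k X` that meet all of T. If T has a kernel of size `k-1`,
a permutation makes it part of the sunflower. Otherwise the sets meeting all of T meet a fixed
`(k-2)`-set, up to O(C(n-3,k-3)) exceptions, and enlarging that set by one point gains more than the
exceptions do (`intersectingCount_touchingBoth_union_le`, `intersectingCount_cross_le`). Since every
part of a sunflower is intersecting, the comparison can be made trace by trace
(`intersectingCount_union_le_union`).

Graphs. For `k = 2` one has E = 1 while the remainder may have about n edges, so the error terms
above are no longer negligible. There is instead an exact formula: stars, plus triangles when `t =
3` (`intersectingCount_eq_of_sized_two`). Among the graphs at least as good as the given one, take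
one with the largest sum of squared degrees. Edge switching shows that its edges are either governed
by small degrees or covered by boundedly many vertices, each of full degree or of nearly the largest
other degree. With at least `l` full vertices the remainder argument applies. With a cover of at
most `l+1` vertices the cover extends to a clique of size `l+1`, and concentrating the missing edges
at one vertex is optimal (`intersectingCount_le_of_clique_cover`). With more covering vertices the
degrees are spread too evenly, and power-sum estimates finish
(`intersectingCount_le_of_many_centres`). -/

open Finset

namespace MostProbablyIntersecting

/-! ### Counting intersecting subfamilies: monotonicity, permutations, union bounds. -/

variable {n : ℕ}

/-- The intersecting subfamilies of `F` with exactly `t` members. -/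
def intersectingSubfamilies (F : Finset (Finset (Fin n))) (t : ℕ) :
    Finset (Finset (Finset (Fin n))) :=
  (F.powersetCard t).filter fun G => (G : Set (Finset (Fin n))).Intersecting

theorem card_intersectingSubfamilies (F : Finset (Finset (Fin n))) (t : ℕ) :
    (intersectingSubfamilies F t).card = intersectingCount F t := rfl

theorem mem_intersectingSubfamilies {F G : Finset (Finset (Fin n))} {t : ℕ} :
    G ∈ intersectingSubfamilies F t ↔
      (G ⊆ F ∧ G.card = t) ∧ (G : Set (Finset (Fin n))).Intersecting := by
  simp [intersectingSubfamilies, mem_powersetCard]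

theorem intersectingSubfamilies_mono {F F' : Finset (Finset (Fin n))} (h : F ⊆ F') (t : ℕ) :
    intersectingSubfamilies F t ⊆ intersectingSubfamilies F' t := by
  intro G
  simp only [mem_intersectingSubfamilies]
  exact fun ⟨⟨h1, h2⟩, h3⟩ => ⟨⟨h1.trans h, h2⟩, h3⟩

theorem intersectingCount_mono {F F' : Finset (Finset (Fin n))} (h : F ⊆ F') (t : ℕ) :
    intersectingCount F t ≤ intersectingCount F' t :=
  card_le_card (intersectingSubfamilies_mono h t)

theorem intersectingCount_le_choose (F : Finset (Finset (Fin n))) (t : ℕ) :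
    intersectingCount F t ≤ F.card.choose t := by
  rw [← card_powersetCard]
  exact card_filter_le _ _

theorem intersectingCount_zero (F : Finset (Finset (Fin n))) : intersectingCount F 0 = 1 := by
  rw [← card_intersectingSubfamilies, card_eq_one]
  refine ⟨∅, ?_⟩
  ext G
  simp only [mem_intersectingSubfamilies, card_eq_zero, mem_singleton]
  constructor
  · exact fun h => h.1.2
  · rintro rfl
    exact ⟨⟨empty_subset _, rfl⟩, fun A hA => absurd hA (by simp)⟩

/-- The image of a family under a permutation of the ground set. -/
def permFamily (σ : Equiv.Perm (Fin n)) (F : Finset (Finset (Fin n))) :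
    Finset (Finset (Fin n)) :=
  F.image (fun A => A.image σ)

theorem image_perm_injective (σ : Equiv.Perm (Fin n)) :
    Function.Injective (fun A : Finset (Fin n) => A.image σ) :=
  image_injective σ.injective

theorem card_permFamily (σ : Equiv.Perm (Fin n)) (F : Finset (Finset (Fin n))) :
    (permFamily σ F).card = F.card :=
  card_image_of_injective _ (image_perm_injective σ)

theorem permFamily_symm_permFamily (σ : Equiv.Perm (Fin n)) (F : Finset (Finset (Fin n))) :
    permFamily σ.symm (permFamily σ F) = F := by
  ext A
  simp [permFamily, image_image]

theorem image_mem_permFamily {σ : Equiv.Perm (Fin n)} {F : Finset (Finset (Fin n))}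
    {A : Finset (Fin n)} : A.image σ ∈ permFamily σ F ↔ A ∈ F := by
  simp only [permFamily, mem_image]
  constructor
  · rintro ⟨B, hB, h⟩
    rwa [← image_perm_injective σ h]
  · exact fun h => ⟨A, h, rfl⟩

theorem disjoint_image_perm {σ : Equiv.Perm (Fin n)} {A B : Finset (Fin n)} :
    Disjoint (A.image σ) (B.image σ) ↔ Disjoint A B :=
  disjoint_image σ.injective

theorem intersectingCount_le_permFamily (σ : Equiv.Perm (Fin n)) (F : Finset (Finset (Fin n)))
    (t : ℕ) : intersectingCount F t ≤ intersectingCount (permFamily σ F) t := by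
  refine card_le_card_of_injOn (permFamily σ) ?_ ?_
  · intro G hG
    have hG' := mem_intersectingSubfamilies.1 hG
    refine mem_intersectingSubfamilies.2 ⟨⟨image_subset_image hG'.1.1, ?_⟩, ?_⟩
    · rw [card_permFamily, hG'.1.2]
    · intro A hA B hB
      simp only [permFamily, coe_image, Set.mem_image, mem_coe] at hA hB
      obtain ⟨A, hA, rfl⟩ := hA
      obtain ⟨B, hB, rfl⟩ := hB
      rw [disjoint_image_perm]
      exact hG'.2 hA hB
  · exact fun G _ G' _ h => image_injective (image_perm_injective σ) h

theorem intersectingCount_permFamily (σ : Equiv.Perm (Fin n)) (F : Finset (Finset (Fin n)))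
    (t : ℕ) : intersectingCount (permFamily σ F) t = intersectingCount F t := by
  refine le_antisymm ?_ (intersectingCount_le_permFamily σ F t)
  have := intersectingCount_le_permFamily σ.symm (permFamily σ F) t
  rwa [permFamily_symm_permFamily] at this

/-- The intersecting `t`-subfamilies containing a fixed member number at most those obtained by
choosing the other members among the sets that meet it. -/
theorem card_intersectingSubfamilies_mem_le (F : Finset (Finset (Fin n))) (t : ℕ)
    (p : Finset (Fin n)) :
    ((intersectingSubfamilies F t).filter (p ∈ ·)).card ≤
      intersectingCount ((F.filter fun A => ¬ Disjoint A p).erase p) (t - 1) := by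
  refine card_le_card_of_injOn (fun G => G.erase p) ?_ ?_
  · intro G hG
    simp only [mem_coe, mem_filter, mem_intersectingSubfamilies] at hG
    obtain ⟨⟨⟨h1, h2⟩, h3⟩, h4⟩ := hG
    refine mem_intersectingSubfamilies.2 ⟨⟨?_, ?_⟩, ?_⟩
    · intro A hA
      have hA' := mem_erase.1 hA
      exact mem_erase.2 ⟨hA'.1, mem_filter.2 ⟨h1 hA'.2, h3 hA'.2 h4⟩⟩
    · rw [card_erase_of_mem h4, h2]
    · exact h3.mono (by exact_mod_cast erase_subset _ _)
  · intro G hG G' hG' h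
    simp only [mem_coe, mem_filter] at hG hG'
    have h : G.erase p = G'.erase p := h
    rw [← insert_erase hG.2, h, insert_erase hG'.2]

theorem intersectingCount_le_add_sum {F F₁ P : Finset (Finset (Fin n))} (h : F ⊆ F₁ ∪ P) (t : ℕ) :
    intersectingCount F t ≤ intersectingCount F₁ t +
      ∑ p ∈ P, ((intersectingSubfamilies F t).filter (p ∈ ·)).card := by
  have : intersectingSubfamilies F t ⊆ intersectingSubfamilies F₁ t ∪
      P.biUnion fun p => (intersectingSubfamilies F t).filter (p ∈ ·) := by
    intro G hG
    have hG' := mem_intersectingSubfamilies.1 hG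
    by_cases hP : ∃ p ∈ P, p ∈ G
    · obtain ⟨p, hp, hpG⟩ := hP
      exact mem_union_right _ (mem_biUnion.2 ⟨p, hp, mem_filter.2 ⟨hG, hpG⟩⟩)
    · refine mem_union_left _ (mem_intersectingSubfamilies.2 ⟨⟨fun A hA => ?_, hG'.1.2⟩, hG'.2⟩)
      rcases mem_union.1 (h (hG'.1.1 hA)) with h | h
      · exact h
      · exact absurd ⟨A, h, hA⟩ hP
  calc intersectingCount F t = (intersectingSubfamilies F t).card := rfl
    _ ≤ _ := card_le_card this
    _ ≤ _ := card_union_le _ _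
    _ ≤ _ := Nat.add_le_add_left card_biUnion_le _

/-- A Bonferroni inequality. -/
theorem sum_card_le_card_biUnion_add {ι β : Type*} [DecidableEq ι] [DecidableEq β]
    (s : Finset ι) (A : ι → Finset β) :
    ∑ i ∈ s, (A i).card ≤ (s.biUnion A).card + ∑ p ∈ s.offDiag, (A p.1 ∩ A p.2).card := by
  have h1 : ∑ i ∈ s, (A i).card = ∑ b ∈ s.biUnion A, (s.filter (b ∈ A ·)).card := by
    have : ∀ i ∈ s, (A i).card = ∑ b ∈ s.biUnion A, if b ∈ A i then 1 else 0 := by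
      intro i hi
      rw [sum_ite_mem, inter_eq_right.2 (subset_biUnion_of_mem A hi)]
      simp
    rw [sum_congr rfl this, sum_comm]
    exact sum_congr rfl fun b _ => (card_filter _ _).symm
  have h2 : ∑ p ∈ s.offDiag, (A p.1 ∩ A p.2).card =
      ∑ b ∈ s.biUnion A, (s.filter (b ∈ A ·)).offDiag.card := by
    have : ∀ p ∈ s.offDiag, (A p.1 ∩ A p.2).card =
        ∑ b ∈ s.biUnion A, if b ∈ A p.1 ∩ A p.2 then 1 else 0 := by
      intro p hp
      rw [sum_ite_mem, inter_eq_right.2 (inter_subset_left.trans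
        (subset_biUnion_of_mem A (mem_offDiag.1 hp).1))]
      simp
    rw [sum_congr rfl this, sum_comm]
    refine sum_congr rfl fun b _ => ?_
    rw [← card_filter]
    congr 1
    ext ⟨x, y⟩
    simp only [mem_filter, mem_offDiag, mem_inter]
    tauto
  rw [h1, h2, card_eq_sum_ones, ← sum_add_distrib]
  -- An element in c + 1 of the sets contributes c + 1 on the left and 1 + (c + 1)c on the right,
  -- `offDiag` consisting of ordered pairs.
  refine sum_le_sum fun b hb => ?_
  obtain ⟨i, hi, hbi⟩ := mem_biUnion.1 hb
  have : 0 < (s.filter (b ∈ A ·)).card := card_pos.2 ⟨i, mem_filter.2 ⟨hi, hbi⟩⟩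
  rw [offDiag_card]
  obtain ⟨c, hc⟩ := Nat.exists_eq_succ_of_ne_zero this.ne'
  rw [hc, Nat.succ_mul_succ_eq]
  have : c * c + c + c + 1 - c.succ = c * c + c := by omega
  rw [this]
  nlinarith
  
/-- Two partitions of a finite type with matching class sizes differ by a permutation. -/
theorem exists_perm_comp_eq {β : Type*} [DecidableEq β] (c c' : Fin n → β)
    (h : ∀ b, (univ.filter fun x => c x = b).card = (univ.filter fun x => c' x = b).card) :
    ∃ σ : Equiv.Perm (Fin n), ∀ x, c' (σ x) = c x := by
  have e : ∀ b, Nonempty ({x // c x = b} ≃ {x // c' x = b}) := by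
    intro b
    refine Fintype.card_eq.1 ?_
    rw [Fintype.card_subtype, Fintype.card_subtype, h b]
  refine ⟨(Equiv.sigmaFiberEquiv c).symm.trans
    ((Equiv.sigmaCongrRight fun b => Classical.choice (e b)).trans (Equiv.sigmaFiberEquiv c')), ?_⟩
  intro x
  simp only [Equiv.trans_apply]
  exact (Classical.choice (e (c x)) ⟨x, rfl⟩).2

/-! ### The lexicographic order and the shape of its initial segments. -/

theorem LexLT.irrefl (A : Finset (Fin n)) : ¬ LexLT A A :=
  fun ⟨_, h1, h2, _⟩ => h2 h1

theorem LexLT.trans {A B C : Finset (Fin n)} (h1 : LexLT A B) (h2 : LexLT B C) : LexLT A C := by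
  obtain ⟨i, hiA, hiB, hi⟩ := h1
  obtain ⟨j, hjB, hjC, hj⟩ := h2
  rcases lt_trichotomy i j with hij | hij | hij
  · exact ⟨i, hiA, fun h => hiB ((hj i hij).2 h), fun a ha => (hi a ha).trans (hj a (ha.trans hij))⟩
  · exact absurd (hij ▸ hjB) hiB
  · exact ⟨j, (hi j hij).2 hjB, hjC, fun a ha => (hi a (ha.trans hij)).trans (hj a ha)⟩

theorem LexLT.total {A B : Finset (Fin n)} (h : A ≠ B) : LexLT A B ∨ LexLT B A := by
  have hne : (symmDiff A B).Nonempty := by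
    rw [nonempty_iff_ne_empty]
    exact fun h' => h (symmDiff_eq_bot.1 h')
  have hmin : ∀ j < (symmDiff A B).min' hne, (j ∈ A ↔ j ∈ B) := by
    intro j hj
    by_contra hc
    have : j ∈ symmDiff A B := by rw [mem_symmDiff]; tauto
    exact absurd (min'_le _ _ this) (not_le.2 hj)
  rcases mem_symmDiff.1 (min'_mem _ hne) with ⟨h1, h2⟩ | ⟨h1, h2⟩
  · exact Or.inl ⟨_, h1, h2, hmin⟩
  · exact Or.inr ⟨_, h1, h2, fun j hj => (hmin j hj).symm⟩

/-- The number of `k`-sets preceding `A`. -/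
def lexRank (k : ℕ) (A : Finset (Fin n)) : ℕ :=
  ((powersetCard k (univ : Finset (Fin n))).filter fun B => LexLT B A).card

theorem lexRank_lt_lexRank {k : ℕ} {A B : Finset (Fin n)} (hA : A ∈ powersetCard k univ)
    (h : LexLT A B) : lexRank k A < lexRank k B := by
  refine card_lt_card (Finset.ssubset_iff_of_subset ?_ |>.2 ⟨A, mem_filter.2 ⟨hA, h⟩, ?_⟩)
  · intro C hC
    rw [mem_filter] at hC ⊢
    exact ⟨hC.1, hC.2.trans h⟩
  · exact fun h' => LexLT.irrefl A (mem_filter.1 h').2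

theorem lexRank_injOn (k : ℕ) :
    Set.InjOn (lexRank k) (powersetCard k (univ : Finset (Fin n)) : Set (Finset (Fin n))) := by
  intro A hA B hB h
  by_contra hne
  rcases LexLT.total hne with h' | h'
  · exact (lexRank_lt_lexRank hA h').ne h
  · exact (lexRank_lt_lexRank hB h').ne h.symm

theorem lexRank_lt {k : ℕ} {A : Finset (Fin n)} (hA : A ∈ powersetCard k univ) :
    lexRank k A < n.choose k := by
  have : n.choose k = (powersetCard k (univ : Finset (Fin n))).card := by simp
  rw [this]
  refine card_lt_card (Finset.ssubset_iff_of_subset (filter_subset _ _) |>.2 ⟨A, hA, ?_⟩)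
  exact fun h' => LexLT.irrefl A (mem_filter.1 h').2

theorem mem_lexFamily {k m : ℕ} {A : Finset (Fin n)} :
    A ∈ lexFamily n k m ↔ A ∈ powersetCard k univ ∧ lexRank k A < m := by
  rw [lexFamily, mem_filter, lexRank]

theorem card_lexFamily {k m : ℕ} (hm : m ≤ n.choose k) : (lexFamily n k m).card = m := by
  have himg : (powersetCard k (univ : Finset (Fin n))).image (lexRank k) = range (n.choose k) := by
    refine eq_of_subset_of_card_le ?_ ?_
    · intro r hr
      obtain ⟨A, hA, rfl⟩ := mem_image.1 hr
      exact mem_range.2 (lexRank_lt hA)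
    · rw [card_image_of_injOn (lexRank_injOn k)]
      simp
  have : (lexFamily n k m).image (lexRank k) = range m := by
    ext r
    simp only [mem_image, mem_range, mem_lexFamily]
    constructor
    · rintro ⟨A, hA, rfl⟩
      exact hA.2
    · intro hr
      have : r ∈ (powersetCard k (univ : Finset (Fin n))).image (lexRank k) := by
        rw [himg, mem_range]; omega
      obtain ⟨A, hA, rfl⟩ := mem_image.1 this
      exact ⟨A, ⟨hA, hr⟩, rfl⟩
  rw [← card_image_of_injOn (s := lexFamily n k m) (f := lexRank k), this, card_range]
  exact (lexRank_injOn k).mono fun A hA => (mem_lexFamily.1 hA).1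

/-- Initial segments of the `k`-sets are comparable with the lexicographic families. -/
theorem subset_lexFamily {k m : ℕ} {I : Finset (Finset (Fin n))} (hI : I ⊆ powersetCard k univ)
    (hdown : ∀ A ∈ I, ∀ B ∈ powersetCard k univ, LexLT B A → B ∈ I) (hm : I.card ≤ m) :
    I ⊆ lexFamily n k m := by
  intro A hA
  refine mem_lexFamily.2 ⟨hI hA, lt_of_lt_of_le ?_ hm⟩
  refine card_lt_card (Finset.ssubset_iff_of_subset ?_ |>.2 ⟨A, hA, ?_⟩)
  · intro B hB
    exact hdown A hA B (mem_filter.1 hB).1 (mem_filter.1 hB).2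
  · exact fun h' => LexLT.irrefl A (mem_filter.1 h').2

theorem lexFamily_subset {k m : ℕ} {I : Finset (Finset (Fin n))} (hI : I ⊆ powersetCard k univ)
    (hdown : ∀ A ∈ I, ∀ B ∈ powersetCard k univ, LexLT B A → B ∈ I) (hm : m ≤ I.card) :
    lexFamily n k m ⊆ I := by
  intro A hA
  obtain ⟨hA, hr⟩ := mem_lexFamily.1 hA
  by_contra hAI
  refine absurd (lt_of_lt_of_le hr hm) (not_lt.2 (card_le_card fun B hB => mem_filter.2 ?_))
  refine ⟨hI hB, ?_⟩
  rcases LexLT.total (show A ≠ B from fun h => hAI (h ▸ hB)) with h | h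
  · exact absurd (hdown B hB A hA h) hAI
  · exact h

/-- The `k`-sets meeting `X`. -/
def touching (k : ℕ) (X : Finset (Fin n)) : Finset (Finset (Fin n)) :=
  (powersetCard k univ).filter fun A => ¬ Disjoint A X

theorem mem_touching {k : ℕ} {X A : Finset (Fin n)} :
    A ∈ touching k X ↔ A.card = k ∧ ¬ Disjoint A X := by
  simp [touching, mem_powersetCard]

theorem card_filter_disjoint (k : ℕ) (X : Finset (Fin n)) :
    ((powersetCard k univ).filter fun A => Disjoint A X).card = (n - X.card).choose k := by
  have : (powersetCard k univ).filter (fun A => Disjoint A X) = powersetCard k (univ \ X) := by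
    ext A
    simp only [mem_filter, mem_powersetCard, subset_univ, true_and, subset_sdiff]
    tauto
  rw [this, card_powersetCard, card_univ_sdiff, Fintype.card_fin]

theorem card_touching_add (k : ℕ) (X : Finset (Fin n)) :
    (touching k X).card + (n - X.card).choose k = n.choose k := by
  rw [← card_filter_disjoint, touching, add_comm, card_filter_add_card_filter_not]
  simp

/-- The first `l` points. -/
def firstPoints (n l : ℕ) : Finset (Fin n) := univ.filter fun x => x.val < l

theorem card_filter_val_Ico {a b : ℕ} (hb : b ≤ n) :
    (univ.filter fun x : Fin n => a ≤ x.val ∧ x.val < b).card = b - a := by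
  rw [← Nat.card_Ico, ← card_image_of_injective _ Fin.val_injective]
  congr 1
  ext x
  simp only [mem_image, mem_filter, mem_univ, true_and, mem_Ico]
  constructor
  · rintro ⟨y, hy, rfl⟩; exact hy
  · exact fun h => ⟨⟨x, by omega⟩, h, rfl⟩

theorem card_firstPoints {l : ℕ} (hl : l ≤ n) : (firstPoints n l).card = l := by
  have := card_filter_val_Ico (n := n) (a := 0) hl
  simpa [firstPoints] using this

/-- The shape of the lexicographic families in the range considered: all `k`-sets meeting an
`l`-set `X`, together with some `k`-sets off `X` containing a fixed `(k-1)`-set `K`. -/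
theorem lexFamily_eq_union {k l m : ℕ} (hk : 1 ≤ k) (hn : l + k ≤ n)
    (h1 : (n.choose k : ℤ) - ((n - l).choose k : ℤ) ≤ (m : ℤ))
    (h2 : (m : ℤ) ≤ (n.choose k : ℤ) - ((n - l).choose k : ℤ) + (n : ℤ) - (l : ℤ) - (k : ℤ) + 1)
    (hm : m ≤ n.choose k) :
    ∃ (X K : Finset (Fin n)) (R : Finset (Finset (Fin n))), X.card = l ∧ K.card + 1 = k ∧
      Disjoint K X ∧ (∀ A ∈ R, A.card = k ∧ Disjoint A X ∧ K ⊆ A) ∧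
      lexFamily n k m = touching k X ∪ R ∧ (touching k X).card + R.card = m := by
  set X := firstPoints n l with hX
  set K : Finset (Fin n) := univ.filter fun x : Fin n => l ≤ x.val ∧ x.val < l + k - 1 with hK
  have hXc : X.card = l := card_firstPoints (by omega)
  have hKc : K.card + 1 = k := by rw [hK, card_filter_val_Ico (by omega)]; omega
  have hKX : Disjoint K X := by
    rw [disjoint_left]
    intro x hx hx'
    simp only [hK, hX, firstPoints, mem_filter] at hx hx'
    omega
  set Rf := (powersetCard k univ).filter fun A => Disjoint A X ∧ K ⊆ A with hRf
  have hdisj : Disjoint (touching k X) Rf := by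
    rw [disjoint_left]
    intro A hA hA'
    exact (mem_touching.1 hA).2 (mem_filter.1 hA').2.1
  have hSc := card_touching_add k X
  rw [hXc] at hSc
  -- Each such set is `K` plus one point at position at least `l + k - 1` (counting from 0). The
  -- number of choices is exactly the width of the admissible interval for `m`.
  have hRfc : Rf.card = n - l - k + 1 := by
    have : (univ.filter fun x : Fin n => l + k - 1 ≤ x.val ∧ x.val < n).card = Rf.card := by
      refine card_bij (fun x _ => insert x K) ?_ ?_ ?_
      · intro x hx
        have hx := (mem_filter.1 hx).2
        have hxK : x ∉ K := by simp only [hK, mem_filter]; omega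
        refine mem_filter.2 ⟨mem_powersetCard.2 ⟨subset_univ _, ?_⟩, ?_, subset_insert _ _⟩
        · rw [card_insert_of_notMem hxK, hKc]
        · rw [disjoint_insert_left]
          refine ⟨?_, hKX⟩
          simp only [hX, firstPoints, mem_filter]; omega
      · intro x hx y hy h
        have hx := (mem_filter.1 hx).2
        have hxK : x ∉ K := by simp only [hK, mem_filter]; omega
        have : x ∈ insert y K := h ▸ mem_insert_self x K
        exact (mem_insert.1 this).resolve_right hxK
      · intro A hA
        obtain ⟨hA1, hA2, hA3⟩ := mem_filter.1 hA
        have hAc := (mem_powersetCard.1 hA1).2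
        have : (A \ K).card = 1 := by rw [card_sdiff_of_subset hA3]; omega
        obtain ⟨x, hx⟩ := card_eq_one.1 this
        have hxA : x ∈ A \ K := hx ▸ mem_singleton_self x
        rw [mem_sdiff] at hxA
        refine ⟨x, ?_, ?_⟩
        · have hxX := disjoint_left.1 hA2 hxA.1
          have hxK := hxA.2
          simp only [hX, hK, firstPoints, mem_filter, mem_univ, true_and] at hxX hxK ⊢
          have := x.2
          omega
        · rw [insert_eq, ← hx, sdiff_union_of_subset hA3]
    rw [← this, card_filter_val_Ico le_rfl]
    omega
  have hsub : touching k X ⊆ lexFamily n k m := by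
    refine subset_lexFamily (filter_subset _ _) ?_ (by omega)
    rintro A hA B hB ⟨i, hiB, hiA, hi⟩
    refine mem_touching.2 ⟨(mem_powersetCard.1 hB).2, ?_⟩
    obtain ⟨x, hxA, hxX⟩ := not_disjoint_iff.1 (mem_touching.1 hA).2
    rcases lt_or_ge x i with h | h
    · exact not_disjoint_iff.2 ⟨x, (hi x h).2 hxA, hxX⟩
    · refine not_disjoint_iff.2 ⟨i, hiB, ?_⟩
      simp only [hX, firstPoints, mem_filter, mem_univ, true_and] at hxX ⊢
      exact lt_of_le_of_lt h hxX
  have hsup : lexFamily n k m ⊆ touching k X ∪ Rf := by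
    refine lexFamily_subset (union_subset (filter_subset _ _) (filter_subset _ _)) ?_ (by rw [card_union_of_disjoint hdisj]; omega)
    rintro A hA B hB ⟨i, hiB, hiA, hi⟩
    -- When `B` misses `X`, the first difference `i` is not in `X`. If moreover `K ⊆ A`, then `i ∉
    -- K`; so `i` comes after both blocks and `B` agrees with `A` on them.
    by_cases hBX : Disjoint B X
    · refine mem_union_right _ (mem_filter.2 ⟨hB, hBX, ?_⟩)
      have hil : ¬ i.val < l := by
        have := disjoint_left.1 hBX hiB
        simpa [hX, firstPoints] using this
      have hAX : Disjoint A X := by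
        rw [disjoint_left]
        intro x hxA hxX
        have : x < i := by
          simp only [hX, firstPoints, mem_filter, mem_univ, true_and] at hxX
          exact Fin.lt_def.2 (by omega)
        exact disjoint_left.1 hBX ((hi x this).2 hxA) hxX
      rcases mem_union.1 hA with hA | hA
      · exact absurd hAX (mem_touching.1 hA).2
      · have hKA := (mem_filter.1 hA).2.2
        intro x hx
        have hiK : i ∉ K := fun h => hiA (hKA h)
        have : x < i := by
          simp only [hK, mem_filter, mem_univ, true_and] at hiK hx
          exact Fin.lt_def.2 (by omega)
        exact (hi x this).2 (hKA hx)
    · exact mem_union_left _ (mem_touching.2 ⟨(mem_powersetCard.1 hB).2, hBX⟩)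
  refine ⟨X, K, lexFamily n k m \ touching k X, hXc, hKc, hKX, ?_, ?_, ?_⟩
  · intro A hA
    rw [mem_sdiff] at hA
    rcases mem_union.1 (hsup hA.1) with h | h
    · exact absurd h hA.2
    · obtain ⟨h1, h2, h3⟩ := mem_filter.1 h
      exact ⟨(mem_powersetCard.1 h1).2, h2, h3⟩
  · rw [union_sdiff_of_subset hsub]
  · rw [card_sdiff_of_subset hsub, card_lexFamily hm]
    have := card_le_card hsub
    rw [card_lexFamily hm] at this
    omega

/-! ### Inequalities between binomial coefficients. -/

/-- The ratio C(d,t)/d is nondecreasing in d. This normalises a star of size d against a full star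
of size D, and also gives C(D,t) - C(D-m,t) ≥ (m/D)·C(D,t), the gain from adding m members to a
star. -/
theorem mul_choose_le_mul_choose {d D t : ℕ} (h : d ≤ D) (ht : 1 ≤ t) :
    D * d.choose t ≤ d * D.choose t := by
  obtain ⟨t, rfl⟩ : ∃ s, t = s + 1 := ⟨t - 1, by omega⟩
  rcases d with _ | d
  · simp
  obtain ⟨D, rfl⟩ : ∃ s, D = s + 1 := ⟨D - 1, by omega⟩
  have h1 := Nat.add_one_mul_choose_eq d t
  have h2 := Nat.add_one_mul_choose_eq D t
  have h3 : d.choose t ≤ D.choose t := Nat.choose_le_choose _ (by omega)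
  refine Nat.le_of_mul_le_mul_right ?_ (by omega : 0 < t + 1)
  calc (D + 1) * (d + 1).choose (t + 1) * (t + 1)
      = (D + 1) * ((d + 1).choose (t + 1) * (t + 1)) := by ring
    _ = (D + 1) * ((d + 1) * d.choose t) := by rw [h1]
    _ ≤ (D + 1) * ((d + 1) * D.choose t) := by gcongr
    _ = (d + 1) * ((D + 1) * D.choose t) := by ring
    _ = _ := by rw [h2]; ring

theorem sq_mul_choose_le_sq_mul_choose {d D t : ℕ} (h : d ≤ D) (ht : 2 ≤ t) :
    D ^ 2 * d.choose t ≤ d ^ 2 * D.choose t := by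
  obtain ⟨t, rfl⟩ : ∃ s, t = s + 2 := ⟨t - 2, by omega⟩
  rcases d with _ | d
  · simp
  obtain ⟨D, rfl⟩ : ∃ s, D = s + 1 := ⟨D - 1, by omega⟩
  have h1 := Nat.add_one_mul_choose_eq d (t + 1)
  have h2 := Nat.add_one_mul_choose_eq D (t + 1)
  have h3 := mul_choose_le_mul_choose (d := d) (D := D) (t := t + 1) (by omega) (by omega)
  have h4 : (D + 1) * d.choose (t + 1) ≤ (d + 1) * D.choose (t + 1) := by
    have : d.choose (t + 1) ≤ D.choose (t + 1) := Nat.choose_le_choose _ (by omega)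
    nlinarith
  refine Nat.le_of_mul_le_mul_right ?_ (by omega : 0 < t + 1 + 1)
  calc (D + 1) ^ 2 * (d + 1).choose (t + 2) * (t + 1 + 1)
      = (D + 1) ^ 2 * ((d + 1).choose (t + 1 + 1) * (t + 1 + 1)) := by ring
    _ = (D + 1) * (d + 1) * ((D + 1) * d.choose (t + 1)) := by rw [← h1]; ring
    _ ≤ (D + 1) * (d + 1) * ((d + 1) * D.choose (t + 1)) := by gcongr
    _ = (d + 1) ^ 2 * ((D + 1) * D.choose (t + 1)) := by ring
    _ = _ := by rw [h2]; ring

theorem choose_mul_choose_le_choose_add (a b r s : ℕ) :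
    a.choose r * b.choose s ≤ (a + b).choose (r + s) := by
  rw [Nat.add_choose_eq]
  exact single_le_sum (f := fun ij : ℕ × ℕ => a.choose ij.1 * b.choose ij.2)
    (fun _ _ => Nat.zero_le _) (mem_antidiagonal.2 (rfl : (r, s).1 + (r, s).2 = r + s))

/-- A single term of Vandermonde's identity. Together with `pow_le_mul_choose` it shows that
lowering the bottom index by s and the top index from b to a costs a factor of order (b - a)^s. -/
theorem choose_mul_choose_sub_le {a b t s : ℕ} (hab : a ≤ b) (hst : s ≤ t) :
    a.choose (t - s) * (b - a).choose s ≤ b.choose t := by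
  have := choose_mul_choose_le_choose_add a (b - a) (t - s) s
  rwa [Nat.add_sub_cancel' hab, Nat.sub_add_cancel hst] at this

/-- The quotient of the two coefficients is a/b. Hence for large n each of C(n-1,k-1), C(n-2,k-2),
C(n-3,k-3) exceeds any prescribed multiple of the next. -/
theorem mul_choose_pred_le {a b c : ℕ} (hb : 1 ≤ b) (h : c * b ≤ a) (ha : 1 ≤ a) :
    c * (a - 1).choose (b - 1) ≤ a.choose b := by
  obtain ⟨b, rfl⟩ : ∃ s, b = s + 1 := ⟨b - 1, by omega⟩
  obtain ⟨a, rfl⟩ : ∃ s, a = s + 1 := ⟨a - 1, by omega⟩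
  have h1 := Nat.add_one_mul_choose_eq a b
  simp only [Nat.add_sub_cancel]
  refine Nat.le_of_mul_le_mul_right ?_ (Nat.succ_pos b)
  calc c * a.choose b * (b + 1) = c * (b + 1) * a.choose b := by ring
    _ ≤ (a + 1) * a.choose b := by gcongr
    _ = _ := h1

/-- A power is bounded by a constant times a binomial coefficient. -/
theorem pow_le_mul_choose {D N s : ℕ} (h : D ≤ 2 * (N + 1 - s)) :
    D ^ s ≤ 2 ^ s * s.factorial * N.choose s := by
  have h1 : (N + 1 - s) ^ s ≤ s.factorial * N.choose s := by
    rw [← Nat.descFactorial_eq_factorial_mul_choose]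
    exact Nat.pow_sub_le_descFactorial N s
  calc D ^ s ≤ (2 * (N + 1 - s)) ^ s := Nat.pow_le_pow_left h s
    _ = 2 ^ s * (N + 1 - s) ^ s := mul_pow _ _ _
    _ ≤ 2 ^ s * (s.factorial * N.choose s) := by gcongr
    _ = _ := by ring

/-! ### Counting `k`-sets through prescribed points. -/

theorem card_filter_superset (k : ℕ) (s : Finset (Fin n)) (hs : s.card ≤ k) :
    ((powersetCard k univ).filter (s ⊆ ·)).card = (n - s.card).choose (k - s.card) := by
  have : (n - s.card).choose (k - s.card) = (powersetCard (k - s.card) (univ \ s)).card := by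
    rw [card_powersetCard, card_univ_sdiff, Fintype.card_fin]
  rw [this]
  refine card_nbij' (fun A => A \ s) (fun B => B ∪ s) ?_ ?_ ?_ ?_
  · intro A hA
    obtain ⟨h1, h2⟩ := mem_filter.1 hA
    refine mem_powersetCard.2 ⟨sdiff_subset_sdiff (subset_univ _) le_rfl, ?_⟩
    rw [card_sdiff_of_subset h2, (mem_powersetCard.1 h1).2]
  · intro B hB
    obtain ⟨h1, h2⟩ := mem_powersetCard.1 hB
    refine mem_filter.2 ⟨mem_powersetCard.2 ⟨subset_univ _, ?_⟩, subset_union_right⟩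
    rw [card_union_of_disjoint (subset_sdiff.1 h1).2, h2]
    omega
  · intro A hA
    exact sdiff_union_of_subset (mem_filter.1 hA).2
  · intro B hB
    change (B ∪ s) \ s = B
    rw [union_sdiff_right]
    exact sdiff_eq_self_of_disjoint (subset_sdiff.1 (mem_powersetCard.1 hB).1).2

theorem card_filter_mem {k : ℕ} (hk : 1 ≤ k) (x : Fin n) :
    ((powersetCard k univ).filter (x ∈ ·)).card = (n - 1).choose (k - 1) := by
  have := card_filter_superset k {x} (by simpa using hk)
  simpa using this

theorem card_filter_mem_mem {k : ℕ} (hk : 2 ≤ k) {x y : Fin n} (h : x ≠ y) :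
    ((powersetCard k univ).filter fun A => x ∈ A ∧ y ∈ A).card = (n - 2).choose (k - 2) := by
  have hc : ({x, y} : Finset (Fin n)).card = 2 := card_pair h
  have := card_filter_superset k {x, y} (by rw [hc]; exact hk)
  rw [hc] at this
  rw [← this]
  congr 1
  ext A
  simp [insert_subset_iff]

theorem card_filter_mem_mem_mem {k : ℕ} (hk : 3 ≤ k) {x y z : Fin n} (h1 : x ≠ y) (h2 : x ≠ z)
    (h3 : y ≠ z) :
    ((powersetCard k univ).filter fun A => x ∈ A ∧ y ∈ A ∧ z ∈ A).card =
      (n - 3).choose (k - 3) := by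
  have hc : ({x, y, z} : Finset (Fin n)).card = 3 := card_eq_three.2 ⟨x, y, z, h1, h2, h3, rfl⟩
  have := card_filter_superset k {x, y, z} (by rw [hc]; exact hk)
  rw [hc] at this
  rw [← this]
  congr 1
  ext A
  simp [insert_subset_iff]

/-- A family of `k`-sets each containing a point of `U` and another point of `V` is small. -/
theorem card_le_of_pair {k : ℕ} (hk : 2 ≤ k) {P : Finset (Finset (Fin n))} (U V : Finset (Fin n))
    (h : ∀ A ∈ P, A.card = k ∧ ∃ x ∈ U, ∃ y ∈ V, x ≠ y ∧ x ∈ A ∧ y ∈ A) :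
    P.card ≤ U.card * V.card * (n - 2).choose (k - 2) := by
  have hsub : P ⊆ ((U ×ˢ V).filter fun p => p.1 ≠ p.2).biUnion fun p =>
      (powersetCard k univ).filter fun A => p.1 ∈ A ∧ p.2 ∈ A := by
    intro A hA
    obtain ⟨hc, x, hx, y, hy, hxy, hxA, hyA⟩ := h A hA
    exact mem_biUnion.2 ⟨(x, y), mem_filter.2 ⟨mk_mem_product hx hy, hxy⟩,
      mem_filter.2 ⟨mem_powersetCard.2 ⟨subset_univ _, hc⟩, hxA, hyA⟩⟩
  refine (card_le_card hsub).trans (card_biUnion_le_card_mul _ _ ((n - 2).choose (k - 2)) ?_ |>.trans ?_)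
  · intro p hp
    exact (card_filter_mem_mem hk (mem_filter.1 hp).2).le
  · refine Nat.mul_le_mul_right _ ((card_filter_le _ _).trans ?_)
    rw [card_product]

/-- A family of `k`-sets each containing distinct points of `U`, `V` and `W` is very small. -/
theorem card_le_of_triple {k : ℕ} (hk : 3 ≤ k) {P : Finset (Finset (Fin n))}
    (U V W : Finset (Fin n))
    (h : ∀ A ∈ P, A.card = k ∧ ∃ x ∈ U, ∃ y ∈ V, ∃ z ∈ W, x ≠ y ∧ x ≠ z ∧ y ≠ z ∧
      x ∈ A ∧ y ∈ A ∧ z ∈ A) :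
    P.card ≤ U.card * (V.card * W.card) * (n - 3).choose (k - 3) := by
  have hsub : P ⊆ ((U ×ˢ (V ×ˢ W)).filter fun p => p.1 ≠ p.2.1 ∧ p.1 ≠ p.2.2 ∧ p.2.1 ≠ p.2.2).biUnion
      fun p => (powersetCard k univ).filter fun A => p.1 ∈ A ∧ p.2.1 ∈ A ∧ p.2.2 ∈ A := by
    intro A hA
    obtain ⟨hc, x, hx, y, hy, z, hz, h1, h2, h3, hxA, hyA, hzA⟩ := h A hA
    exact mem_biUnion.2 ⟨(x, y, z), mem_filter.2 ⟨mk_mem_product hx (mk_mem_product hy hz),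
      h1, h2, h3⟩, mem_filter.2 ⟨mem_powersetCard.2 ⟨subset_univ _, hc⟩, hxA, hyA, hzA⟩⟩
  refine (card_le_card hsub).trans (card_biUnion_le_card_mul _ _ ((n - 3).choose (k - 3)) ?_ |>.trans ?_)
  · intro p hp
    obtain ⟨h1, h2, h3⟩ := (mem_filter.1 hp).2
    exact (card_filter_mem_mem_mem hk h1 h2 h3).le
  · refine Nat.mul_le_mul_right _ ((card_filter_le _ _).trans ?_)
    rw [card_product, card_product]

/-! ### Degrees, stars, and intersecting families without a common point. -/

/-- The number of members of `F` containing `x`. -/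
def deg (F : Finset (Finset (Fin n))) (x : Fin n) : ℕ := (F.filter (x ∈ ·)).card

theorem deg_le {k : ℕ} (hk : 1 ≤ k) {F : Finset (Finset (Fin n))}
    (hF : (F : Set (Finset (Fin n))).Sized k) (x : Fin n) :
    deg F x ≤ (n - 1).choose (k - 1) := by
  rw [← card_filter_mem hk x]
  refine card_le_card fun A hA => ?_
  obtain ⟨h1, h2⟩ := mem_filter.1 hA
  exact mem_filter.2 ⟨mem_powersetCard.2 ⟨subset_univ _, hF h1⟩, h2⟩

theorem sum_deg (F : Finset (Finset (Fin n))) (W : Finset (Fin n)) :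
    ∑ x ∈ W, deg F x = ∑ A ∈ F, (A ∩ W).card := by
  simp only [deg, card_filter]
  rw [sum_comm]
  refine sum_congr rfl fun A _ => ?_
  rw [← card_filter, filter_mem_eq_inter, inter_comm]

theorem sum_deg_univ {k : ℕ} {F : Finset (Finset (Fin n))}
    (hF : (F : Set (Finset (Fin n))).Sized k) : ∑ x, deg F x = F.card * k := by
  rw [sum_deg, card_eq_sum_ones, sum_mul]
  refine sum_congr rfl fun A hA => ?_
  rw [inter_univ, hF hA, one_mul]

/-- By Bonferroni, the overcount comes only from sets containing two points of `W`. So boundedly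
many vertices cannot share more than |F| + O(E) of degree; this is the only constraint on degrees
used in the stability argument. -/
theorem sum_deg_le {k : ℕ} (hk : 2 ≤ k) {F : Finset (Finset (Fin n))}
    (hF : (F : Set (Finset (Fin n))).Sized k) (W : Finset (Fin n)) :
    ∑ x ∈ W, deg F x ≤ F.card + W.card ^ 2 * (n - 2).choose (k - 2) := by
  refine (sum_card_le_card_biUnion_add W fun x => F.filter (x ∈ ·)).trans ?_
  refine Nat.add_le_add (card_le_card (biUnion_subset.2 fun x _ => filter_subset _ _)) ?_
  calc ∑ p ∈ W.offDiag, _ ≤ ∑ p ∈ W.offDiag, (n - 2).choose (k - 2) := by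
        refine sum_le_sum fun p hp => ?_
        rw [← card_filter_mem_mem hk (mem_offDiag.1 hp).2.2]
        refine card_le_card fun A hA => ?_
        obtain ⟨h1, h2⟩ := mem_inter.1 hA
        exact mem_filter.2 ⟨mem_powersetCard.2 ⟨subset_univ _, hF (mem_filter.1 h1).1⟩,
          (mem_filter.1 h1).2, (mem_filter.1 h2).2⟩
    _ ≤ _ := by
        rw [sum_const, smul_eq_mul]
        refine Nat.mul_le_mul_right _ ?_
        rw [offDiag_card, sq]
        exact Nat.sub_le _ _

/-- The `k`-sets containing at least two points of `U`. -/
def pairSets (k : ℕ) (U : Finset (Fin n)) : Finset (Finset (Fin n)) :=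
  (powersetCard k univ).filter fun A => ∃ x ∈ U, ∃ y ∈ U, x ≠ y ∧ x ∈ A ∧ y ∈ A

theorem card_pairSets_le {k u : ℕ} (hk : 2 ≤ k) {U : Finset (Fin n)} (hU : U.card ≤ u) :
    (pairSets k U).card ≤ u ^ 2 * (n - 2).choose (k - 2) := by
  refine (card_le_of_pair hk U U fun A hA => ?_).trans ?_
  · obtain ⟨h1, h2⟩ := mem_filter.1 hA
    exact ⟨(mem_powersetCard.1 h1).2, h2⟩
  · rw [sq]
    gcongr

/-- If the members of `H` have no common point, any set meeting all of them contains two points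
of the union of those members of `H` that differ from it. -/
theorem mem_pairSets {k : ℕ} {H : Finset (Finset (Fin n))} {B : Finset (Fin n)}
    (hBk : B.card = k) (hne : (H.erase B).Nonempty) (hH : ∀ x, ∃ A ∈ H, x ∉ A)
    (hB : ∀ A ∈ H, ¬ Disjoint A B) : B ∈ pairSets k ((H.erase B).biUnion id) := by
  obtain ⟨A, hA⟩ := hne
  obtain ⟨x, hxA, hxB⟩ := not_disjoint_iff.1 (hB A (mem_erase.1 hA).2)
  obtain ⟨A', hA', hxA'⟩ := hH x
  have hne : A' ≠ B := fun h => hxA' (h ▸ hxB)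
  obtain ⟨y, hyA', hyB⟩ := not_disjoint_iff.1 (hB A' hA')
  refine mem_filter.2 ⟨mem_powersetCard.2 ⟨subset_univ _, hBk⟩, x, ?_, y, ?_, ?_, hxB, hyB⟩
  · exact mem_biUnion.2 ⟨A, hA, hxA⟩
  · exact mem_biUnion.2 ⟨A', mem_erase.2 ⟨hne, hA'⟩, hyA'⟩
  · rintro rfl
    exact hxA' hyA'

theorem card_biUnion_id_le {k s : ℕ} {H : Finset (Finset (Fin n))} (hH : ∀ A ∈ H, A.card = k)
    (hs : H.card ≤ s) : (H.biUnion id).card ≤ k * s := by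
  refine (card_biUnion_le_card_mul _ _ k fun A hA => (hH A hA).le).trans ?_
  rw [mul_comm]
  gcongr

/-- The intersecting subfamilies whose members have no point in common. -/
def nontrivialSubfamilies (F : Finset (Finset (Fin n))) (t : ℕ) :
    Finset (Finset (Finset (Fin n))) :=
  (intersectingSubfamilies F t).filter fun G => ∀ x, ∃ A ∈ G, x ∉ A

/-- Fix a member A and, for each of its points, a member avoiding that point: at most k + 1 members
with empty common intersection, padded to exactly s of them. Every member of the subfamily then
contains two points of the union of the others among these s. So s - 1 of them are chosen freely in
`F`, while the last one and the remaining t - s members come from collections of size O(E). -/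
theorem card_nontrivialSubfamilies_le {k t : ℕ} (hk : 2 ≤ k) (ht : 2 ≤ t)
    {F : Finset (Finset (Fin n))} (hF : (F : Set (Finset (Fin n))).Sized k) :
    (nontrivialSubfamilies F t).card ≤
      F.card ^ (min t (k + 1) - 1) * (((k * (k + 1)) ^ 2 * (n - 2).choose (k - 2)) *
        ((k * (k + 1)) ^ 2 * (n - 2).choose (k - 2)).choose (t - min t (k + 1))) := by
  set s := min t (k + 1) with hs
  set M := (k * (k + 1)) ^ 2 * (n - 2).choose (k - 2) with hM
  have hs2 : 2 ≤ s := by omega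
  have hsub : nontrivialSubfamilies F t ⊆
      (powersetCard (s - 1) F).biUnion fun H => (pairSets k (H.biUnion id)).biUnion fun B =>
        (powersetCard (t - s) (pairSets k ((insert B H).biUnion id))).image
          fun G => insert B H ∪ G := by
    intro G hG
    obtain ⟨hG, hnt⟩ := mem_filter.1 hG
    obtain ⟨⟨hGF, hGc⟩, hGi⟩ := mem_intersectingSubfamilies.1 hG
    obtain ⟨H, hHG, hHc, hH⟩ : ∃ H ⊆ G, H.card = s ∧ ∀ x, ∃ A ∈ H, x ∉ A := by
      obtain ⟨A, hA⟩ : G.Nonempty := card_pos.1 (by omega)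
      choose B hB hxB using hnt
      have hsub : insert A (A.image B) ⊆ G := by
        refine insert_subset hA fun C hC => ?_
        obtain ⟨x, _, rfl⟩ := mem_image.1 hC
        exact hB x
      have hcard : (insert A (A.image B)).card ≤ s := by
        refine le_min (hGc ▸ card_le_card hsub) ((card_insert_le _ _).trans ?_)
        exact Nat.add_le_add_right (card_image_le.trans (hF (hGF hA)).le) 1
      obtain ⟨H, h1, h2, h3⟩ := exists_subsuperset_card_eq hsub hcard (by omega)
      refine ⟨H, h2, h3, fun x => ?_⟩
      by_cases hx : x ∈ A
      · exact ⟨B x, h1 (mem_insert_of_mem (mem_image_of_mem _ hx)), hxB x⟩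
      · exact ⟨A, h1 (mem_insert_self _ _), hx⟩
    obtain ⟨B, hB⟩ : H.Nonempty := card_pos.1 (by omega)
    have hec : (H.erase B).card = s - 1 := by rw [card_erase_of_mem hB, hHc]
    have hpair : ∀ C ∈ G, C ∈ pairSets k ((H.erase C).biUnion id) := by
      intro C hC
      refine mem_pairSets (hF (hGF hC)) (card_pos.1 ?_) hH fun A hA => hGi (hHG hA) hC
      have := pred_card_le_card_erase (s := H) (a := C)
      omega
    refine mem_biUnion.2 ⟨H.erase B, mem_powersetCard.2 ⟨(erase_subset _ _).trans
      (hHG.trans hGF), hec⟩, mem_biUnion.2 ⟨B, hpair B (hHG hB), mem_image.2 ⟨G \ H, ?_, ?_⟩⟩⟩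
    · rw [insert_erase hB]
      refine mem_powersetCard.2 ⟨fun C hC => ?_, by rw [card_sdiff_of_subset hHG, hGc, hHc]⟩
      have h1 := hpair C (mem_sdiff.1 hC).1
      rwa [erase_eq_of_notMem (mem_sdiff.1 hC).2] at h1
    · rw [insert_erase hB, union_sdiff_of_subset hHG]
  refine (card_le_card hsub).trans ((card_biUnion_le_card_mul _ _ (M * M.choose (t - s)) ?_).trans ?_)
  · intro H hH
    obtain ⟨hHF, hHc⟩ := mem_powersetCard.1 hH
    refine (card_biUnion_le_card_mul _ _ (M.choose (t - s)) ?_).trans ?_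
    · intro B hB
      refine card_image_le.trans ?_
      rw [card_powersetCard]
      refine Nat.choose_le_choose _ (card_pairSets_le hk (card_biUnion_id_le ?_ ?_))
      · intro A hA
        rcases mem_insert.1 hA with rfl | hA
        · exact (mem_powersetCard.1 (mem_filter.1 hB).1).2
        · exact hF (hHF hA)
      · refine (card_insert_le _ _).trans ?_
        omega
    · refine Nat.mul_le_mul_right _ (card_pairSets_le hk (card_biUnion_id_le ?_ ?_))
      · exact fun A hA => hF (hHF hA)
      · omega
  · rw [card_powersetCard]
    exact Nat.mul_le_mul_right _ (Nat.choose_le_pow _ _)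

/-- The constant in the bound for the number of nontrivial intersecting subfamilies. -/
def nontrivialConst (k c : ℕ) : ℕ :=
  c ^ k * ((k * (k + 1)) ^ 2 * (2 ^ (k + 1) * (k + 1).factorial))

/-- Relative to a full star, the subfamilies without a common point number only O(E/D)·C(D,t): the
bounded power D^s is absorbed into C(D-M,s), and C(M,t-s)·C(D-M,s) ≤ C(D,t). The constant does not
depend on `t`. -/
theorem mul_card_nontrivialSubfamilies_le {k t c : ℕ} (hk : 2 ≤ k) (ht : 2 ≤ t) (hc : 1 ≤ c)
    {F : Finset (Finset (Fin n))} (hF : (F : Set (Finset (Fin n))).Sized k)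
    (hFc : F.card ≤ c * (n - 1).choose (k - 1))
    (hn : 2 * ((k * (k + 1)) ^ 2 * (n - 2).choose (k - 2)) + 2 * (k + 1) ≤
      (n - 1).choose (k - 1)) :
    (n - 1).choose (k - 1) * (nontrivialSubfamilies F t).card ≤
      nontrivialConst k c * (n - 2).choose (k - 2) * ((n - 1).choose (k - 1)).choose t := by
  have h1 := card_nontrivialSubfamilies_le hk ht hF
  set D := (n - 1).choose (k - 1) with hD
  set E := (n - 2).choose (k - 2) with hE
  set s := min t (k + 1) with hs
  set M := (k * (k + 1)) ^ 2 * E with hM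
  have hs2 : 2 ≤ s := by omega
  have h2 : D ^ s ≤ 2 ^ (k + 1) * (k + 1).factorial * (D - M).choose s := by
    refine (pow_le_mul_choose (N := D - M) (s := s) (by omega)).trans ?_
    refine Nat.mul_le_mul_right _ (Nat.mul_le_mul (Nat.pow_le_pow_right (by norm_num) (by omega)) ?_)
    exact Nat.factorial_le (by omega)
  have h3 := choose_mul_choose_sub_le (a := M) (b := D) (t := t) (s := s) (by omega) (by omega)
  have h4 : c ^ (s - 1) ≤ c ^ k := Nat.pow_le_pow_right hc (by omega)
  have h5 : D * D ^ (s - 1) = D ^ s := by rw [← pow_succ']; congr 1; omega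
  calc D * (nontrivialSubfamilies F t).card
      ≤ D * ((c * D) ^ (s - 1) * (M * M.choose (t - s))) := by
        refine Nat.mul_le_mul_left _ (h1.trans ?_)
        gcongr
    _ = c ^ (s - 1) * (M * M.choose (t - s)) * (D * D ^ (s - 1)) := by rw [mul_pow]; ring
    _ ≤ c ^ k * (M * M.choose (t - s)) *
          (2 ^ (k + 1) * (k + 1).factorial * (D - M).choose s) := by rw [h5]; gcongr
    _ = c ^ k * M * (2 ^ (k + 1) * (k + 1).factorial) *
          (M.choose (t - s) * (D - M).choose s) := by ring
    _ ≤ c ^ k * M * (2 ^ (k + 1) * (k + 1).factorial) * D.choose t := by gcongr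
    _ = _ := by rw [hM, nontrivialConst]; ring

theorem intersectingCount_le_sum_add (F : Finset (Finset (Fin n))) (t : ℕ) :
    intersectingCount F t ≤ ∑ x, (deg F x).choose t + (nontrivialSubfamilies F t).card := by
  have hsub : intersectingSubfamilies F t ⊆
      (univ.biUnion fun x => powersetCard t (F.filter (x ∈ ·))) ∪ nontrivialSubfamilies F t := by
    intro G hG
    obtain ⟨⟨hGF, hGc⟩, hGi⟩ := mem_intersectingSubfamilies.1 hG
    by_cases h : ∀ x, ∃ A ∈ G, x ∉ A
    · exact mem_union_right _ (mem_filter.2 ⟨hG, h⟩)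
    · push Not at h
      obtain ⟨x, hx⟩ := h
      refine mem_union_left _ (mem_biUnion.2 ⟨x, mem_univ _, mem_powersetCard.2 ⟨?_, hGc⟩⟩)
      exact fun A hA => mem_filter.2 ⟨hGF hA, hx A hA⟩
  refine (card_le_card hsub).trans ((card_union_le _ _).trans (Nat.add_le_add_right
    (card_biUnion_le.trans (sum_le_sum fun x _ => ?_)) _))
  rw [card_powersetCard, deg]

/-- Families of sets through a common point are intersecting. -/
theorem intersecting_of_mem {G : Finset (Finset (Fin n))} {x : Fin n} (h : ∀ A ∈ G, x ∈ A) :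
    (G : Set (Finset (Fin n))).Intersecting :=
  fun A hA B hB => not_disjoint_iff.2 ⟨x, h A hA, h B hB⟩

/-- Stars through different points of `X` are all intersecting, and a subfamily counted in two of
them lies in the sets through both points. It yields the matching lower bound for the count of
`touching k X`. -/
theorem sum_choose_deg_le (F : Finset (Finset (Fin n))) (X : Finset (Fin n)) {t : ℕ} :
    ∑ x ∈ X, (deg F x).choose t ≤ intersectingCount F t +
      ∑ p ∈ X.offDiag, (F.filter fun A => p.1 ∈ A ∧ p.2 ∈ A).card.choose t := by
  have h := sum_card_le_card_biUnion_add X fun x => powersetCard t (F.filter (x ∈ ·))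
  simp only [card_powersetCard] at h
  refine h.trans (Nat.add_le_add (card_le_card (biUnion_subset.2 fun x _ G hG => ?_))
    (sum_le_sum fun p _ => ?_))
  · obtain ⟨h1, h2⟩ := mem_powersetCard.1 hG
    exact mem_intersectingSubfamilies.2 ⟨⟨h1.trans (filter_subset _ _), h2⟩,
      intersecting_of_mem fun A hA => (mem_filter.1 (h1 hA)).2⟩
  · rw [← card_powersetCard]
    refine card_le_card fun G hG => ?_
    obtain ⟨h1, h2⟩ := mem_inter.1 hG
    refine mem_powersetCard.2 ⟨fun A hA => ?_, (mem_powersetCard.1 h1).2⟩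
    have ha := mem_filter.1 ((mem_powersetCard.1 h1).1 hA)
    have hb := mem_filter.1 ((mem_powersetCard.1 h2).1 hA)
    exact mem_filter.2 ⟨ha.1, ha.2, hb.2⟩

theorem deg_touching {k : ℕ} (hk : 1 ≤ k) {X : Finset (Fin n)} {x : Fin n} (hx : x ∈ X) :
    deg (touching k X) x = (n - 1).choose (k - 1) := by
  rw [← card_filter_mem hk x, deg]
  congr 1
  ext A
  simp only [mem_filter, mem_touching, mem_powersetCard, subset_univ, true_and]
  constructor
  · tauto
  · exact fun h => ⟨⟨h.1, not_disjoint_iff.2 ⟨x, h.2, hx⟩⟩, h.2⟩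

theorem card_mul_choose_le_touching {k t : ℕ} (hk : 2 ≤ k) (X : Finset (Fin n)) :
    X.card * ((n - 1).choose (k - 1)).choose t ≤ intersectingCount (touching k X) t +
      X.card ^ 2 * ((n - 2).choose (k - 2)).choose t := by
  have h := sum_choose_deg_le (touching k X) X (t := t)
  rw [sum_congr rfl fun x hx => by rw [deg_touching (by omega) hx], sum_const, smul_eq_mul] at h
  refine h.trans (Nat.add_le_add_left ?_ _)
  calc _ ≤ ∑ p ∈ X.offDiag, ((n - 2).choose (k - 2)).choose t := by
        refine sum_le_sum fun p hp => Nat.choose_le_choose _ ?_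
        rw [← card_filter_mem_mem hk (mem_offDiag.1 hp).2.2]
        exact card_le_card (filter_subset_filter _ (filter_subset _ _))
    _ ≤ _ := by
        rw [sum_const, smul_eq_mul, offDiag_card, sq]
        exact Nat.mul_le_mul_right _ (Nat.sub_le _ _)

/-! ### Stability: a family with many intersecting subfamilies is close to `l` full stars. -/

theorem exists_top {α : Type*} [DecidableEq α] (d : α → ℕ) (s : Finset α) (j : ℕ)
    (hj : j ≤ s.card) :
    ∃ T ⊆ s, T.card = j ∧ ∀ x ∈ T, ∀ y ∈ s, y ∉ T → d y ≤ d x := by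
  induction j with
  | zero => exact ⟨∅, empty_subset _, rfl, by simp⟩
  | succ j ih =>
    obtain ⟨T, hT, hTc, hTd⟩ := ih (by omega)
    have hne : (s \ T).Nonempty := card_pos.1 (by rw [card_sdiff_of_subset hT]; omega)
    obtain ⟨z, hz, hzmax⟩ := exists_max_image (s \ T) d hne
    rw [mem_sdiff] at hz
    refine ⟨insert z T, insert_subset hz.1 hT, by rw [card_insert_of_notMem hz.2, hTc], ?_⟩
    intro x hx y hy hyT
    rw [mem_insert, not_or] at hyT
    rcases mem_insert.1 hx with rfl | hx
    · exact hzmax y (mem_sdiff.2 ⟨hy, hyT.2⟩)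
    · exact hTd x hx y hy hyT.2

/-- The sum of the squares of the degrees off a set of `l` vertices of largest degree. -/
theorem sum_sq_deg_le {k l : ℕ} (hk : 2 ≤ k) {F : Finset (Finset (Fin n))}
    (hF : (F : Set (Finset (Fin n))).Sized k) {X : Finset (Fin n)} (hX : X.card = l)
    (hXtop : ∀ x ∈ X, ∀ y ∉ X, deg F y ≤ deg F x) {D E Y c : ℝ}
    (hD : 0 < D) (hE : E = (n - 2).choose (k - 2))
    (hY : ∑ x ∈ X, (deg F x : ℝ) = l * D - Y) (hY0 : 0 ≤ Y)
    (hFc : (F.card : ℝ) ≤ l * D + 2 * E) (hED : 2 * E ≤ D)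
    (hc : c = 2 + (l + 4 * k * (l + 1) ^ 2 : ℝ) ^ 2) (hcE : 4 * (c * E) ≤ D)
    (hk0 : l + 4 * k * (l + 1) ^ 2 ≤ n) :
    ∑ x ∈ Xᶜ, (deg F x : ℝ) ^ 2 ≤ (Y + c * E) * (D * (1 - 1 / (2 * (l + 1)))) := by
  -- With this size the vertices outside `X` and the next `J` ones contribute a fraction (l+1)k/J =
  -- 1/(4(l+1)) of A·D, where A = Y + cE, which is less than the 3/(4(l+1)) saved on those `J`
  -- vertices.
  set J := 4 * k * (l + 1) ^ 2 with hJ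
  have hJ0 : 0 < J := by positivity
  have hE0 : 0 ≤ E := by rw [hE]; positivity
  have hXcc : Xᶜ.card = n - l := by rw [card_compl, Fintype.card_fin, hX]
  obtain ⟨W, hWX, hWc, hWtop⟩ := exists_top (deg F) Xᶜ J (by omega)
  have hXW : Disjoint X W := by
    rw [disjoint_left]; exact fun x h1 h2 => (mem_compl.1 (hWX h2)) h1
  have hcast : (c : ℝ) = 2 + ((l + J : ℕ) : ℝ) ^ 2 := by rw [hc, hJ]; push_cast; ring
  -- The set `X ∪ W` has bounded size, so its degree sum is at most |F| + O(E). What `W` can carry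
  -- is therefore controlled by the deficit `Y` of `X`.
  have hsumW : ∑ x ∈ W, (deg F x : ℝ) ≤ Y + c * E := by
    have h := sum_deg_le hk hF (X ∪ W)
    rw [sum_union hXW, card_union_of_disjoint hXW, hX, hWc] at h
    have h' : (∑ x ∈ X, (deg F x : ℝ)) + ∑ x ∈ W, (deg F x : ℝ) ≤
        F.card + ((l + J : ℕ) : ℝ) ^ 2 * E := by rw [hE]; exact_mod_cast h
    rw [hY] at h'
    rw [hcast]
    linarith
  set A := Y + c * E with hA
  have hc0 : 0 ≤ c := by rw [hcast]; positivity
  have hA0 : 0 ≤ A := by positivity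
  -- the degrees off `X`
  have hdegX : ∀ y ∈ Xᶜ, (deg F y : ℝ) * (l + 1) ≤ D * (l + 1 / 4) := by
    intro y hy
    have hyX := mem_compl.1 hy
    have h := sum_deg_le hk hF (insert y X)
    rw [sum_insert hyX, card_insert_of_notMem hyX, hX] at h
    have h1 : (deg F y : ℝ) + ∑ x ∈ X, (deg F x : ℝ) ≤ F.card + (l + 1 : ℝ) ^ 2 * E := by
      rw [hE]; exact_mod_cast h
    have h2 : (l : ℝ) * deg F y ≤ ∑ x ∈ X, (deg F x : ℝ) := by
      rw [← hX, ← nsmul_eq_mul]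
      exact card_nsmul_le_sum _ _ _ fun x hx => by exact_mod_cast hXtop x hx y hyX
    have h3 : (l + 1 : ℝ) ^ 2 ≤ ((l + J : ℕ) : ℝ) ^ 2 := by
      have : 1 ≤ J := hJ0
      gcongr; exact_mod_cast (by omega : l + 1 ≤ l + J)
    have h4 : (2 + (l + 1 : ℝ) ^ 2) * E ≤ c * E := by rw [hcast]; gcongr
    nlinarith
  -- A vertex outside `W` has degree at most the average over `W`.
  have hdegW : ∀ y ∈ Xᶜ \ W, (deg F y : ℝ) * J ≤ A := by
    intro y hy
    obtain ⟨h1, h2⟩ := mem_sdiff.1 hy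
    refine le_trans ?_ hsumW
    rw [mul_comm, ← hWc, ← nsmul_eq_mul]
    exact card_nsmul_le_sum _ _ _ fun x hx => by exact_mod_cast hWtop x hx y h1 h2
  have hsumrest : ∑ x ∈ Xᶜ \ W, (deg F x : ℝ) ≤ (l + 1) * D * k := by
    have h1 : ∑ x ∈ Xᶜ \ W, (deg F x : ℝ) ≤ ∑ x, (deg F x : ℝ) :=
      sum_le_sum_of_subset_of_nonneg (subset_univ _) fun _ _ _ => Nat.cast_nonneg _
    have h2 : ∑ x, (deg F x : ℝ) = F.card * k := by exact_mod_cast sum_deg_univ hF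
    have h3 : (F.card : ℝ) ≤ (l + 1) * D := by linarith
    rw [h2] at h1
    refine h1.trans ?_
    gcongr
  have hl1 : (0 : ℝ) < l + 1 := by positivity
  have hW2 : ∑ x ∈ W, (deg F x : ℝ) ^ 2 ≤ (D * (l + 1 / 4) / (l + 1)) * A := by
    calc _ ≤ ∑ x ∈ W, (D * (l + 1 / 4) / (l + 1)) * (deg F x : ℝ) := by
          refine sum_le_sum fun x hx => ?_
          rw [sq]
          refine mul_le_mul_of_nonneg_right ?_ (Nat.cast_nonneg _)
          rw [le_div_iff₀ hl1]
          exact hdegX x (hWX hx)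
      _ ≤ _ := by rw [← mul_sum]; gcongr
  have hR2 : ∑ x ∈ Xᶜ \ W, (deg F x : ℝ) ^ 2 ≤ (A / J) * ((l + 1) * D * k) := by
    have hJr : (0 : ℝ) < J := by exact_mod_cast hJ0
    calc _ ≤ ∑ x ∈ Xᶜ \ W, (A / J) * (deg F x : ℝ) := by
          refine sum_le_sum fun x hx => ?_
          rw [sq]
          refine mul_le_mul_of_nonneg_right ?_ (Nat.cast_nonneg _)
          rw [le_div_iff₀ hJr]
          exact hdegW x hx
      _ ≤ _ := by rw [← mul_sum]; gcongr
  have hsplit := sum_sdiff hWX (f := fun x => (deg F x : ℝ) ^ 2)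
  rw [← hsplit]
  have hkr : (0 : ℝ) < k := by exact_mod_cast (by omega : 0 < k)
  have e1 : (A / J) * ((l + 1) * D * k) = A * (D * (1 / (4 * (l + 1)))) := by
    rw [hJ]; push_cast; field_simp
  have e2 : (D * (l + 1 / 4) / (l + 1)) * A = A * (D * (1 - 3 / (4 * (l + 1)))) := by
    field_simp; ring
  have e3 : A * (D * (1 - 1 / (2 * (l + 1)))) =
      A * (D * (1 / (4 * (l + 1)))) + A * (D * (1 - 3 / (4 * (l + 1)))) := by
    field_simp; ring
  rw [e3]
  linarith

theorem le_choose {a j : ℕ} (hj : 1 ≤ j) (hja : j < a) : a ≤ a.choose j := by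
  induction a with
  | zero => omega
  | succ a ih =>
    obtain ⟨j, rfl⟩ : ∃ i, j = i + 1 := ⟨j - 1, by omega⟩
    rcases eq_or_lt_of_le (show j + 1 ≤ a by omega) with h | h
    · rw [← h, Nat.choose_succ_self_right]
    · have h1 := ih h
      have h2 : 0 < a.choose j := Nat.choose_pos (by omega)
      rw [Nat.choose_succ_succ']
      omega

set_option maxHeartbeats 1000000 in
/-- A family of about the size of `l` stars with more intersecting subfamilies than the union of
`l` stars is close to a union of `l` stars. -/
theorem exists_star_cover (k l : ℕ) (hk : 3 ≤ k) :
    ∃ C n₀ : ℕ, ∀ n, n₀ ≤ n → ∀ F : Finset (Finset (Fin n)),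
      (F : Set (Finset (Fin n))).Sized k → F.card ≤ l * (n - 1).choose (k - 1) + n →
      ∀ t, 2 ≤ t → ∀ X₀ : Finset (Fin n), X₀.card = l →
      intersectingCount (touching k X₀) t < intersectingCount F t →
      ∃ X : Finset (Fin n), X.card = l ∧
        l * (n - 1).choose (k - 1) ≤ ∑ x ∈ X, deg F x + C * (n - 2).choose (k - 2) := by
  set cJ : ℕ := 2 + (l + 4 * k * (l + 1) ^ 2) ^ 2 with hcJ
  set cN := nontrivialConst k (l + 1) with hcN
  refine ⟨2 * (l + 1) * (l ^ 2 + cN + cJ),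
    (2 + 4 * cJ + 2 * (k * (k + 1)) ^ 2 + 2 * (k + 1)) * k + k + 4 + l + 4 * k * (l + 1) ^ 2,
    fun n hn F hF hFc t ht X₀ hX₀ hlt => ?_⟩
  set D := (n - 1).choose (k - 1) with hD
  set E := (n - 2).choose (k - 2) with hE
  -- Here `k ≥ 3` matters: n is O(E), so the permitted excess of n sets over l·D is part of the
  -- error term.
  have hE1 : n - 2 ≤ E := le_choose (by omega) (by omega)
  have hDE : (2 + 4 * cJ + 2 * (k * (k + 1)) ^ 2 + 2 * (k + 1)) * E ≤ D := by
    have := mul_choose_pred_le (a := n - 1) (b := k - 1)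
      (c := 2 + 4 * cJ + 2 * (k * (k + 1)) ^ 2 + 2 * (k + 1)) (by omega)
      (by
        have : (2 + 4 * cJ + 2 * (k * (k + 1)) ^ 2 + 2 * (k + 1)) * (k - 1) ≤
          (2 + 4 * cJ + 2 * (k * (k + 1)) ^ 2 + 2 * (k + 1)) * k := Nat.mul_le_mul_left _ (by omega)
        omega) (by omega)
    simpa [hE, hD, Nat.sub_sub] using this
  have hE0 : 1 ≤ E := by omega
  have hkE : k + 1 ≤ (k + 1) * E := Nat.le_mul_of_pos_right _ hE0
  have hDE' : 2 * E + 4 * (cJ * E) + 2 * ((k * (k + 1)) ^ 2 * E) + 2 * ((k + 1) * E) ≤ D := by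
    refine le_of_eq_of_le ?_ hDE
    ring
  have hED : 2 * E ≤ D := by omega
  have hcE : 4 * (cJ * E) ≤ D := by omega
  have hM : 2 * ((k * (k + 1)) ^ 2 * E) + 2 * (k + 1) ≤ D := by omega
  have hn2 : n ≤ 2 * E := by omega
  have hFc' : F.card ≤ (l + 1) * D := by rw [add_mul, one_mul]; omega
  have hNT := mul_card_nontrivialSubfamilies_le (c := l + 1) (by omega) ht (by omega) hF hFc' hM
  rw [← hcN, ← hD, ← hE] at hNT
  obtain ⟨X, -, hX, hXtop⟩ := exists_top (deg F) univ l (by simp; omega)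
  refine ⟨X, hX, ?_⟩
  have hdeg := deg_le (by omega : 1 ≤ k) hF
  rw [← hD] at hdeg
  have hS := card_mul_choose_le_touching (t := t) (by omega : 2 ≤ k) X₀
  rw [hX₀, ← hD, ← hE] at hS
  have hET : D * E.choose t ≤ E * D.choose t := mul_choose_le_mul_choose (by omega) (by omega)
  have hup := intersectingCount_le_sum_add F t
  set T := D.choose t with hT
  -- pass to the reals
  have hDr : (0 : ℝ) < D := by exact_mod_cast (by omega : 0 < D)
  have hEr : (0 : ℝ) ≤ E := Nat.cast_nonneg _
  have hl1 : (0 : ℝ) < l + 1 := by positivity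
  obtain ⟨Y, hY⟩ : ∃ Y : ℝ, ∑ x ∈ X, (deg F x : ℝ) = l * D - Y :=
    ⟨l * D - ∑ x ∈ X, (deg F x : ℝ), by ring⟩
  have hY0 : 0 ≤ Y := by
    have : ∑ x ∈ X, (deg F x : ℝ) ≤ l * D := by
      rw [← hX, ← nsmul_eq_mul]
      exact sum_le_card_nsmul _ _ _ fun x _ => by exact_mod_cast hdeg x
    linarith
  have hsq := sum_sq_deg_le (l := l) (c := cJ) (E := E) (D := D) (Y := Y) (by omega : 2 ≤ k) hF hX
    (fun x hx y hy => hXtop x hx y (mem_univ _) hy) hDr (by rw [hE]) hY hY0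
    (by
      have : F.card ≤ l * D + 2 * E := by omega
      exact_mod_cast this) (by exact_mod_cast hED) (by rw [hcJ]; push_cast; ring)
    (by exact_mod_cast hcE) (by omega)
  -- In units of T/D², the degrees in `X` contribute at most D(lD - Y) by linear comparison, those
  -- off `X` their sum of squares since `t ≥ 2`. Beating `l` full stars thus forces the squares off
  -- `X` to make up for D·Y, up to O(E·D).
  have key : (D : ℝ) * Y < (l ^ 2 + cN) * E * D +
      (Y + cJ * E) * (D * (1 - 1 / (2 * (l + 1)))) := by
    by_contra hcon
    push Not at hcon
    refine absurd hlt (not_lt.2 ?_)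
    have hsum : (D : ℝ) ^ 2 * ∑ x, ((deg F x).choose t : ℝ) ≤
        (D * (l * D - Y) + ∑ x ∈ Xᶜ, (deg F x : ℝ) ^ 2) * T := by
      rw [← sum_add_sum_compl X, mul_add, add_mul]
      refine add_le_add ?_ ?_
      · rw [← hY, mul_sum, mul_sum, sum_mul]
        refine sum_le_sum fun x _ => ?_
        have h : (D : ℝ) * (deg F x).choose t ≤ deg F x * T := by
          exact_mod_cast mul_choose_le_mul_choose (hdeg x) (by omega)
        calc (D : ℝ) ^ 2 * (deg F x).choose t = D * (D * (deg F x).choose t) := by ring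
          _ ≤ D * (deg F x * T) := by gcongr
          _ = _ := by ring
      · rw [mul_sum, sum_mul]
        refine sum_le_sum fun x _ => ?_
        exact_mod_cast sq_mul_choose_le_sq_mul_choose (hdeg x) ht
    have hupr : (intersectingCount F t : ℝ) ≤ ∑ x, ((deg F x).choose t : ℝ) +
        (nontrivialSubfamilies F t).card := by exact_mod_cast hup
    have hNTr : (D : ℝ) * (nontrivialSubfamilies F t).card ≤ cN * E * T := by exact_mod_cast hNT
    have hSr : (l : ℝ) * T ≤ intersectingCount (touching k X₀) t + l ^ 2 * E.choose t := by
      exact_mod_cast hS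
    have hETr : (D : ℝ) * E.choose t ≤ E * T := by exact_mod_cast hET
    have hT0 : (0 : ℝ) ≤ T := Nat.cast_nonneg _
    have hfin : (D : ℝ) ^ 2 * intersectingCount F t ≤
        D ^ 2 * intersectingCount (touching k X₀) t := by
      have h1 : (D : ℝ) ^ 2 * (nontrivialSubfamilies F t).card ≤ D * (cN * E * T) := by
        rw [sq, mul_assoc]; gcongr
      have h2 : (D : ℝ) ^ 2 * (l ^ 2 * E.choose t) ≤ l ^ 2 * (D * (E * T)) := by
        have : (D : ℝ) ^ 2 * (l ^ 2 * E.choose t) = l ^ 2 * (D * (D * E.choose t)) := by ring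
        rw [this]; gcongr
      have h3 : (D : ℝ) ^ 2 * intersectingCount F t ≤
          (D * (l * D - Y) + ∑ x ∈ Xᶜ, (deg F x : ℝ) ^ 2) * T + D * (cN * E * T) := by
        refine (mul_le_mul_of_nonneg_left hupr (by positivity)).trans ?_
        rw [mul_add]; exact add_le_add hsum h1
      have h4 : (D : ℝ) ^ 2 * (l * T) ≤
          D ^ 2 * intersectingCount (touching k X₀) t + l ^ 2 * (D * (E * T)) := by
        refine (mul_le_mul_of_nonneg_left hSr (by positivity)).trans ?_
        rw [mul_add]; exact add_le_add le_rfl h2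
      have h5 : (∑ x ∈ Xᶜ, (deg F x : ℝ) ^ 2) * T ≤
          (D * Y - (l ^ 2 + cN) * E * D) * T := mul_le_mul_of_nonneg_right (by linarith) hT0
      linarith
    have := le_of_mul_le_mul_left hfin (by positivity)
    exact_mod_cast this
  -- The squares off `X` return only the fraction 1 - 1/(2(l+1)) of D·Y, so the inequality `key`
  -- bounds `Y` itself by a multiple of E.
  have hYb : Y ≤ 2 * (l + 1) * (l ^ 2 + cN + cJ) * E := by
    have h1 : Y < (l ^ 2 + cN) * E + (Y + cJ * E) * (1 - 1 / (2 * (l + 1))) := by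
      have : (D : ℝ) * Y < D * ((l ^ 2 + cN) * E + (Y + cJ * E) * (1 - 1 / (2 * (l + 1)))) := by
        linarith
      exact lt_of_mul_lt_mul_left this hDr.le
    have h2 : (0 : ℝ) ≤ cJ * E * (1 / (2 * (l + 1))) := by positivity
    have h3 : Y * (1 / (2 * (l + 1))) ≤ (l ^ 2 + cN + cJ) * E := by linarith
    rw [mul_one_div, div_le_iff₀ (by positivity)] at h3
    linarith
  have hfinal : (l : ℝ) * D ≤ ∑ x ∈ X, (deg F x : ℝ) + 2 * (l + 1) * (l ^ 2 + cN + cJ) * E := by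
    linarith
  exact_mod_cast hfinal

/-! ### Families of sets meeting `X` and a `(k-2)`-set `Q`. -/

/-- Counting intersecting subfamilies of a family most of whose members meet `X` and `Q` in exactly
one point each. -/
theorem intersectingCount_le_of_regular {k l b v : ℕ} (hk : 3 ≤ k) {X Q J : Finset (Fin n)}
    {F B Rg : Finset (Finset (Fin n))} (hX : X.card = l) (hX0 : X.Nonempty) (hQ : Q.card = k - 2)
    (hXQ : Disjoint X Q) (hJX : J ⊆ X) (hJ : J.card ≤ k - 2)
    (hRg : ∀ A ∈ Rg, A.card = k ∧ ∃ i ∈ J, ∃ q ∈ Q, A ∩ X = {i} ∧ A ∩ Q = {q})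
    (hF : F ⊆ B ∪ Rg) (hB : B.card ≤ b * (n - 3).choose (k - 3)) :
    intersectingCount F v ≤
      (l + k) * ((k - 2) * (n - 2).choose (k - 2) +
        (b + 2 * l * k ^ 2) * (n - 3).choose (k - 3)).choose v +
      if 2 ≤ v then (l * k * (n - 2).choose (k - 2)) * ((l * k ^ 2 * (n - 3).choose (k - 3)) *
        ((k - 2) * (n - 2).choose (k - 2) +
        (b + 2 * l * k ^ 2) * (n - 3).choose (k - 3)).choose (v - 2)) else 0 := by
  set D := (n - 2).choose (k - 2) with hD
  set E := (n - 3).choose (k - 3) with hE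
  set N := (k - 2) * D + (b + 2 * l * k ^ 2) * E with hN
  have hBN : b * E ≤ (b + 2 * l * k ^ 2) * E := Nat.mul_le_mul_right _ (by omega)
  have hmemX : ∀ A ∈ Rg, ∀ i, A ∩ X = {i} → i ∈ A ∧ i ∈ X := fun A _ i h =>
    mem_inter.1 (h ▸ mem_singleton_self i)
  have hmemQ : ∀ A ∈ Rg, ∀ q, A ∩ Q = {q} → q ∈ A ∧ q ∈ Q := fun A _ i h =>
    mem_inter.1 (h ▸ mem_singleton_self i)
  have heqX : ∀ A : Finset (Fin n), ∀ i, A ∩ X = {i} → ∀ z ∈ A, z ∈ X → z = i := fun A i h z h1 h2 =>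
    mem_singleton.1 (h ▸ mem_inter.2 ⟨h1, h2⟩)
  have heqQ : ∀ A : Finset (Fin n), ∀ i, A ∩ Q = {i} → ∀ z ∈ A, z ∈ Q → z = i := fun A i h z h1 h2 =>
    mem_singleton.1 (h ▸ mem_inter.2 ⟨h1, h2⟩)
  have hneXQ : ∀ x ∈ X, ∀ q ∈ Q, x ≠ q := fun x hx q hq h => disjoint_left.1 hXQ hx (h ▸ hq)
  -- the two kinds of exceptional families attached to a pair of members
  let near : Finset (Fin n) → Finset (Finset (Fin n)) := fun A =>
    Rg.filter fun A' => ¬ Disjoint A' A ∧ Disjoint (A' ∩ (X ∪ Q)) A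
  have hnear : ∀ A : Finset (Fin n), A.card = k → (near A).card ≤ l * k ^ 2 * E := by
    intro A hA
    refine (card_le_of_triple hk X Q A fun A' hA' => ?_).trans ?_
    · obtain ⟨h1, h2, h3⟩ := mem_filter.1 hA'
      obtain ⟨hc, i, hi, q, hq, hiX, hqQ⟩ := hRg A' h1
      obtain ⟨z, hz, hzA⟩ := not_disjoint_iff.1 h2
      have hi' := hmemX A' h1 i hiX
      have hq' := hmemQ A' h1 q hqQ
      refine ⟨hc, i, hi'.2, q, hq'.2, z, hzA, hneXQ i hi'.2 q hq'.2, ?_, ?_, hi'.1, hq'.1, hz⟩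
      · rintro rfl
        exact disjoint_left.1 h3 (mem_inter.2 ⟨hz, mem_union_left _ hi'.2⟩) hzA
      · rintro rfl
        exact disjoint_left.1 h3 (mem_inter.2 ⟨hz, mem_union_right _ hq'.2⟩) hzA
    · rw [hX, hQ, hA]
      refine Nat.mul_le_mul_right _ ?_
      rw [sq]
      gcongr
      omega
  let two : Fin n → Fin n → Finset (Finset (Fin n)) := fun i q =>
    (powersetCard k univ).filter fun A => i ∈ A ∧ q ∈ A
  have htwo : ∀ i q, i ≠ q → (two i q).card = D := fun i q h => card_filter_mem_mem (by omega) h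
  -- Let A and A' have types (i,q) and (i',q') with i ≠ i' and q ≠ q'. A regular set meeting both
  -- either has type (i,q') or (i',q), or shares no type point with one of them, and then lies in
  -- its `near` family.
  let rest : Finset (Fin n) → Finset (Fin n) → Finset (Finset (Fin n)) := fun A A' =>
    B ∪ ((Rg.filter fun C => ∃ i ∈ A ∩ X, ∃ q ∈ A' ∩ Q, i ∈ C ∧ q ∈ C) ∪
      (Rg.filter fun C => ∃ i ∈ A' ∩ X, ∃ q ∈ A ∩ Q, i ∈ C ∧ q ∈ C)) ∪ (near A ∪ near A')
  have hdisj : ∀ C ∈ Rg, ∀ A, ∀ i q, C ∩ X = {i} → C ∩ Q = {q} → i ∉ A → q ∉ A →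
      Disjoint (C ∩ (X ∪ Q)) A := by
    intro C hC A i q hi hq hiA hqA
    rw [inter_union_distrib_left, hi, hq, disjoint_union_left, disjoint_singleton_left,
      disjoint_singleton_left]
    exact ⟨hiA, hqA⟩
  have hsub : intersectingSubfamilies F v ⊆
      ((X.biUnion fun i => powersetCard v (B ∪ Rg.filter (i ∈ ·))) ∪
      (Q.biUnion fun q => powersetCard v (B ∪ Rg.filter (q ∈ ·)))) ∪
      ((Rg.biUnion fun A => ((near A).filter fun A' => ¬ Disjoint A A' ∧
          Disjoint (A ∩ (X ∪ Q)) (A' ∩ (X ∪ Q))).biUnion fun A' =>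
        (powersetCard (v - 2) (rest A A')).image (fun H => H ∪ {A, A'})).filter
          fun G => 2 ≤ v) := by
    intro G hG
    obtain ⟨⟨hGF, hGc⟩, hGi⟩ := mem_intersectingSubfamilies.1 hG
    by_cases h1 : ∃ i ∈ X, ∀ A ∈ G, A ∈ Rg → i ∈ A
    · obtain ⟨i, hi, h⟩ := h1
      refine mem_union_left _ (mem_union_left _ (mem_biUnion.2 ⟨i, hi, mem_powersetCard.2
        ⟨fun A hA => ?_, hGc⟩⟩))
      rcases mem_union.1 (hF (hGF hA)) with h' | h'
      · exact mem_union_left _ h'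
      · exact mem_union_right _ (mem_filter.2 ⟨h', h A hA h'⟩)
    by_cases h2 : ∃ q ∈ Q, ∀ A ∈ G, A ∈ Rg → q ∈ A
    · obtain ⟨i, hi, h⟩ := h2
      refine mem_union_left _ (mem_union_right _ (mem_biUnion.2 ⟨i, hi, mem_powersetCard.2
        ⟨fun A hA => ?_, hGc⟩⟩))
      rcases mem_union.1 (hF (hGF hA)) with h' | h'
      · exact mem_union_left _ h'
      · exact mem_union_right _ (mem_filter.2 ⟨h', h A hA h'⟩)
    push Not at h1 h2
    -- Take A of type (i,q), a member avoiding i and a member avoiding q. Some two of these three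
    -- differ in both coordinates.
    have hex : ∃ A ∈ G, ∃ A' ∈ G, A ∈ Rg ∧ A' ∈ Rg ∧ ∃ i q i' q', i ∈ J ∧ i' ∈ J ∧
        i ≠ i' ∧ q ≠ q' ∧ A ∩ X = {i} ∧ A ∩ Q = {q} ∧ A' ∩ X = {i'} ∧ A' ∩ Q = {q'} := by
      obtain ⟨x, hx⟩ := hX0
      obtain ⟨A, hA, hAR, -⟩ := h1 x hx
      obtain ⟨hc, i, hi, q, hq, hiX, hqQ⟩ := hRg A hAR
      obtain ⟨A₁, hA₁, hAR₁, hn₁⟩ := h1 i (hJX hi)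
      obtain ⟨hc₁, i₁, hi₁, q₁, hq₁, hiX₁, hqQ₁⟩ := hRg A₁ hAR₁
      obtain ⟨A₂, hA₂, hAR₂, hn₂⟩ := h2 q hq
      obtain ⟨hc₂, i₂, hi₂, q₂, hq₂, hiX₂, hqQ₂⟩ := hRg A₂ hAR₂
      have e1 : i ≠ i₁ := fun h => hn₁ (h ▸ (hmemX A₁ hAR₁ i₁ hiX₁).1)
      have e2 : q ≠ q₂ := fun h => hn₂ (h ▸ (hmemQ A₂ hAR₂ q₂ hqQ₂).1)
      by_cases e3 : q = q₁
      · by_cases e4 : i = i₂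
        · exact ⟨A₁, hA₁, A₂, hA₂, hAR₁, hAR₂, i₁, q₁, i₂, q₂, hi₁, hi₂, e4 ▸ e1.symm, e3 ▸ e2,
            hiX₁, hqQ₁, hiX₂, hqQ₂⟩
        · exact ⟨A, hA, A₂, hA₂, hAR, hAR₂, i, q, i₂, q₂, hi, hi₂, e4, e2, hiX, hqQ, hiX₂, hqQ₂⟩
      · exact ⟨A, hA, A₁, hA₁, hAR, hAR₁, i, q, i₁, q₁, hi, hi₁, e1, e3, hiX, hqQ, hiX₁, hqQ₁⟩
    obtain ⟨A, hA, A', hA', hAR, hAR', i, q, i', q', hi, hi', hii, hqq, hiX, hqQ, hiX', hqQ'⟩ := hex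
    have mi := hmemX A hAR i hiX
    have mq := hmemQ A hAR q hqQ
    have mi' := hmemX A' hAR' i' hiX'
    have mq' := hmemQ A' hAR' q' hqQ'
    have niA' : i ∉ A' := fun h => hii (heqX A' i' hiX' i h mi.2)
    have nqA' : q ∉ A' := fun h => hqq (heqQ A' q' hqQ' q h mq.2)
    have ni'A : i' ∉ A := fun h => hii (heqX A i hiX i' h mi'.2).symm
    have nq'A : q' ∉ A := fun h => hqq (heqQ A q hqQ q' h mq'.2).symm
    have hAA' : A ≠ A' := fun h => niA' (h ▸ mi.1)
    have hpair : ({A, A'} : Finset (Finset (Fin n))) ⊆ G :=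
      insert_subset hA (singleton_subset_iff.2 hA')
    have hpc : ({A, A'} : Finset (Finset (Fin n))).card = 2 := card_pair hAA'
    have hv : 2 ≤ v := by
      have := card_le_card hpair
      omega
    refine mem_union_right _ (mem_filter.2 ⟨mem_biUnion.2 ⟨A, hAR, mem_biUnion.2 ⟨A',
      mem_filter.2 ⟨mem_filter.2 ⟨hAR', hGi hA' hA, hdisj A' hAR' A i' q' hiX' hqQ' ni'A nq'A⟩,
        hGi hA hA', ?_⟩, mem_image.2 ⟨G \ {A, A'}, mem_powersetCard.2 ⟨fun C hC => ?_, ?_⟩,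
        sdiff_union_of_subset hpair⟩⟩⟩, hv⟩)
    · exact (hdisj A hAR A' i q hiX hqQ niA' nqA').mono_right inter_subset_left
    · have hCG := (mem_sdiff.1 hC).1
      rcases mem_union.1 (hF (hGF hCG)) with h | hCR
      · exact mem_union_left _ (mem_union_left _ h)
      obtain ⟨-, i₀, hi₀, q₀, hq₀, hiX₀, hqQ₀⟩ := hRg C hCR
      have mi₀ := hmemX C hCR i₀ hiX₀
      have mq₀ := hmemQ C hCR q₀ hqQ₀
      by_cases hCA : i₀ ∉ A ∧ q₀ ∉ A
      · exact mem_union_right _ (mem_union_left _ (mem_filter.2 ⟨hCR, hGi hCG hA,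
          hdisj C hCR A i₀ q₀ hiX₀ hqQ₀ hCA.1 hCA.2⟩))
      by_cases hCA' : i₀ ∉ A' ∧ q₀ ∉ A'
      · exact mem_union_right _ (mem_union_right _ (mem_filter.2 ⟨hCR, hGi hCG hA',
          hdisj C hCR A' i₀ q₀ hiX₀ hqQ₀ hCA'.1 hCA'.2⟩))
      refine mem_union_left _ (mem_union_right _ ?_)
      by_cases e1 : i₀ ∈ A
      · have e2 : i₀ ∉ A' := by
          have : i₀ = i := heqX A i hiX i₀ e1 mi₀.2
          rwa [this]
        have e3 : q₀ ∈ A' := by tauto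
        exact mem_union_left _ (mem_filter.2 ⟨hCR, i₀, mem_inter.2 ⟨e1, mi₀.2⟩, q₀,
          mem_inter.2 ⟨e3, mq₀.2⟩, mi₀.1, mq₀.1⟩)
      · have e2 : q₀ ∈ A := by tauto
        have e3 : q₀ ∉ A' := by
          have : q₀ = q := heqQ A q hqQ q₀ e2 mq₀.2
          rwa [this]
        have e4 : i₀ ∈ A' := by tauto
        exact mem_union_right _ (mem_filter.2 ⟨hCR, i₀, mem_inter.2 ⟨e4, mi₀.2⟩, q₀,
          mem_inter.2 ⟨e2, mq₀.2⟩, mi₀.1, mq₀.1⟩)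
    · rw [card_sdiff_of_subset hpair, hpc, hGc]
  have hstar1 : ∀ i ∈ X, (B ∪ Rg.filter (i ∈ ·)).card ≤ N := by
    intro i hi
    have h : (Rg.filter (i ∈ ·)).card ≤ 1 * (k - 2) * D := by
      have := card_le_of_pair (k := k) (by omega) (P := Rg.filter (i ∈ ·)) {i} Q fun A hA => ?_
      · rwa [card_singleton, hQ] at this
      · obtain ⟨hAR, hiA⟩ := mem_filter.1 hA
        obtain ⟨hc, i₀, hi₀, q₀, hq₀, hiX₀, hqQ₀⟩ := hRg A hAR
        exact ⟨hc, i, mem_singleton_self _, q₀, hq₀, hneXQ i hi q₀ hq₀, hiA,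
          (hmemQ A hAR q₀ hqQ₀).1⟩
    have := card_union_le B (Rg.filter (i ∈ ·))
    rw [one_mul] at h
    omega
  have hstar2 : ∀ q ∈ Q, (B ∪ Rg.filter (q ∈ ·)).card ≤ N := by
    intro q hq
    have h : (Rg.filter (q ∈ ·)).card ≤ J.card * 1 * D := by
      have := card_le_of_pair (k := k) (by omega) (P := Rg.filter (q ∈ ·)) J {q} fun A hA => ?_
      · rwa [card_singleton] at this
      · obtain ⟨hAR, hqA⟩ := mem_filter.1 hA
        obtain ⟨hc, i₀, hi₀, q₀, hq₀, hiX₀, hqQ₀⟩ := hRg A hAR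
        exact ⟨hc, i₀, hi₀, q, mem_singleton_self _, hneXQ i₀ (hJX hi₀) q hq,
          (hmemX A hAR i₀ hiX₀).1, hqA⟩
    have h' : J.card * 1 * D ≤ (k - 2) * D := by
      rw [mul_one]; exact Nat.mul_le_mul_right _ hJ
    have := card_union_le B (Rg.filter (q ∈ ·))
    omega
  have hrest : ∀ A ∈ Rg, ∀ A' ∈ Rg, Disjoint (A ∩ (X ∪ Q)) (A' ∩ (X ∪ Q)) →
      (rest A A').card ≤ N := by
    intro A hAR A' hAR' hd
    obtain ⟨hc, i, hi, q, hq, hiX, hqQ⟩ := hRg A hAR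
    obtain ⟨hc', i', hi', q', hq', hiX', hqQ'⟩ := hRg A' hAR'
    have hii : i ≠ i' := by
      rintro rfl
      exact disjoint_left.1 hd (mem_inter.2 ⟨(hmemX A hAR i hiX).1, mem_union_left _ (hJX hi)⟩)
        (mem_inter.2 ⟨(hmemX A' hAR' i hiX').1, mem_union_left _ (hJX hi)⟩)
    -- Two distinct points of `J` exist, so `k ≥ 4`. The two mixed types, at most 2D sets, then fit
    -- in the same bound (k-2)D as a star.
    have hk4 : 2 ≤ k - 2 := by
      refine le_trans ?_ hJ
      exact one_lt_card.2 ⟨i, hi, i', hi', hii⟩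
    have b1 : (Rg.filter fun C => ∃ i ∈ A ∩ X, ∃ q ∈ A' ∩ Q, i ∈ C ∧ q ∈ C).card ≤ D := by
      rw [← htwo i q' (hneXQ i (hJX hi) q' hq')]
      refine card_le_card fun C hC => ?_
      rw [hiX, hqQ'] at hC
      obtain ⟨hCR, j, hj, r, hr, h1, h2⟩ := mem_filter.1 hC
      rw [mem_singleton.1 hj] at h1
      rw [mem_singleton.1 hr] at h2
      exact mem_filter.2 ⟨mem_powersetCard.2 ⟨subset_univ _, (hRg C hCR).1⟩, h1, h2⟩
    have b2 : (Rg.filter fun C => ∃ i ∈ A' ∩ X, ∃ q ∈ A ∩ Q, i ∈ C ∧ q ∈ C).card ≤ D := by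
      rw [← htwo i' q (hneXQ i' (hJX hi') q hq)]
      refine card_le_card fun C hC => ?_
      rw [hiX', hqQ] at hC
      obtain ⟨hCR, j, hj, r, hr, h1, h2⟩ := mem_filter.1 hC
      rw [mem_singleton.1 hj] at h1
      rw [mem_singleton.1 hr] at h2
      exact mem_filter.2 ⟨mem_powersetCard.2 ⟨subset_univ _, (hRg C hCR).1⟩, h1, h2⟩
    have b3 := hnear A hc
    have b4 := hnear A' hc'
    have b5 : 2 * D ≤ (k - 2) * D := Nat.mul_le_mul_right _ hk4
    have b6 : N = (k - 2) * D + (b * E + 2 * (l * k ^ 2 * E)) := by rw [hN]; ring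
    refine (card_union_le _ _).trans ?_
    refine (Nat.add_le_add (card_union_le _ _) (card_union_le _ _)).trans ?_
    refine (Nat.add_le_add_right (Nat.add_le_add_left (card_union_le _ _) _) _).trans ?_
    omega
  have hRgc : Rg.card ≤ l * k * D := by
    refine (card_le_of_pair (k := k) (by omega) X Q fun A hA => ?_).trans ?_
    · obtain ⟨hc, i₀, hi₀, q₀, hq₀, hiX₀, hqQ₀⟩ := hRg A hA
      exact ⟨hc, i₀, hJX hi₀, q₀, hq₀, hneXQ i₀ (hJX hi₀) q₀ hq₀, (hmemX A hA i₀ hiX₀).1,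
        (hmemQ A hA q₀ hqQ₀).1⟩
    · rw [hX, hQ]
      gcongr
      omega
  refine (card_le_card hsub).trans ((card_union_le _ _).trans (Nat.add_le_add ?_ ?_))
  · refine (card_union_le _ _).trans ?_
    have g1 := card_biUnion_le_card_mul X (fun i => powersetCard v (B ∪ Rg.filter (i ∈ ·)))
      (N.choose v) fun i hi => by
        rw [card_powersetCard]; exact Nat.choose_le_choose _ (hstar1 i hi)
    have g2 := card_biUnion_le_card_mul Q (fun i => powersetCard v (B ∪ Rg.filter (i ∈ ·)))
      (N.choose v) fun i hi => by
        rw [card_powersetCard]; exact Nat.choose_le_choose _ (hstar2 i hi)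
    rw [hX] at g1
    rw [hQ] at g2
    have g3 : (k - 2) * N.choose v ≤ k * N.choose v := Nat.mul_le_mul_right _ (by omega)
    rw [add_mul]
    omega
  · split_ifs with hv
    · refine (card_filter_le _ _).trans ((card_biUnion_le_card_mul _ _ _ fun A hA => ?_).trans
        (Nat.mul_le_mul_right _ hRgc))
      refine (card_biUnion_le_card_mul _ _ (N.choose (v - 2)) fun A' hA' => ?_).trans
        (Nat.mul_le_mul_right _ ((card_filter_le _ _).trans (hnear A (hRg A hA).1)))
      refine card_image_le.trans ?_
      rw [card_powersetCard]
      obtain ⟨h1, h2⟩ := mem_filter.1 hA'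
      exact Nat.choose_le_choose _ (hrest A hA A' (mem_filter.1 h1).1 h2.2)
    · simp [hv]

/-- The `k`-sets meeting both `X` and `Q`. -/
def touchingBoth (k : ℕ) (X Q : Finset (Fin n)) : Finset (Finset (Fin n)) :=
  (touching k X).filter fun A => ¬ Disjoint A Q

theorem mem_touchingBoth {k : ℕ} {X Q A : Finset (Fin n)} :
    A ∈ touchingBoth k X Q ↔ A.card = k ∧ ¬ Disjoint A X ∧ ¬ Disjoint A Q := by
  rw [touchingBoth, mem_filter, mem_touching, and_assoc]

/-- A set that meets `X`, `Q` and `p` usually meets `X` in a single point, lying in `p`, and `Q` in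
a single point; otherwise it contains three points from bounded sets, which leaves O(C(n-3,k-3))
choices. So the companions of `p` are regular in the sense of `intersectingCount_le_of_regular`,
with `J = p ∩ X`. The threshold `3 ≤ u` is `2 ≤ u - 1`, the member `p` having been removed. -/
theorem card_subfamilies_mem_le_of_off {k l c u : ℕ} (hk : 3 ≤ k) {X Q p : Finset (Fin n)}
    {P : Finset (Finset (Fin n))} (hX : X.card = l) (hX0 : X.Nonempty) (hQ : Q.card = k - 2)
    (hQX : Disjoint Q X) (hpk : p.card = k) (hpQ : Disjoint p Q) (hpX : (p ∩ X).card ≤ k - 2)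
    (hP : P.card ≤ c * (n - 3).choose (k - 3)) :
    ((intersectingSubfamilies (touchingBoth k X Q ∪ P) u).filter (p ∈ ·)).card ≤
      (l + k) * ((k - 2) * (n - 2).choose (k - 2) +
        (c + l * (k * (l + 2 * k)) + 2 * l * k ^ 2) * (n - 3).choose (k - 3)).choose (u - 1) +
      if 3 ≤ u then (l * k * (n - 2).choose (k - 2)) * ((l * k ^ 2 * (n - 3).choose (k - 3)) *
        ((k - 2) * (n - 2).choose (k - 2) +
        (c + l * (k * (l + 2 * k)) + 2 * l * k ^ 2) * (n - 3).choose (k - 3)).choose (u - 3))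
      else 0 := by
  set Rg := (touching k X).filter
    (fun A => ∃ i ∈ p ∩ X, ∃ q ∈ Q, A ∩ X = {i} ∧ A ∩ Q = {q}) with hRg
  set F := ((touchingBoth k X Q ∪ P).filter fun A => ¬ Disjoint A p).erase p with hF
  have hB : (P ∪ ((touchingBoth k X Q).filter (fun A => ¬ Disjoint A p) \ Rg)).card ≤
      (c + l * (k * (l + 2 * k))) * (n - 3).choose (k - 3) := by
    rw [add_mul]
    refine (card_union_le _ _).trans (Nat.add_le_add hP ?_)
    refine (card_le_of_triple hk X Q (X ∪ Q ∪ p) fun A hA => ?_).trans ?_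
    · obtain ⟨hA1, hA2⟩ := mem_sdiff.1 hA
      obtain ⟨hA1, hAp⟩ := mem_filter.1 hA1
      obtain ⟨hAk, hAX, hAQ⟩ := mem_touchingBoth.1 hA1
      obtain ⟨x, hxA, hxX⟩ := not_disjoint_iff.1 hAX
      obtain ⟨q, hqA, hqQ⟩ := not_disjoint_iff.1 hAQ
      have hxq : x ≠ q := fun h => disjoint_left.1 hQX hqQ (h ▸ hxX)
      refine ⟨hAk, x, hxX, q, hqQ, ?_⟩
      suffices h : ∃ z ∈ X ∪ Q ∪ p, x ≠ z ∧ q ≠ z ∧ z ∈ A by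
        obtain ⟨z, hz, h1, h2, h3⟩ := h
        exact ⟨z, hz, hxq, h1, h2, hxA, hqA, h3⟩
      by_cases h1 : A ∩ X = {x}
      · by_cases h2 : A ∩ Q = {q}
        · have hxp : x ∉ p := fun h => hA2 (mem_filter.2 ⟨mem_touching.2 ⟨hAk, hAX⟩, x,
            mem_inter.2 ⟨h, hxX⟩, q, hqQ, h1, h2⟩)
          obtain ⟨z, hzA, hzp⟩ := not_disjoint_iff.1 hAp
          exact ⟨z, mem_union_right _ hzp, fun h => hxp (h ▸ hzp),
            fun h => disjoint_left.1 hpQ hzp (h ▸ hqQ), hzA⟩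
        · obtain ⟨z, hz, hzq⟩ : ∃ z ∈ A ∩ Q, z ≠ q := by
            by_contra hcon
            push Not at hcon
            exact h2 (eq_singleton_iff_unique_mem.2 ⟨mem_inter.2 ⟨hqA, hqQ⟩, hcon⟩)
          obtain ⟨hzA, hzQ⟩ := mem_inter.1 hz
          exact ⟨z, mem_union_left _ (mem_union_right _ hzQ),
            fun h => disjoint_left.1 hQX hzQ (h ▸ hxX), hzq.symm, hzA⟩
      · obtain ⟨z, hz, hzq⟩ : ∃ z ∈ A ∩ X, z ≠ x := by
          by_contra hcon
          push Not at hcon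
          exact h1 (eq_singleton_iff_unique_mem.2 ⟨mem_inter.2 ⟨hxA, hxX⟩, hcon⟩)
        obtain ⟨hzA, hzX⟩ := mem_inter.1 hz
        exact ⟨z, mem_union_left _ (mem_union_left _ hzX), hzq.symm,
          fun h => disjoint_left.1 hQX hqQ (h ▸ hzX), hzA⟩
    · refine Nat.mul_le_mul_right _ ?_
      rw [hX, hQ]
      have : (X ∪ Q ∪ p).card ≤ l + 2 * k := by
        have h1 := card_union_le (X ∪ Q) p
        have h2 := card_union_le X Q
        omega
      gcongr
      omega
  have h := intersectingCount_le_of_regular (v := u - 1) (F := F) (Rg := Rg) hk hX hX0 hQ hQX.symm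
    inter_subset_right hpX (fun A hA => ?_) (fun A hA => ?_) hB
  · refine (card_intersectingSubfamilies_mem_le _ _ _).trans (h.trans (Nat.add_le_add_left ?_ _))
    have e : u - 1 - 2 = u - 3 := by omega
    rw [e]
    split_ifs with h1 h2 h2
    · exact le_rfl
    · omega
    · exact Nat.zero_le _
    · exact Nat.zero_le _
  · obtain ⟨h1, h2⟩ := mem_filter.1 hA
    exact ⟨(mem_touching.1 h1).1, h2⟩
  · obtain ⟨h1, h2⟩ := mem_filter.1 (mem_erase.1 hA).2
    rcases mem_union.1 h1 with h1 | h1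
    · by_cases h3 : A ∈ Rg
      · exact mem_union_right _ h3
      · exact mem_union_left _ (mem_union_right _ (mem_sdiff.2 ⟨mem_filter.2 ⟨h1, h2⟩, h3⟩))
    · exact mem_union_left _ (mem_union_left _ h1)

/-- The gain from adding a point to `Q`. -/
theorem exists_gain {k : ℕ} (hk : 3 ≤ k) {X Q : Finset (Fin n)} {x₀ : Fin n} (hX0 : X.Nonempty)
    (hQ : Q.card = k - 2) (hQX : Disjoint Q X) (hxQ : x₀ ∉ Q) (hxX : x₀ ∉ X) :
    ∃ N w : ℕ, N ≤ (k - 1) * (n - 2).choose (k - 2) ∧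
      (k - 1) * (n - 2).choose (k - 2) ≤ N + k ^ 2 * (n - 3).choose (k - 3) ∧
      (n - 2).choose (k - 2) ≤ w + k * (n - 3).choose (k - 3) ∧
      ∀ u, 1 ≤ u → ∃ g, intersectingCount (touchingBoth k X Q) u + g ≤
        intersectingCount (touchingBoth k X (insert x₀ Q)) u ∧ w * N.choose u ≤ N * g := by
  obtain ⟨i, hi⟩ := hX0
  have hiQ : ∀ q ∈ insert x₀ Q, i ≠ q := by
    intro q hq h
    rcases mem_insert.1 hq with rfl | hq
    · exact hxX (h ▸ hi)
    · exact disjoint_left.1 hQX hq (h ▸ hi)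
  have hQc : (insert x₀ Q).card = k - 1 := by rw [card_insert_of_notMem hxQ]; omega
  set S := (touchingBoth k X (insert x₀ Q)).filter (i ∈ ·) with hS
  set S₀ := (touchingBoth k X Q).filter (i ∈ ·) with hS₀
  have hSS : S₀ ⊆ S := by
    intro A hA
    obtain ⟨h1, h2⟩ := mem_filter.1 hA
    obtain ⟨h3, h4, h5⟩ := mem_touchingBoth.1 h1
    exact mem_filter.2 ⟨mem_touchingBoth.2 ⟨h3, h4, fun h => h5 (h.mono_right (subset_insert _ _))⟩,
      h2⟩
  refine ⟨S.card, (S \ S₀).card, ?_, ?_, ?_, ?_⟩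
  · have := card_le_of_pair (k := k) (by omega) (P := S) {i} (insert x₀ Q) fun A hA => ?_
    · rwa [card_singleton, one_mul, hQc] at this
    · obtain ⟨h1, h2⟩ := mem_filter.1 hA
      obtain ⟨h3, h4, h5⟩ := mem_touchingBoth.1 h1
      obtain ⟨q, hqA, hq⟩ := not_disjoint_iff.1 h5
      exact ⟨h3, i, mem_singleton_self _, q, hq, hiQ q hq, h2, hqA⟩
  · have h := sum_card_le_card_biUnion_add (insert x₀ Q)
      fun q => (powersetCard k univ).filter fun A => i ∈ A ∧ q ∈ A
    rw [sum_congr rfl fun q hq => card_filter_mem_mem (by omega) (hiQ q hq), sum_const, hQc,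
      smul_eq_mul] at h
    refine h.trans (Nat.add_le_add (card_le_card (biUnion_subset.2 fun q hq A hA => ?_)) ?_)
    · obtain ⟨h1, h2, h3⟩ := mem_filter.1 hA
      exact mem_filter.2 ⟨mem_touchingBoth.2 ⟨(mem_powersetCard.1 h1).2,
        not_disjoint_iff.2 ⟨i, h2, hi⟩, not_disjoint_iff.2 ⟨q, h3, hq⟩⟩, h2⟩
    · refine (sum_le_card_nsmul _ _ ((n - 3).choose (k - 3)) fun p hp => ?_).trans ?_
      · obtain ⟨h1, h2, h3⟩ := mem_offDiag.1 hp
        rw [← card_filter_mem_mem_mem hk (hiQ _ h1) (hiQ _ h2) h3]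
        refine card_le_card fun A hA => ?_
        obtain ⟨ha, hb⟩ := mem_inter.1 hA
        obtain ⟨h4, h5, h6⟩ := mem_filter.1 ha
        exact mem_filter.2 ⟨h4, h5, h6, (mem_filter.1 hb).2.2⟩
      · rw [smul_eq_mul, offDiag_card, hQc]
        refine Nat.mul_le_mul_right _ ((Nat.sub_le _ _).trans ?_)
        rw [sq]
        exact Nat.mul_le_mul (by omega) (by omega)
  · rw [← card_filter_mem_mem (by omega : 2 ≤ k) (hiQ x₀ (mem_insert_self _ _))]
    have hsub : (powersetCard k univ).filter (fun A => i ∈ A ∧ x₀ ∈ A) ⊆ (S \ S₀) ∪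
        (powersetCard k univ).filter (fun A => i ∈ A ∧ x₀ ∈ A ∧ ¬ Disjoint A Q) := by
      intro A hA
      obtain ⟨h1, h2, h3⟩ := mem_filter.1 hA
      by_cases hAQ : Disjoint A Q
      · refine mem_union_left _ (mem_sdiff.2 ⟨mem_filter.2 ⟨mem_touchingBoth.2
          ⟨(mem_powersetCard.1 h1).2, not_disjoint_iff.2 ⟨i, h2, hi⟩,
            not_disjoint_iff.2 ⟨x₀, h3, mem_insert_self _ _⟩⟩, h2⟩, fun h => ?_⟩)
        exact (mem_touchingBoth.1 (mem_filter.1 h).1).2.2 hAQ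
      · exact mem_union_right _ (mem_filter.2 ⟨h1, h2, h3, hAQ⟩)
    refine (card_le_card hsub).trans ((card_union_le _ _).trans (Nat.add_le_add_left ?_ _))
    refine (card_le_of_triple hk {i} {x₀} Q fun A hA => ?_).trans ?_
    · obtain ⟨h1, h2, h3, h4⟩ := mem_filter.1 hA
      obtain ⟨q, hqA, hq⟩ := not_disjoint_iff.1 h4
      exact ⟨(mem_powersetCard.1 h1).2, i, mem_singleton_self _, x₀, mem_singleton_self _, q, hq,
        hiQ _ (mem_insert_self _ _), hiQ q (mem_insert_of_mem hq), fun h => hxQ (h ▸ hq), h2, h3, hqA⟩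
    · rw [card_singleton, card_singleton, one_mul, one_mul, hQ]
      exact Nat.mul_le_mul_right _ (by omega)
  · intro u hu
    -- The gain counts the `u`-subfamilies of the star at `i` that use a new set, that is C(N,u) -
    -- C(N-w,u), which is at least (w/N)·C(N,u) by convexity.
    refine ⟨(powersetCard u S \ powersetCard u S₀).card, ?_, ?_⟩
    · rw [← card_intersectingSubfamilies, ← card_intersectingSubfamilies, ← card_union_of_disjoint]
      · refine card_le_card (union_subset (intersectingSubfamilies_mono ?_ _) fun G hG => ?_)
        · intro A hA
          obtain ⟨h3, h4, h5⟩ := mem_touchingBoth.1 hA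
          exact mem_touchingBoth.2 ⟨h3, h4, fun h => h5 (h.mono_right (subset_insert _ _))⟩
        · obtain ⟨h1, h2⟩ := mem_powersetCard.1 (mem_sdiff.1 hG).1
          exact mem_intersectingSubfamilies.2 ⟨⟨h1.trans (filter_subset _ _), h2⟩,
            intersecting_of_mem (x := i) fun A hA => (mem_filter.1 (h1 hA)).2⟩
      · rw [disjoint_left]
        intro G hG hG'
        obtain ⟨h1, h2⟩ := mem_sdiff.1 hG'
        obtain ⟨h1, h3⟩ := mem_powersetCard.1 h1
        refine h2 (mem_powersetCard.2 ⟨fun A hA => mem_filter.2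
          ⟨(mem_intersectingSubfamilies.1 hG).1.1 hA, (mem_filter.1 (h1 hA)).2⟩, h3⟩)
    · have hle := card_le_card hSS
      have h1 := mul_choose_le_mul_choose hle hu
      rw [card_sdiff_of_subset (powersetCard_mono hSS), card_powersetCard, card_powersetCard,
        card_sdiff_of_subset hSS, Nat.sub_mul, Nat.mul_sub]
      omega

set_option maxHeartbeats 400000 in
/-- Adding one more point to `Q` beats adding few sets off `Q`. -/
theorem intersectingCount_touchingBoth_union_le (k l c : ℕ) (hk : 3 ≤ k) :
    ∃ n₀, ∀ n, n₀ ≤ n → ∀ (X Q : Finset (Fin n)) (x₀ : Fin n) (P : Finset (Finset (Fin n))),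
      X.card = l → X.Nonempty → Q.card = k - 2 → Disjoint Q X → x₀ ∉ Q → x₀ ∉ X →
      (∀ p ∈ P, p.card = k ∧ Disjoint p Q ∧ (p ∩ X).card ≤ k - 2) →
      P.card ≤ c * (n - 3).choose (k - 3) →
      ∀ u, intersectingCount (touchingBoth k X Q ∪ P) u ≤
        intersectingCount (touchingBoth k X (insert x₀ Q)) u := by
  set a := c + l * (k * (l + 2 * k)) + 2 * l * k ^ 2 with ha
  set c₂ := 2 * c * (l + k) + 48 * c * (l ^ 2 * k ^ 3) with hc₂
  refine ⟨(2 * (a + k ^ 2 + k) + 2 * k * c₂ + 7) * k + k + 4, fun n hn X Q x₀ P hX hX0 hQ hQX hxQ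
    hxX hP hPc u => ?_⟩
  rcases Nat.eq_zero_or_pos u with rfl | hu
  · rw [intersectingCount_zero, intersectingCount_zero]
  obtain ⟨N, w, hN1, hN2, hw, hgain⟩ := exists_gain hk hX0 hQ hQX hxQ hxX
  obtain ⟨g, hg1, hg2⟩ := hgain u hu
  refine le_trans ?_ hg1
  refine (intersectingCount_le_add_sum (le_refl _) u).trans (Nat.add_le_add_left ?_ _)
  have hp : ∀ p ∈ P, _ := fun p hp => card_subfamilies_mem_le_of_off (u := u) hk hX hX0 hQ hQX
    (hP p hp).1 (hP p hp).2.1 (hP p hp).2.2 hPc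
  rw [← ha] at hp
  have hDE : (2 * (a + k ^ 2 + k) + 2 * k * c₂ + 7) * (n - 3).choose (k - 3) ≤
      (n - 2).choose (k - 2) := by
    have := mul_choose_pred_le (a := n - 2) (b := k - 2)
      (c := 2 * (a + k ^ 2 + k) + 2 * k * c₂ + 7) (by omega)
      (by
        have : (2 * (a + k ^ 2 + k) + 2 * k * c₂ + 7) * (k - 2) ≤
          (2 * (a + k ^ 2 + k) + 2 * k * c₂ + 7) * k := Nat.mul_le_mul_left _ (by omega)
        omega) (by omega)
    simpa [Nat.sub_sub] using this
  have hE0 : 1 ≤ (n - 3).choose (k - 3) := Nat.choose_pos (by omega)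
  clear_value a
  generalize hD : (n - 2).choose (k - 2) = D at *
  generalize hE : (n - 3).choose (k - 3) = E at *
  set M := (k - 2) * D + a * E with hM
  have hDE' : 2 * (a * E) + 2 * (k ^ 2 * E) + 2 * (k * E) + 2 * k * c₂ * E + 7 * E ≤ D := by
    refine le_of_eq_of_le ?_ hDE
    ring
  have hkD : (k - 1) * D = (k - 2) * D + D := by
    have : k - 1 = (k - 2) + 1 := by omega
    rw [this, add_mul, one_mul]
  -- A subfamily containing some `p` draws its other members mainly from about (k-2)D sets, whereas
  -- the enlarged star has about (k-1)D. This gap, at least D/2, makes the loss smaller than the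
  -- gain.
  have hMN : M ≤ N := by omega
  have hMN3 : D + 4 ≤ 2 * (N - M) := by omega
  have hMN2 : D ≤ 2 * (N - M) := by omega
  have hsum := sum_le_card_nsmul P _ _ hp
  refine hsum.trans ?_
  rw [smul_eq_mul]
  set A := M.choose (u - 1) with hA
  set T := N.choose u with hT
  have hAT : D * A ≤ 2 * T := by
    have := choose_mul_choose_sub_le (a := M) (b := N) (t := u) (s := 1) hMN hu
    rw [Nat.choose_one_right] at this
    calc D * A ≤ 2 * (N - M) * A := Nat.mul_le_mul_right _ hMN2
      _ = 2 * (A * (N - M)) := by ring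
      _ ≤ 2 * T := by gcongr
  set B := if 3 ≤ u then M.choose (u - 3) else 0 with hB
  -- The constant is 2³·3!, from `pow_le_mul_choose` with s = 3.
  have hBT : D ^ 3 * B ≤ 48 * T := by
    rw [hB]
    split_ifs with h3
    · have h1 := choose_mul_choose_sub_le (a := M) (b := N) (t := u) (s := 3) hMN h3
      have h2 := pow_le_mul_choose (D := D) (N := N - M) (s := 3) (by omega)
      norm_num [Nat.factorial] at h2
      calc D ^ 3 * M.choose (u - 3) ≤ 48 * (N - M).choose 3 * M.choose (u - 3) := by gcongr
        _ = 48 * (M.choose (u - 3) * (N - M).choose 3) := by ring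
        _ ≤ 48 * T := by gcongr
    · simp
  have hBB : (if 3 ≤ u then l * k * D * (l * k ^ 2 * E * M.choose (u - 3)) else 0) =
      l ^ 2 * k ^ 3 * (D * E * B) := by
    rw [hB]
    split_ifs
    · ring
    · simp
  rw [hBB]
  have hgT : T ≤ 2 * k * g := by
    have hD0 : 0 < D := by omega
    refine Nat.le_of_mul_le_mul_left ?_ hD0
    have h1 : D ≤ 2 * w := by omega
    calc D * T ≤ 2 * w * T := Nat.mul_le_mul_right _ h1
      _ = 2 * (w * T) := by ring
      _ ≤ 2 * (N * g) := by gcongr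
      _ ≤ 2 * (k * D * g) := by
          gcongr
          exact hN1.trans (Nat.mul_le_mul_right _ (by omega))
      _ = _ := by ring
  -- The O(E) sets of `P` each lose O(T/D) + O(E·T/D²), in total O((E/D)·T), against a gain of at
  -- least T/(2k). Here E denotes C(n-3,k-3) and D denotes C(n-2,k-2).
  have hfin : D ^ 2 * (P.card * ((l + k) * A + l ^ 2 * k ^ 3 * (D * E * B))) ≤ D ^ 2 * g := by
    refine Nat.le_of_mul_le_mul_left ?_ (show 0 < 2 * k by omega)
    have hED : E ≤ D := by omega
    have h1 : 2 * k * c₂ * E ≤ D := by omega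
    calc 2 * k * (D ^ 2 * (P.card * ((l + k) * A + l ^ 2 * k ^ 3 * (D * E * B))))
        ≤ 2 * k * (D ^ 2 * (c * E * ((l + k) * A + l ^ 2 * k ^ 3 * (D * E * B)))) := by gcongr
      _ = 2 * k * (c * E * ((l + k) * D * (D * A) + l ^ 2 * k ^ 3 * E * (D ^ 3 * B))) := by ring
      _ ≤ 2 * k * (c * E * ((l + k) * D * (2 * T) + l ^ 2 * k ^ 3 * D * (48 * T))) := by gcongr
      _ = 2 * k * c₂ * E * (D * T) := by rw [hc₂]; ring
      _ ≤ D * (D * T) := by gcongr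
      _ ≤ D * (D * (2 * k * g)) := by gcongr
      _ = _ := by ring
  exact Nat.le_of_mul_le_mul_left hfin (by have : 0 < D := by omega
                                           positivity)

/-! ### The best remainder beyond a full union of stars is a sunflower. -/

/-- The members of `S` meeting every member of `T`. -/
def cross (S T : Finset (Finset (Fin n))) : Finset (Finset (Fin n)) :=
  S.filter fun A => ∀ B ∈ T, ¬ Disjoint A B

/-- If passing from `T ⊆ R` to `T' ⊆ R'` never decreases the number of intersecting families
crossing `T`, then `S ∪ R` has at most as many intersecting subfamilies as `S ∪ R'`. -/
theorem intersectingCount_union_le_union {S R R' : Finset (Finset (Fin n))}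
    (hSR' : Disjoint S R') (hRR' : R.card = R'.card)
    (hR' : (R' : Set (Finset (Fin n))).Intersecting)
    (h : ∀ T ⊆ R, ∀ T' ⊆ R', T.card = T'.card → ∀ u,
      intersectingCount (cross S T) u ≤ intersectingCount (cross S T') u) (t : ℕ) :
    intersectingCount (S ∪ R) t ≤ intersectingCount (S ∪ R') t := by
  obtain ⟨e⟩ : Nonempty (R ≃ R') := ⟨equivOfCardEq hRR'⟩
  let f : Finset (Fin n) → Finset (Fin n) := fun A => if hA : A ∈ R then e ⟨A, hA⟩ else A
  have hf : ∀ A (hA : A ∈ R), f A = e ⟨A, hA⟩ := fun A hA => dif_pos hA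
  have hfm : ∀ A ∈ R, f A ∈ R' := fun A hA => by rw [hf A hA]; exact (e ⟨A, hA⟩).2
  have hfi : Set.InjOn f R := by
    intro A hA B hB hAB
    rw [hf A hA, hf B hB] at hAB
    have := e.injective (Subtype.ext hAB)
    exact congrArg Subtype.val this
  have himi : Set.InjOn (fun T => T.image f) (R.powerset : Set (Finset (Finset (Fin n)))) := by
    intro T hT T' hT' hTT
    have hT := mem_powerset.1 hT
    have hT' := mem_powerset.1 hT'
    have aux : ∀ U V : Finset (Finset (Fin n)), U ⊆ R → V ⊆ R → U.image f = V.image f → U ⊆ V := by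
      intro U V hU hV hUV A hA
      obtain ⟨B, hB, hBA⟩ := mem_image.1 (hUV ▸ mem_image_of_mem f hA)
      rwa [← hfi (hV hB) (hU hA) hBA]
    exact (aux T T' hT hT' hTT).antisymm (aux T' T hT' hT hTT.symm)
  -- Sort by the trace T on `R`: the rest of the subfamily is intersecting and crosses T. This is
  -- only an upper bound, T itself possibly not being intersecting.
  have hup : intersectingCount (S ∪ R) t ≤
      ∑ T ∈ R.powerset, if T.card ≤ t then intersectingCount (cross S T) (t - T.card) else 0 := by
    rw [← card_intersectingSubfamilies, card_eq_sum_card_fiberwise (f := fun G => G ∩ R)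
      (t := R.powerset) fun G _ => mem_powerset.2 inter_subset_right]
    refine sum_le_sum fun T hT => ?_
    split_ifs with hTt
    · refine card_le_card_of_injOn (fun G => G \ T) ?_ ?_
      · intro G hG
        obtain ⟨hG, hGT⟩ := mem_filter.1 hG
        obtain ⟨⟨h1, h2⟩, h3⟩ := mem_intersectingSubfamilies.1 hG
        have hTG : T ⊆ G := hGT ▸ inter_subset_left
        refine mem_intersectingSubfamilies.2 ⟨⟨fun A hA => ?_, ?_⟩,
          h3.mono (by exact_mod_cast sdiff_subset)⟩
        · obtain ⟨hAG, hAT⟩ := mem_sdiff.1 hA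
          refine mem_filter.2 ⟨(mem_union.1 (h1 hAG)).resolve_right fun hAR => hAT ?_,
            fun B hB => h3 hAG (hTG hB)⟩
          rw [← hGT]; exact mem_inter.2 ⟨hAG, hAR⟩
        · rw [card_sdiff_of_subset hTG, h2]
      · intro G hG G' hG' hGG
        have hTG : T ⊆ G := (mem_filter.1 hG).2 ▸ inter_subset_left
        have hTG' : T ⊆ G' := (mem_filter.1 hG').2 ▸ inter_subset_left
        have hGG : G \ T = G' \ T := hGG
        rw [← sdiff_union_of_subset hTG, hGG, sdiff_union_of_subset hTG']
    · rw [Nat.le_zero, card_eq_zero, filter_eq_empty_iff]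
      intro G hG hGT
      have hTG : T ⊆ G := hGT ▸ inter_subset_left
      have := card_le_card hTG
      rw [(mem_intersectingSubfamilies.1 hG).1.2] at this
      exact hTt this
  -- The converse holds for `R'`: as `R'` is intersecting, every T ⊆ `R'` extends by any
  -- intersecting family crossing it.
  have hlow : ∑ T ∈ R'.powerset, (if T.card ≤ t then
      intersectingCount (cross S T) (t - T.card) else 0) ≤ intersectingCount (S ∪ R') t := by
    rw [← card_intersectingSubfamilies (S ∪ R'), card_eq_sum_card_fiberwise (f := fun G => G ∩ R')
      (t := R'.powerset) fun G _ => mem_powerset.2 inter_subset_right]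
    refine sum_le_sum fun T hT => ?_
    have hT := mem_powerset.1 hT
    have hdisj : ∀ {u H}, H ∈ intersectingSubfamilies (cross S T) u → Disjoint H R' := by
      intro u H hH
      exact hSR'.mono_left ((mem_intersectingSubfamilies.1 hH).1.1.trans (filter_subset _ _))
    split_ifs with hTt
    · refine card_le_card_of_injOn (fun H => H ∪ T) ?_ ?_
      · intro H hH
        have hHR := hdisj hH
        obtain ⟨⟨h1, h2⟩, h3⟩ := mem_intersectingSubfamilies.1 hH
        refine mem_filter.2 ⟨mem_intersectingSubfamilies.2 ⟨⟨union_subset_union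
          (h1.trans (filter_subset _ _)) hT, ?_⟩, ?_⟩, ?_⟩
        · rw [card_union_of_disjoint (hHR.mono_right hT), h2]; omega
        · intro A hA B hB
          rcases mem_union.1 (mem_coe.1 hA) with hA | hA <;>
            rcases mem_union.1 (mem_coe.1 hB) with hB | hB
          · exact h3 hA hB
          · exact (mem_filter.1 (h1 hA)).2 B hB
          · exact fun h => (mem_filter.1 (h1 hB)).2 A hA h.symm
          · exact hR' (hT hA) (hT hB)
        · change (H ∪ T) ∩ R' = T
          rw [union_inter_distrib_right, disjoint_iff_inter_eq_empty.1 hHR, empty_union,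
            inter_eq_left.2 hT]
      · intro H hH H' hH' hHH
        have h1 := (hdisj hH).mono_right hT
        have h2 := (hdisj hH').mono_right hT
        have hHH : H ∪ T = H' ∪ T := hHH
        rw [← union_sdiff_cancel_right h1, hHH, union_sdiff_cancel_right h2]
    · exact Nat.zero_le _
  refine hup.trans (le_trans ?_ hlow)
  calc _ ≤ ∑ T ∈ R.powerset, if (T.image f).card ≤ t then
        intersectingCount (cross S (T.image f)) (t - (T.image f).card) else 0 := by
        refine sum_le_sum fun T hT => ?_
        have hT := mem_powerset.1 hT
        have hc : (T.image f).card = T.card := card_image_of_injOn (hfi.mono (by exact_mod_cast hT))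
        rw [hc]
        split_ifs
        · refine h T hT _ (fun B hB => ?_) hc.symm _
          obtain ⟨A, hA, rfl⟩ := mem_image.1 hB
          exact hfm A (hT hA)
        · exact le_rfl
    _ = ∑ T ∈ R.powerset.image (fun T => T.image f), if T.card ≤ t then
        intersectingCount (cross S T) (t - T.card) else 0 := by rw [sum_image himi]
    _ ≤ _ := by
        refine sum_le_sum_of_subset fun T' hT' => ?_
        obtain ⟨T, hT, rfl⟩ := mem_image.1 hT'
        refine mem_powerset.2 fun B hB => ?_
        obtain ⟨A, hA, rfl⟩ := mem_image.1 hB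
        exact hfm A (mem_powerset.1 hT hA)

theorem permFamily_touching {k : ℕ} {σ : Equiv.Perm (Fin n)} {X Y : Finset (Fin n)}
    (h : X.image σ = Y) : permFamily σ (touching k X) = touching k Y := by
  subst h
  refine eq_of_subset_of_card_le (fun B hB => ?_) ?_
  · obtain ⟨A, hA, rfl⟩ := mem_image.1 hB
    obtain ⟨h1, h2⟩ := mem_touching.1 hA
    exact mem_touching.2 ⟨by rw [card_image_of_injective _ σ.injective, h1],
      fun h => h2 (disjoint_image_perm.1 h)⟩
  · rw [card_permFamily]
    have h1 := card_touching_add k X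
    have h2 := card_touching_add k (X.image σ)
    rw [card_image_of_injective _ σ.injective] at h2
    omega

theorem permFamily_cross (σ : Equiv.Perm (Fin n)) (S T : Finset (Finset (Fin n))) :
    permFamily σ (cross S T) = cross (permFamily σ S) (permFamily σ T) := by
  ext B
  constructor
  · intro hB
    obtain ⟨A, hA, rfl⟩ := mem_image.1 hB
    obtain ⟨h1, h2⟩ := mem_filter.1 hA
    refine mem_filter.2 ⟨image_mem_permFamily.2 h1, fun C' hC' => ?_⟩
    obtain ⟨C, hC, rfl⟩ := mem_image.1 hC'
    exact fun h => h2 C hC (disjoint_image_perm.1 h)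
  · intro hB
    obtain ⟨h1, h2⟩ := mem_filter.1 hB
    obtain ⟨A, hA, rfl⟩ := mem_image.1 h1
    refine image_mem_permFamily.2 (mem_filter.2 ⟨hA, fun C hC h => ?_⟩)
    exact h2 _ (image_mem_permFamily.2 hC) (disjoint_image_perm.2 h)

/-- Three pairwise disjoint sets can be moved to three others of the same sizes. -/
theorem exists_perm_image_eq {A B C A' B' C' : Finset (Fin n)} (hA : A.card = A'.card)
    (hB : B.card = B'.card) (hC : C.card = C'.card) (hAB : Disjoint A B) (hAC : Disjoint A C)
    (hBC : Disjoint B C) (hAB' : Disjoint A' B') (hAC' : Disjoint A' C') (hBC' : Disjoint B' C') :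
    ∃ σ : Equiv.Perm (Fin n), A.image σ = A' ∧ B.image σ = B' ∧ C.image σ = C' := by
  -- Colour each point by which of the three sets contains it, the fourth colour being the
  -- complement; a permutation matching colour classes moves all three sets at once.
  let col : Finset (Fin n) → Finset (Fin n) → Finset (Fin n) → Fin n → Fin 4 := fun A B C x =>
    if x ∈ A then 0 else if x ∈ B then 1 else if x ∈ C then 2 else 3
  have c0 : ∀ A B C x, col A B C x = 0 ↔ x ∈ A := by
    intro A B C x; simp only [col]; split_ifs <;> simp_all
  have c1 : ∀ A B C x, Disjoint A B → (col A B C x = 1 ↔ x ∈ B) := by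
    intro A B C x h
    have : x ∈ _ → x ∉ _ := fun hx => disjoint_left.1 h hx
    simp only [col]; split_ifs <;> simp_all
  have c2 : ∀ A B C x, Disjoint A C → Disjoint B C → (col A B C x = 2 ↔ x ∈ C) := by
    intro A B C x h h'
    have : x ∈ _ → x ∉ _ := fun hx => disjoint_left.1 h hx
    have : x ∈ _ → x ∉ _ := fun hx => disjoint_left.1 h' hx
    simp only [col]; split_ifs <;> simp_all
  have c3 : ∀ A B C x, col A B C x = 3 ↔ x ∈ (A ∪ B ∪ C)ᶜ := by
    intro A B C x; simp only [col]; split_ifs <;> simp_all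
  have hun : ∀ {A B C : Finset (Fin n)}, Disjoint A B → Disjoint A C → Disjoint B C →
      (A ∪ B ∪ C).card = A.card + B.card + C.card := by
    intro A B C h1 h2 h3
    rw [card_union_of_disjoint (disjoint_union_left.2 ⟨h2, h3⟩), card_union_of_disjoint h1]
  obtain ⟨σ, hσ⟩ := exists_perm_comp_eq (col A B C) (col A' B' C') (by
    intro b
    fin_cases b
    · simpa [c0] using hA
    · simpa [c1 _ _ _ _ hAB, c1 _ _ _ _ hAB'] using hB
    · simpa [c2 _ _ _ _ hAC hBC, c2 _ _ _ _ hAC' hBC'] using hC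
    · have e1 : (univ.filter fun x => col A B C x = 3) = (A ∪ B ∪ C)ᶜ := by
        ext x; rw [mem_filter, c3]; simp
      have e2 : (univ.filter fun x => col A' B' C' x = 3) = (A' ∪ B' ∪ C')ᶜ := by
        ext x; rw [mem_filter, c3]; simp
      change (univ.filter fun x => col A B C x = 3).card = (univ.filter fun x => col A' B' C' x = 3).card
      rw [e1, e2, card_compl, card_compl, hun hAB hAC hBC, hun hAB' hAC' hBC', hA, hB, hC])
  refine ⟨σ, ?_, ?_, ?_⟩
  · refine eq_of_subset_of_card_le (fun y hy => ?_) (by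
      rw [card_image_of_injective _ σ.injective, hA])
    obtain ⟨x, hx, rfl⟩ := mem_image.1 hy
    rw [← c0 A' B' C', hσ, c0]; exact hx
  · refine eq_of_subset_of_card_le (fun y hy => ?_) (by
      rw [card_image_of_injective _ σ.injective, hB])
    obtain ⟨x, hx, rfl⟩ := mem_image.1 hy
    rw [← c1 A' B' C' _ hAB', hσ, c1 _ _ _ _ hAB]; exact hx
  · refine eq_of_subset_of_card_le (fun y hy => ?_) (by
      rw [card_image_of_injective _ σ.injective, hC])
    obtain ⟨x, hx, rfl⟩ := mem_image.1 hy
    rw [← c2 A' B' C' _ hAC' hBC', hσ, c2 _ _ _ _ hAC hBC]; exact hx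

theorem eq_insert_of_card {A Q : Finset (Fin n)} {k : ℕ} (hA : A.card = k) (hQ : Q.card + 1 = k)
    (hQA : Q ⊆ A) {x : Fin n} (hx : x ∈ A) (hxQ : x ∉ Q) : A = insert x Q := by
  refine (eq_of_subset_of_card_le (insert_subset hx hQA) ?_).symm
  rw [card_insert_of_notMem hxQ, hA, hQ]

/-- Over a kernel of size k - 1 each member has a single extra point, and distinct members have
distinct extra points. -/
theorem card_biUnion_sdiff_kernel {T : Finset (Finset (Fin n))} {Q : Finset (Fin n)} {k : ℕ}
    (hT : ∀ A ∈ T, A.card = k ∧ Q ⊆ A) (hQ : Q.card + 1 = k) :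
    (T.biUnion fun A => A \ Q).card = T.card := by
  rw [card_biUnion]
  · rw [card_eq_sum_ones]
    refine sum_congr rfl fun A hA => ?_
    rw [card_sdiff_of_subset (hT A hA).2, (hT A hA).1]
    omega
  · intro A hA B hB hAB
    rw [Function.onFun, disjoint_left]
    intro x hx hx'
    rw [mem_sdiff] at hx hx'
    exact hAB ((eq_insert_of_card (hT A hA).1 hQ (hT A hA).2 hx.1 hx.2).trans
      (eq_insert_of_card (hT B hB).1 hQ (hT B hB).2 hx'.1 hx'.2).symm)

/-- Two sunflowers of equal size with kernels of size k - 1 are equivalent under a permutation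
preserving `X`: send kernel to kernel and petals to petals. -/
theorem intersectingCount_cross_eq_of_kernel {k : ℕ} {X Q K : Finset (Fin n)}
    {T T' : Finset (Finset (Fin n))} (hQ : Q.card + 1 = k) (hK : K.card + 1 = k)
    (hQX : Disjoint Q X) (hKX : Disjoint K X)
    (hT : ∀ A ∈ T, A.card = k ∧ Disjoint A X ∧ Q ⊆ A)
    (hT' : ∀ A ∈ T', A.card = k ∧ Disjoint A X ∧ K ⊆ A) (hTT : T.card = T'.card) (u : ℕ) :
    intersectingCount (cross (touching k X) T) u =
      intersectingCount (cross (touching k X) T') u := by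
  have e1 := card_biUnion_sdiff_kernel (fun A hA => ⟨(hT A hA).1, (hT A hA).2.2⟩) hQ
  have e2 := card_biUnion_sdiff_kernel (fun A hA => ⟨(hT' A hA).1, (hT' A hA).2.2⟩) hK
  have dX : ∀ {T : Finset (Finset (Fin n))} {Q : Finset (Fin n)},
      (∀ A ∈ T, A.card = k ∧ Disjoint A X ∧ Q ⊆ A) → Disjoint X (T.biUnion fun A => A \ Q) := by
    intro T Q hT
    rw [disjoint_biUnion_right]
    exact fun A hA => (hT A hA).2.1.symm.mono_right sdiff_subset
  have dQ : ∀ {T : Finset (Finset (Fin n))} {Q : Finset (Fin n)},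
      Disjoint Q (T.biUnion fun A => A \ Q) := by
    intro T Q
    rw [disjoint_biUnion_right]
    exact fun A _ => disjoint_sdiff
  obtain ⟨σ, hσX, hσQ, hσE⟩ := exists_perm_image_eq (A := X) (A' := X) (B := Q) (B' := K)
    (C := T.biUnion fun A => A \ Q) (C' := T'.biUnion fun A => A \ K) rfl (by omega) (by omega)
    hQX.symm (dX hT) dQ hKX.symm (dX hT') dQ
  have hσT : permFamily σ T = T' := by
    refine eq_of_subset_of_card_le (fun B hB => ?_) (by rw [card_permFamily, hTT])
    obtain ⟨A, hA, rfl⟩ := mem_image.1 hB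
    obtain ⟨hAk, hAX, hQA⟩ := hT A hA
    obtain ⟨x, hx⟩ : (A \ Q).Nonempty := card_pos.1 (by rw [card_sdiff_of_subset hQA]; omega)
    obtain ⟨hxA, hxQ⟩ := mem_sdiff.1 hx
    have h1 : σ x ∈ T'.biUnion fun A => A \ K := by
      rw [← hσE]; exact mem_image_of_mem _ (mem_biUnion.2 ⟨A, hA, hx⟩)
    obtain ⟨A', hA', hx'⟩ := mem_biUnion.1 h1
    obtain ⟨hxA', hxK⟩ := mem_sdiff.1 hx'
    obtain ⟨hAk', -, hKA'⟩ := hT' A' hA'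
    rw [eq_insert_of_card hAk hQ hQA hxA hxQ]
    change (insert x Q).image σ ∈ T'
    rw [image_insert, hσQ, ← eq_insert_of_card hAk' hK hKA' hxA' hxK]
    exact hA'
  rw [← intersectingCount_permFamily σ (cross _ T), permFamily_cross, permFamily_touching hσX, hσT]

/-- A family `T` without a kernel of size k - 1 is hard to cross. A crossing set either meets a
fixed (k-2)-subset Q of one member, or is caught by three points from bounded sets. For the
sunflower `T'` it suffices to meet the (k-1)-set `K`, and the additional point of `K` outweighs the
exceptional sets. -/
theorem intersectingCount_cross_le (k l : ℕ) (hk : 2 ≤ k) :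
    ∃ n₀, ∀ n, n₀ ≤ n → ∀ (X K : Finset (Fin n)) (T T' : Finset (Finset (Fin n))),
      X.card = l → K.card + 1 = k → Disjoint K X → (∀ A ∈ T, A.card = k ∧ Disjoint A X) →
      (∀ A ∈ T', A.card = k ∧ Disjoint A X ∧ K ⊆ A) → T.card = T'.card → ∀ u,
      intersectingCount (cross (touching k X) T) u ≤
        intersectingCount (cross (touching k X) T') u := by
  obtain ⟨n₀, hn₀⟩ : ∃ n₀, 3 ≤ k → ∀ n, n₀ ≤ n → ∀ (X Q : Finset (Fin n)) (x₀ : Fin n)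
      (P : Finset (Finset (Fin n))),
      X.card = l → X.Nonempty → Q.card = k - 2 → Disjoint Q X → x₀ ∉ Q → x₀ ∉ X →
      (∀ p ∈ P, p.card = k ∧ Disjoint p Q ∧ (p ∩ X).card ≤ k - 2) →
      P.card ≤ (l * (k * (k * k))) * (n - 3).choose (k - 3) →
      ∀ u, intersectingCount (touchingBoth k X Q ∪ P) u ≤
        intersectingCount (touchingBoth k X (insert x₀ Q)) u := by
    by_cases h : 3 ≤ k
    · obtain ⟨n₀, h'⟩ := intersectingCount_touchingBoth_union_le k l (l * (k * (k * k))) h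
      exact ⟨n₀, fun _ => h'⟩
    · exact ⟨0, fun h' => absurd h' h⟩
  refine ⟨n₀ + k + l, fun n hn X K T T' hX hK hKX hT hT' hTT u => ?_⟩
  rcases X.eq_empty_or_nonempty with rfl | hX0
  · refine intersectingCount_mono (fun A hA => ?_) u
    exact absurd (disjoint_empty_right A) (mem_touching.1 (mem_filter.1 hA).1).2
  rcases T.eq_empty_or_nonempty with rfl | hT0
  · rw [card_empty, eq_comm, card_eq_zero] at hTT
    rw [hTT]
  obtain ⟨B₁, hB₁⟩ := hT0
  set Q₀ : Finset (Fin n) := B₁.filter fun x => ∀ B ∈ T, x ∈ B with hQ₀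
  have hQ₀T : ∀ B ∈ T, Q₀ ⊆ B := fun B hB x hx => (mem_filter.1 hx).2 B hB
  by_cases hQc : k - 1 ≤ Q₀.card
  · obtain ⟨Q, hQ, hQk⟩ := exists_subset_card_eq hQc
    exact (intersectingCount_cross_eq_of_kernel (Q := Q) (by omega) hK
      ((hT B₁ hB₁).2.mono_left (hQ.trans (hQ₀T B₁ hB₁))) hKX
      (fun A hA => ⟨(hT A hA).1, (hT A hA).2, hQ.trans (hQ₀T A hA)⟩) hT' hTT u).le
  -- As `Q` contains every common point of `T`, each point of `B₁` outside `Q` is missed by some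
  -- member of `T`.
  obtain ⟨Q, hQ₀Q, hQB, hQk⟩ := exists_subsuperset_card_eq (hQ₀T B₁ hB₁)
    (show Q₀.card ≤ k - 2 by omega) (by rw [(hT B₁ hB₁).1]; omega)
  have hmiss : ∀ x : Fin n, ∃ B : Finset (Fin n), B.card ≤ k ∧
      (x ∈ B₁ → x ∉ Q → B ∈ T ∧ x ∉ B) := by
    intro x
    by_cases hx : x ∈ B₁ ∧ x ∉ Q
    · have : ∃ B ∈ T, x ∉ B := by
        by_contra hcon
        push Not at hcon
        exact hx.2 (hQ₀Q (mem_filter.2 ⟨hx.1, hcon⟩))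
      obtain ⟨B, hB, hxB⟩ := this
      exact ⟨B, (hT B hB).1.le, fun _ _ => ⟨hB, hxB⟩⟩
    · exact ⟨∅, by simp, fun h1 h2 => absurd ⟨h1, h2⟩ hx⟩
  choose M hMc hM using hmiss
  -- A crossing set disjoint from `Q` meets `B₁` in some y outside `Q`, then meets the member of `T`
  -- missing y in another point z. Both are off `X`, so with its point in `X` it contains three
  -- distinct points from bounded sets and has at most k - 2 points in `X`.
  set P := (cross (touching k X) T).filter fun A => Disjoint A Q with hP
  have hPprop : ∀ A ∈ P, A.card = k ∧ Disjoint A Q ∧ ∃ x ∈ X, ∃ y ∈ B₁, ∃ z ∈ B₁.biUnion M,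
      x ≠ y ∧ x ≠ z ∧ y ≠ z ∧ x ∈ A ∧ y ∈ A ∧ z ∈ A ∧ y ∉ X ∧ z ∉ X := by
    intro A hA
    obtain ⟨h1, hAQ⟩ := mem_filter.1 hA
    obtain ⟨h1, h2⟩ := mem_filter.1 h1
    obtain ⟨hAk, hAX⟩ := mem_touching.1 h1
    obtain ⟨x, hxA, hxX⟩ := not_disjoint_iff.1 hAX
    obtain ⟨y, hyA, hyB⟩ := not_disjoint_iff.1 (h2 B₁ hB₁)
    obtain ⟨hMT, hyM⟩ := hM y hyB (disjoint_left.1 hAQ hyA)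
    obtain ⟨z, hzA, hzM⟩ := not_disjoint_iff.1 (h2 _ hMT)
    have hyX := disjoint_left.1 (hT B₁ hB₁).2 hyB
    have hzX := disjoint_left.1 (hT _ hMT).2 hzM
    exact ⟨hAk, hAQ, x, hxX, y, hyB, z, mem_biUnion.2 ⟨y, hyB, hzM⟩, fun h => hyX (h ▸ hxX),
      fun h => hzX (h ▸ hxX), fun h => hyM (h ▸ hzM), hxA, hyA, hzA, hyX, hzX⟩
  have hsub : cross (touching k X) T ⊆ touchingBoth k X Q ∪ P := by
    intro A hA
    by_cases hAQ : Disjoint A Q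
    · exact mem_union_right _ (mem_filter.2 ⟨hA, hAQ⟩)
    · exact mem_union_left _ (mem_filter.2 ⟨(mem_filter.1 hA).1, hAQ⟩)
  rcases Nat.lt_or_ge k 3 with hk3 | hk3
  · refine intersectingCount_mono (fun A hA => ?_) u
    -- For `k = 2` a two-element set would contain three distinct points, so nothing crosses `T`.
    exfalso
    have hQ0 : Q = ∅ := card_eq_zero.1 (by omega)
    have hAP : A ∈ P := mem_filter.2 ⟨hA, hQ0 ▸ disjoint_empty_right A⟩
    obtain ⟨hAk, -, x, -, y, -, z, -, h1, h2, h3, hx, hy, hz, -⟩ := hPprop A hAP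
    have : ({x, y, z} : Finset (Fin n)) ⊆ A := by simp [insert_subset_iff, hx, hy, hz]
    have := card_le_card this
    rw [card_eq_three.2 ⟨x, y, z, h1, h2, h3, rfl⟩] at this
    omega
  have hQX : Disjoint Q X := (hT B₁ hB₁).2.mono_left hQB
  obtain ⟨x₀, hx₀⟩ : ((Q ∪ X)ᶜ).Nonempty := card_pos.1 (by
    rw [card_compl, Fintype.card_fin, card_union_of_disjoint hQX]; omega)
  rw [mem_compl, mem_union, not_or] at hx₀
  refine (intersectingCount_mono hsub u).trans ((hn₀ hk3 n (by omega) X Q x₀ P hX hX0 hQk hQX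
    hx₀.1 hx₀.2 (fun A hA => ?_) ?_ u).trans ?_)
  · obtain ⟨hAk, hAQ, x, -, y, -, z, -, h1, h2, h3, hx, hy, hz, hyX, hzX⟩ := hPprop A hA
    refine ⟨hAk, hAQ, ?_⟩
    have h4 : ({y, z} : Finset (Fin n)) ⊆ A \ X := by
      simp [insert_subset_iff, hy, hz, hyX, hzX]
    have h5 := card_le_card h4
    rw [card_pair h3] at h5
    have h6 := card_inter_add_card_sdiff A X
    omega
  · refine (card_le_of_triple hk3 X B₁ (B₁.biUnion M) fun A hA => ?_).trans ?_
    · obtain ⟨hAk, -, x, hx, y, hy, z, hz, h1, h2, h3, h4, h5, h6, -⟩ := hPprop A hA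
      exact ⟨hAk, x, hx, y, hy, z, hz, h1, h2, h3, h4, h5, h6⟩
    · refine Nat.mul_le_mul_right _ ?_
      have h1 := card_biUnion_le_card_mul B₁ M k fun x _ => hMc x
      rw [(hT B₁ hB₁).1] at h1
      rw [hX, (hT B₁ hB₁).1]
      gcongr
  -- Move the enlarged `Q` to `K`, preserving `X`. A set meeting `K` meets every member of `T'`, all
  -- of which contain `K`.
  · obtain ⟨σ, hσX, hσQ, -⟩ := exists_perm_image_eq (A := X) (A' := X) (B := insert x₀ Q) (B' := K)
      (C := ∅) (C' := ∅) rfl (by rw [card_insert_of_notMem hx₀.1]; omega) rfl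
      (disjoint_insert_right.2 ⟨hx₀.2, hQX.symm⟩) (disjoint_empty_right _) (disjoint_empty_right _)
      hKX.symm (disjoint_empty_right _) (disjoint_empty_right _)
    rw [← intersectingCount_permFamily σ]
    refine intersectingCount_mono (fun B hB => ?_) u
    obtain ⟨A, hA, rfl⟩ := mem_image.1 hB
    obtain ⟨h1, h2⟩ := mem_filter.1 hA
    refine mem_filter.2 ⟨?_, fun C hC h => ?_⟩
    · rw [← permFamily_touching hσX]; exact image_mem_permFamily.2 h1
    · refine h2 ((disjoint_image_perm (σ := σ)).1 ?_)
      rw [hσQ]; exact h.mono_right (hT' C hC).2.2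

/-- If a family contains all `k`-sets meeting an `l`-set, the best way of choosing its remaining
members is a sunflower with a kernel of size `k - 1`. -/
theorem intersectingCount_touching_union_le (k l : ℕ) (hk : 2 ≤ k) :
    ∃ n₀, ∀ n, n₀ ≤ n → ∀ (X₁ X K : Finset (Fin n)) (R R' : Finset (Finset (Fin n))),
      X₁.card = l → X.card = l → K.card + 1 = k → Disjoint K X →
      (∀ A ∈ R, A.card = k ∧ Disjoint A X₁) →
      (∀ A ∈ R', A.card = k ∧ Disjoint A X ∧ K ⊆ A) → R.card = R'.card → ∀ t,
      intersectingCount (touching k X₁ ∪ R) t ≤ intersectingCount (touching k X ∪ R') t := by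
  obtain ⟨n₀, hn₀⟩ := intersectingCount_cross_le k l hk
  refine ⟨n₀, fun n hn X₁ X K R R' hX₁ hX hK hKX hR hR' hRR t => ?_⟩
  obtain ⟨σ, hσX, -⟩ := exists_perm_image_eq (A := X₁) (A' := X) (B := ∅) (B' := ∅)
    (C := ∅) (C' := ∅) (by omega) rfl rfl
    (disjoint_empty_right _) (disjoint_empty_right _) (disjoint_empty_right _)
    (disjoint_empty_right _) (disjoint_empty_right _) (disjoint_empty_right _)
  have hu : permFamily σ (touching k X₁ ∪ R) = touching k X ∪ permFamily σ R := by
    rw [permFamily, image_union, ← permFamily, ← permFamily, permFamily_touching hσX]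
  rw [← intersectingCount_permFamily σ, hu]
  refine intersectingCount_union_le_union ?_ (by rw [card_permFamily, hRR]) ?_ ?_ t
  · rw [disjoint_left]
    exact fun A hA hA' => (mem_touching.1 hA).2 (hR' A hA').2.1
  · intro A hA B hB
    obtain ⟨x, hx⟩ : K.Nonempty := card_pos.1 (by omega)
    exact not_disjoint_iff.2 ⟨x, (hR' A hA).2.2 hx, (hR' B hB).2.2 hx⟩
  · intro T hT T' hT' hTT u
    refine hn₀ n hn X K T T' hX hK hKX (fun A hA => ?_) (fun A hA => hR' A (hT' hA)) hTT u
    obtain ⟨A, hA', rfl⟩ := mem_image.1 (hT hA)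
    obtain ⟨h1, h2⟩ := hR A hA'
    refine ⟨by rw [card_image_of_injective _ σ.injective, h1], ?_⟩
    rw [← hσX]
    exact disjoint_image_perm.2 h2

/-! ### Exchanging outside members for missing ones; conclusion for uniformity at least three. -/

/-- The `t`-subfamilies of `T` not contained in `F₁` are intersecting subfamilies of `F₂` that `F₁`
lacks. The statement is additive to avoid truncated subtraction. -/
theorem intersectingCount_add_choose_le {F₁ F₂ T : Finset (Finset (Fin n))} (h : F₁ ⊆ F₂)
    (hT : T ⊆ F₂) (hi : (T : Set (Finset (Fin n))).Intersecting) (t : ℕ) :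
    intersectingCount F₁ t + T.card.choose t ≤
      intersectingCount F₂ t + (T ∩ F₁).card.choose t := by
  rw [← card_powersetCard t T, ← card_powersetCard t (T ∩ F₁), ← card_intersectingSubfamilies,
    ← card_intersectingSubfamilies, ← card_union_add_card_inter]
  refine Nat.add_le_add (card_le_card (union_subset (intersectingSubfamilies_mono h t)
    fun G hG => ?_)) (card_le_card fun G hG => ?_)
  · obtain ⟨h1, h2⟩ := mem_powersetCard.1 hG
    exact mem_intersectingSubfamilies.2 ⟨⟨h1.trans hT, h2⟩,
      fun A hA B hB => hi (h1 hA) (h1 hB)⟩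
  · obtain ⟨h1, h2⟩ := mem_inter.1 hG
    obtain ⟨h3, h4⟩ := mem_powersetCard.1 h2
    exact mem_powersetCard.2 ⟨subset_inter h3 (mem_intersectingSubfamilies.1 h1).1.1, h4⟩

theorem card_touching_le {k : ℕ} (hk : 1 ≤ k) (X : Finset (Fin n)) :
    (touching k X).card ≤ X.card * (n - 1).choose (k - 1) := by
  have : touching k X ⊆ X.biUnion fun x => (powersetCard k univ).filter (x ∈ ·) := by
    intro A hA
    obtain ⟨h1, h2⟩ := mem_touching.1 hA
    obtain ⟨x, hxA, hxX⟩ := not_disjoint_iff.1 h2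
    exact mem_biUnion.2 ⟨x, hxX, by simp [mem_powersetCard, h1, hxA]⟩
  refine (card_le_card this).trans (card_biUnion_le_card_mul _ _ _ fun x _ => ?_)
  rw [card_filter_mem hk]

theorem card_touching_filter_mem_le {k : ℕ} (hk : 2 ≤ k) {X : Finset (Fin n)} {a : Fin n}
    (ha : a ∉ X) :
    ((touching k X).filter (a ∈ ·)).card ≤ X.card * (n - 2).choose (k - 2) := by
  have : (touching k X).filter (a ∈ ·) ⊆
      X.biUnion fun x => (powersetCard k univ).filter fun A => x ∈ A ∧ a ∈ A := by
    intro A hA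
    obtain ⟨hA, haA⟩ := mem_filter.1 hA
    obtain ⟨h1, h2⟩ := mem_touching.1 hA
    obtain ⟨x, hxA, hxX⟩ := not_disjoint_iff.1 h2
    exact mem_biUnion.2 ⟨x, hxX, by simp [mem_powersetCard, h1, hxA, haA]⟩
  refine (card_le_card this).trans (card_biUnion_le_card_mul _ _ _ fun x hx => ?_)
  rw [card_filter_mem_mem hk (ne_of_mem_of_not_mem hx ha)]

/-- From C(E,t-1) ≤ E·C(E,t-2) and C(E,t-2)·C(D-E,2) ≤ C(D,t) it is enough that l·D·E ≤ C(D-E,2).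
This says that a set meeting at most E others is worth less than a 1/(lD) share of a full star. -/
theorem mul_mul_choose_pred_le {l D E t : ℕ} (hE : 1 ≤ E) (h : 8 * (l + 1) * E ≤ D) (ht : 2 ≤ t) :
    l * D * E.choose (t - 1) ≤ D.choose t := by
  obtain ⟨t, rfl⟩ : ∃ s, t = s + 2 := ⟨t - 2, by omega⟩
  have h1 : E.choose (t + 1) ≤ E * E.choose t := by
    have := Nat.choose_succ_right_eq E t
    calc E.choose (t + 1) ≤ E.choose (t + 1) * (t + 1) := Nat.le_mul_of_pos_right _ (by omega)
      _ = E.choose t * (E - t) := this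
      _ ≤ E.choose t * E := Nat.mul_le_mul_left _ (Nat.sub_le _ _)
      _ = _ := mul_comm _ _
  have hle : 8 * E ≤ D := by nlinarith
  obtain ⟨a, rfl⟩ : ∃ a, D = E + (a + 1) := ⟨D - E - 1, by omega⟩
  have h2 := choose_mul_choose_le_choose_add E (a + 1) t 2
  have h3 : l * (E + (a + 1)) * E ≤ (a + 1).choose 2 := by
    have h4 : (a + 1).choose 2 * 2 = (a + 1) * a := by
      have := Nat.add_one_mul_choose_eq a 1
      rw [Nat.choose_one_right] at this
      exact this.symm
    have h5 : 8 * (l * E) ≤ E + (a + 1) := by nlinarith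
    have h6 : 7 * E ≤ a + 1 := by omega
    have h8 : 8 * (l * (E + (a + 1)) * E) ≤ (E + (a + 1)) * (E + (a + 1)) := by nlinarith
    have h7 : 6 ≤ a := by omega
    nlinarith
  show l * (E + (a + 1)) * E.choose (t + 1) ≤ _
  calc _ ≤ l * (E + (a + 1)) * (E * E.choose t) := Nat.mul_le_mul_left _ h1
    _ = E.choose t * (l * (E + (a + 1)) * E) := by ring
    _ ≤ E.choose t * (a + 1).choose 2 := Nat.mul_le_mul_left _ h3
    _ ≤ _ := h2

/-- Trading missing members of `touching k X` for members off `X` loses intersecting families. -/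
theorem intersectingCount_le_touching_union {k l E r : ℕ} (hk : 2 ≤ k) {X : Finset (Fin n)}
    (hX : X.card = l) {F : Finset (Finset (Fin n))} (hF : (F : Set (Finset (Fin n))).Sized k)
    (hcard : F.card = (touching k X).card + r) (hE : 1 ≤ E)
    (hED : 8 * (l + 1) * E ≤ (n - 1).choose (k - 1))
    (hdeg : ∀ a ∉ X, k * deg F a ≤ E) {t : ℕ} (ht : 2 ≤ t) :
    ∃ R : Finset (Finset (Fin n)), R.card = r ∧ (∀ A ∈ R, A.card = k ∧ Disjoint A X) ∧
      intersectingCount F t ≤ intersectingCount (touching k X ∪ R) t := by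
  set S := touching k X with hS
  set D := (n - 1).choose (k - 1) with hD
  have hRX : ∀ A ∈ F \ S, A.card = k ∧ Disjoint A X := by
    intro A hA
    obtain ⟨h1, h2⟩ := mem_sdiff.1 hA
    have h3 := hF h1
    exact ⟨h3, by_contra fun h => h2 (mem_touching.2 ⟨h3, h⟩)⟩
  have hRc : (F \ S).card = r + (S \ F).card := by
    have h1 := card_sdiff_add_card_inter F S
    have h2 := card_sdiff_add_card_inter S F
    rw [inter_comm] at h2
    omega
  obtain ⟨R₁, hR₁, hR₁c⟩ := exists_subset_card_eq (show r ≤ (F \ S).card by omega)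
  refine ⟨R₁, hR₁c, fun A hA => hRX A (hR₁ hA), ?_⟩
  set q := (S \ F).card with hq
  have hR₂c : ((F \ S) \ R₁).card = q := by
    rw [card_sdiff_of_subset hR₁]; omega
  rcases Nat.eq_zero_or_pos q with hq0 | hq0
  · have : (F \ S) = R₁ := by
      refine (eq_of_subset_of_card_le hR₁ (by omega)).symm
    refine intersectingCount_mono (fun A hA => ?_) t
    rw [← this, mem_union, mem_sdiff]
    tauto
  have hcov : F ⊆ ((S ∩ F) ∪ R₁) ∪ ((F \ S) \ R₁) := by
    intro A hA
    simp only [mem_union, mem_inter, mem_sdiff]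
    tauto
  have hup : intersectingCount F t ≤ intersectingCount ((S ∩ F) ∪ R₁) t + q * E.choose (t - 1) := by
    refine (intersectingCount_le_add_sum hcov t).trans (Nat.add_le_add_left ?_ _)
    rw [← hR₂c]
    refine sum_le_card_nsmul _ _ _ fun A hA => ?_
    refine (card_intersectingSubfamilies_mem_le F t A).trans
      ((intersectingCount_le_choose _ _).trans (Nat.choose_le_choose _ ?_))
    obtain ⟨hAk, hAX⟩ := hRX A (mem_sdiff.1 hA).1
    refine (card_erase_le).trans ?_
    have hsub : F.filter (fun B => ¬ Disjoint B A) ⊆ A.biUnion fun a => F.filter (a ∈ ·) := by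
      intro B hB
      obtain ⟨h1, h2⟩ := mem_filter.1 hB
      obtain ⟨a, haB, haA⟩ := not_disjoint_iff.1 h2
      exact mem_biUnion.2 ⟨a, haA, mem_filter.2 ⟨h1, haB⟩⟩
    refine (card_le_card hsub).trans (card_biUnion_le.trans ?_)
    have : ∀ a ∈ A, k * (F.filter (a ∈ ·)).card ≤ E :=
      fun a ha => hdeg a (disjoint_left.1 hAX ha)
    have h2 : k * ∑ a ∈ A, (F.filter (a ∈ ·)).card ≤ k * E := by
      rw [mul_sum, ← hAk]
      rw [← hAk] at this
      exact sum_le_card_nsmul _ _ _ this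
    exact Nat.le_of_mul_le_mul_left h2 (by omega)
  -- Pigeonhole: some star loses at least q/l of the q missing sets, and restoring that star alone
  -- already pays for dropping q outside members.
  obtain ⟨i, hi, hmi⟩ : ∃ i ∈ X, q ≤ l * ((S \ F).filter (i ∈ ·)).card := by
    by_contra! hcon
    have hsub : S \ F ⊆ X.biUnion fun i => (S \ F).filter (i ∈ ·) := by
      intro A hA
      obtain ⟨x, hxA, hxX⟩ := not_disjoint_iff.1 (mem_touching.1 (mem_sdiff.1 hA).1).2
      exact mem_biUnion.2 ⟨x, hxX, mem_filter.2 ⟨hA, hxA⟩⟩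
    have h1 := (card_le_card hsub).trans card_biUnion_le
    have h2 : l * q ≤ ∑ i ∈ X, l * ((S \ F).filter (i ∈ ·)).card := by
      rw [← mul_sum]; exact Nat.mul_le_mul_left _ h1
    have h0 : X.Nonempty := by
      obtain ⟨A, hA⟩ := card_pos.1 hq0
      obtain ⟨x, -, hxX⟩ := not_disjoint_iff.1 (mem_touching.1 (mem_sdiff.1 hA).1).2
      exact ⟨x, hxX⟩
    have h3 := sum_lt_sum_of_nonempty h0 hcon
    rw [sum_const, hX, smul_eq_mul] at h3
    omega
  have hTS : S.filter (i ∈ ·) ⊆ S ∪ R₁ := (filter_subset _ _).trans subset_union_left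
  have hlow := intersectingCount_add_choose_le (F₁ := (S ∩ F) ∪ R₁) (F₂ := S ∪ R₁)
    (union_subset_union_left inter_subset_left) hTS
    (intersecting_of_mem fun A hA => (mem_filter.1 hA).2) t
  have hTc : (S.filter (i ∈ ·)).card = D := deg_touching (by omega) hi
  rw [hTc] at hlow
  clear_value D
  have hTi : (S.filter (i ∈ ·) ∩ ((S ∩ F) ∪ R₁)).card + ((S \ F).filter (i ∈ ·)).card = D := by
    rw [← hTc, ← card_union_of_disjoint]
    · congr 1
      ext A
      simp only [mem_union, mem_inter, mem_filter, mem_sdiff]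
      constructor
      · rintro (h | h)
        · exact h.1
        · exact ⟨h.1.1, h.2⟩
      · rintro ⟨h1, h2⟩
        by_cases hAF : A ∈ F
        · exact Or.inl ⟨⟨h1, h2⟩, Or.inl ⟨h1, hAF⟩⟩
        · exact Or.inr ⟨⟨h1, hAF⟩, h2⟩
    · rw [disjoint_left]
      intro A hA hA'
      simp only [mem_union, mem_inter, mem_filter, mem_sdiff] at hA hA'
      rcases hA.2 with h | h
      · exact hA'.1.2 h.2
      · exact hA'.1.2 (mem_sdiff.1 (hR₁ h)).1
  set d := (S.filter (i ∈ ·) ∩ ((S ∩ F) ∪ R₁)).card with hd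
  set m := ((S \ F).filter (i ∈ ·)).card with hm
  have h1 := mul_choose_le_mul_choose (show d ≤ D by omega) (show 1 ≤ t by omega)
  have h2 := mul_mul_choose_pred_le hE hED ht
  have hl : 1 ≤ l := by rw [← hX]; exact card_pos.2 ⟨i, hi⟩
  have hDpos : 1 ≤ D := by nlinarith
  -- With m ≥ q/l sets restored, the gain is at least (m/D)·C(D,t) ≥ (q/(lD))·C(D,t), which is at
  -- least the loss q·C(E,t-1).
  have h3 : q * E.choose (t - 1) + d.choose t ≤ D.choose t := by
    refine Nat.le_of_mul_le_mul_left (c := l * D) ?_ (by positivity)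
    calc l * D * (q * E.choose (t - 1) + d.choose t)
        = q * (l * D * E.choose (t - 1)) + l * (D * d.choose t) := by ring
      _ ≤ q * D.choose t + l * (d * D.choose t) := by gcongr
      _ ≤ l * m * D.choose t + l * (d * D.choose t) := by gcongr
      _ = l * (d + m) * D.choose t := by ring
      _ = l * D * D.choose t := by rw [hTi]
  omega

/-- The case of uniformity at least three. -/
theorem intersectingCount_le_of_three_le (k l : ℕ) (hk : 3 ≤ k) :
    ∃ n₀ : ℕ, ∀ n, n₀ ≤ n → ∀ (F : Finset (Finset (Fin n))) (X K : Finset (Fin n))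
      (R : Finset (Finset (Fin n))), (F : Set (Finset (Fin n))).Sized k → X.card = l →
      K.card + 1 = k → Disjoint K X → (∀ A ∈ R, A.card = k ∧ Disjoint A X ∧ K ⊆ A) →
      F.card = (touching k X).card + R.card → R.card ≤ n → ∀ t, 2 ≤ t →
      intersectingCount F t ≤ intersectingCount (touching k X ∪ R) t := by
  obtain ⟨C, n₁, hn₁⟩ := exists_star_cover k l hk
  obtain ⟨n₂, hn₂⟩ := intersectingCount_touching_union_le k l (by omega)
  refine ⟨n₁ + n₂ + (8 * (l + 1) * (k * (3 + C + l)) + 1) * k + 1,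
    fun n hn F X₀ K R hF hX₀ hK hKX hR hcard hRn t ht => ?_⟩
  have hkb : k ≤ (8 * (l + 1) * (k * (3 + C + l)) + 1) * k := Nat.le_mul_of_pos_left _ (by omega)
  have hnn₁ : n₁ ≤ n := by omega
  have hnn₂ : n₂ ≤ n := by omega
  by_contra! hcon
  obtain ⟨X, hX, hsum⟩ := hn₁ n hnn₁ F hF (by
      have := card_touching_le (show 1 ≤ k by omega) X₀
      rw [hX₀] at this
      omega) t ht X₀ hX₀
    ((intersectingCount_mono subset_union_left t).trans_lt hcon)
  have hcc : (touching k X).card = (touching k X₀).card := by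
    have h1 := card_touching_add k X
    have h2 := card_touching_add k X₀
    rw [hX] at h1
    rw [hX₀] at h2
    omega
  set E1 := (n - 2).choose (k - 2) with hE1
  have hn1 : n - 2 ≤ E1 := le_choose (by omega) (by omega)
  have hn3 : 3 ≤ n := by omega
  have hmiss : (touching k X \ F).card ≤ C * E1 := by
    have hsub : touching k X \ F ⊆ X.biUnion fun i => (touching k X \ F).filter (i ∈ ·) := by
      intro A hA
      obtain ⟨x, hxA, hxX⟩ := not_disjoint_iff.1 (mem_touching.1 (mem_sdiff.1 hA).1).2
      exact mem_biUnion.2 ⟨x, hxX, mem_filter.2 ⟨hA, hxA⟩⟩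
    have h1 := (card_le_card hsub).trans card_biUnion_le
    have h2 : ∀ x ∈ X, ((touching k X \ F).filter (x ∈ ·)).card + deg F x ≤
        (n - 1).choose (k - 1) := by
      intro x hx
      rw [deg, ← card_union_of_disjoint, ← card_filter_mem (show 1 ≤ k by omega) x]
      · refine card_le_card fun A hA => ?_
        simp only [mem_union, mem_filter, mem_sdiff, mem_powersetCard_univ] at hA ⊢
        rcases hA with h | h
        · exact ⟨(mem_touching.1 h.1.1).1, h.2⟩
        · exact ⟨hF h.1, h.2⟩
      · rw [disjoint_left]
        intro A hA hA'
        exact (mem_sdiff.1 (mem_filter.1 hA).1).2 (mem_filter.1 hA').1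
    have h3 := sum_le_card_nsmul X _ _ h2
    rw [sum_add_distrib, smul_eq_mul, hX] at h3
    omega
  have hout : (F \ touching k X).card ≤ n + C * E1 := by
    have h1 := card_sdiff_add_card_inter F (touching k X)
    have h2 := card_sdiff_add_card_inter (touching k X) F
    rw [inter_comm] at h2
    omega
  -- A point off `X` has degree at most l·E1 from sets meeting `X` and n + C·E1 from the others,
  -- with n ≤ 3·E1. The factor `k` passes from degrees of points to the number of members meeting a
  -- `k`-set.
  have hmain := intersectingCount_le_touching_union (E := k * (3 + C + l) * E1) (r := R.card)
    (by omega) hX hF (by omega) (Nat.mul_pos (Nat.mul_pos (by omega) (by omega)) (by omega)) ?_ ?_ ht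
  · obtain ⟨R', hR'c, hR', hle⟩ := hmain
    have := hn₂ n hnn₂ X X₀ K R' R hX hX₀ hK hKX hR' hR hR'c t
    omega
  · calc _ = 8 * (l + 1) * (k * (3 + C + l)) * (n - 1 - 1).choose (k - 1 - 1) := by
          rw [hE1]; simp only [Nat.sub_sub]; ring
      _ ≤ _ := by
        refine mul_choose_pred_le (by omega) ?_ (by omega)
        calc _ ≤ 8 * (l + 1) * (k * (3 + C + l)) * k := by gcongr; omega
          _ ≤ _ := by
            rw [add_mul] at hn
            omega
  · intro a ha
    have h1 : deg F a ≤ ((touching k X).filter (a ∈ ·)).card + (F \ touching k X).card := by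
      rw [deg]
      refine (card_le_card fun A hA => ?_).trans (card_union_le _ _)
      simp only [mem_union, mem_filter, mem_sdiff] at hA ⊢
      tauto
    have h2 := card_touching_filter_mem_le (show 2 ≤ k by omega) ha
    rw [hX, ← hE1] at h2
    have h3 : deg F a ≤ (3 + C + l) * E1 := by
      have : n ≤ 3 * E1 := by omega
      calc _ ≤ l * E1 + (3 * E1 + C * E1) := by omega
        _ = _ := by ring
    rw [mul_assoc]
    exact Nat.mul_le_mul_left _ h3

/-! ### Graphs: stars, triangles, and the effect of adding an edge. -/

/-- The triples all of whose pairs belong to `F`. -/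
def triangles (F : Finset (Finset (Fin n))) : Finset (Finset (Fin n)) :=
  (powersetCard 3 univ).filter fun T => powersetCard 2 T ⊆ F

theorem mem_triangles {F : Finset (Finset (Fin n))} {T : Finset (Fin n)} :
    T ∈ triangles F ↔ T.card = 3 ∧ powersetCard 2 T ⊆ F := by
  simp [triangles, mem_powersetCard]

theorem eq_pair_of_mem {A : Finset (Fin n)} (hA : A.card = 2) {x y : Fin n} (hx : x ∈ A)
    (hy : y ∈ A) (hxy : x ≠ y) : A = {x, y} :=
  (eq_of_subset_of_card_le (by simp [insert_subset_iff, hx, hy]) (by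
    rw [hA, card_pair hxy])).symm

theorem exists_eq_pair {A : Finset (Fin n)} (hA : A.card = 2) {x : Fin n} (hx : x ∈ A) :
    ∃ y, x ≠ y ∧ A = {x, y} := by
  obtain ⟨y, hy, hyx⟩ := exists_mem_ne (by omega : 1 < A.card) x
  exact ⟨y, hyx.symm, eq_pair_of_mem hA hx hy hyx.symm⟩

/-- Two edges xy and xz meet at x, and an edge missing x must be yz. An edge meeting all three sides
of this triangle has both ends among its vertices. -/
theorem exists_eq_powersetCard_two {G : Finset (Finset (Fin n))}
    (hG : (G : Set (Finset (Fin n))).Sized 2) (hi : (G : Set (Finset (Fin n))).Intersecting)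
    (hc : 2 ≤ G.card) (h : ∀ x, ∃ A ∈ G, x ∉ A) :
    ∃ T : Finset (Fin n), T.card = 3 ∧ powersetCard 2 T = G := by
  obtain ⟨A, hA, B, hB, hAB⟩ := one_lt_card.1 hc
  obtain ⟨x, hxA, hxB⟩ := not_disjoint_iff.1 (hi hA hB)
  obtain ⟨y, hxy, rfl⟩ := exists_eq_pair (hG hA) hxA
  obtain ⟨z, hxz, rfl⟩ := exists_eq_pair (hG hB) hxB
  have hyz : y ≠ z := by rintro rfl; exact hAB rfl
  obtain ⟨C, hC, hxC⟩ := h x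
  have hyC : y ∈ C := by
    obtain ⟨w, hw, hw'⟩ := not_disjoint_iff.1 (hi hA hC)
    rcases mem_insert.1 hw with rfl | hw
    · exact absurd hw' hxC
    · rwa [mem_singleton.1 hw] at hw'
  have hzC : z ∈ C := by
    obtain ⟨w, hw, hw'⟩ := not_disjoint_iff.1 (hi hB hC)
    rcases mem_insert.1 hw with rfl | hw
    · exact absurd hw' hxC
    · rwa [mem_singleton.1 hw] at hw'
  obtain rfl := eq_pair_of_mem (hG hC) hyC hzC hyz
  have hT : ({x, y, z} : Finset (Fin n)).card = 3 := card_eq_three.2 ⟨x, y, z, hxy, hxz, hyz, rfl⟩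
  refine ⟨{x, y, z}, hT, (eq_of_subset_of_card_le (fun E hE => ?_) ?_).symm⟩
  · refine mem_powersetCard.2 ⟨?_, hG hE⟩
    have key : ∀ u v, u ∈ ({x, y, z} : Finset (Fin n)) → v ∈ ({x, y, z} : Finset (Fin n)) →
        u ≠ v → u ∈ E → v ∈ E → E ⊆ {x, y, z} := by
      intro u v hu hv huv huE hvE
      rw [eq_pair_of_mem (hG hE) huE hvE huv]
      exact insert_subset hu (singleton_subset_iff.2 hv)
    obtain ⟨a, ha, haE⟩ := not_disjoint_iff.1 (hi hA hE)
    obtain ⟨b, hb, hbE⟩ := not_disjoint_iff.1 (hi hB hE)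
    obtain ⟨c, hc, hcE⟩ := not_disjoint_iff.1 (hi hC hE)
    simp only [mem_insert, mem_singleton] at ha hb hc
    have hx : x ∈ ({x, y, z} : Finset (Fin n)) := by simp
    have hy : y ∈ ({x, y, z} : Finset (Fin n)) := by simp
    have hz : z ∈ ({x, y, z} : Finset (Fin n)) := by simp
    rcases ha with rfl | rfl
    · rcases hc with rfl | rfl
      · exact key _ _ hx hy hxy haE hcE
      · exact key _ _ hx hz hxz haE hcE
    · rcases hb with rfl | rfl
      · exact key _ _ hx hy hxy hbE haE
      · exact key _ _ hy hz hyz haE hbE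
  · rw [card_powersetCard, hT]
    have h3 : ({{x, y}, {x, z}, {y, z}} : Finset (Finset (Fin n))).card = 3 := by
      refine card_eq_three.2 ⟨_, _, _, hAB, ?_, ?_, rfl⟩
      · exact fun h => hxC (h ▸ mem_insert_self x _)
      · exact fun h => hxC (h ▸ mem_insert_self x _)
    show Nat.choose 3 2 ≤ _
    have : Nat.choose 3 2 = 3 := rfl
    rw [this, ← h3]
    exact card_le_card (by simp [insert_subset_iff, hA, hB, hC])

theorem card_union_of_subset_triple {T A B : Finset (Fin n)} (hT : T.card = 3) (hA : A ⊆ T)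
    (hB : B ⊆ T) (hAc : A.card = 2) (hBc : B.card = 2) : ¬ Disjoint A B := by
  intro h
  have := card_le_card (union_subset hA hB)
  rw [card_union_of_disjoint h] at this
  omega

/-- The number of intersecting subfamilies of a graph. -/
theorem intersectingCount_eq_of_sized_two {F : Finset (Finset (Fin n))}
    (hF : (F : Set (Finset (Fin n))).Sized 2) {t : ℕ} (ht : 2 ≤ t) :
    intersectingCount F t =
      ∑ x, (deg F x).choose t + if t = 3 then (triangles F).card else 0 := by
  have hstar : (univ.biUnion fun x => powersetCard t (F.filter (x ∈ ·))).card =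
      ∑ x, (deg F x).choose t := by
    rw [card_biUnion]
    · simp only [card_powersetCard, deg]
    -- As `t ≥ 2`, a star determines its centre: two distinct edges cannot share two vertices.
    · intro x _ y _ hxy
      refine disjoint_left.2 fun G hG hG' => ?_
      obtain ⟨h1, h2⟩ := mem_powersetCard.1 hG
      obtain ⟨h3, -⟩ := mem_powersetCard.1 hG'
      obtain ⟨A, hA, B, hB, hAB⟩ := one_lt_card.1 (show 1 < G.card by omega)
      refine hAB ?_
      have h4 := mem_filter.1 (h1 hA)
      have h5 := mem_filter.1 (h1 hB)
      rw [eq_pair_of_mem (hF h4.1) h4.2 (mem_filter.1 (h3 hA)).2 hxy,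
        eq_pair_of_mem (hF h5.1) h5.2 (mem_filter.1 (h3 hB)).2 hxy]
  rw [← hstar, ← card_intersectingSubfamilies]
  have hsub : (univ.biUnion fun x => powersetCard t (F.filter (x ∈ ·))) ⊆
      intersectingSubfamilies F t := by
    intro G hG
    obtain ⟨x, -, hG⟩ := mem_biUnion.1 hG
    obtain ⟨h1, h2⟩ := mem_powersetCard.1 hG
    exact mem_intersectingSubfamilies.2 ⟨⟨h1.trans (filter_subset _ _), h2⟩,
      intersecting_of_mem fun A hA => (mem_filter.1 (h1 hA)).2⟩
  rw [← card_sdiff_add_card_eq_card hsub, add_comm]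
  congr 1
  have hmem : ∀ G, G ∈ intersectingSubfamilies F t \
      (univ.biUnion fun x => powersetCard t (F.filter (x ∈ ·))) ↔
      t = 3 ∧ ∃ T ∈ triangles F, powersetCard 2 T = G := by
    intro G
    constructor
    · intro hG
      obtain ⟨h1, h2⟩ := mem_sdiff.1 hG
      obtain ⟨⟨h3, h4⟩, h5⟩ := mem_intersectingSubfamilies.1 h1
      obtain ⟨T, hT, rfl⟩ := exists_eq_powersetCard_two (fun A hA => hF (h3 hA)) h5 (by omega)
        (fun x => by
          by_contra! hcon
          exact h2 (mem_biUnion.2 ⟨x, mem_univ _, mem_powersetCard.2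
            ⟨fun A hA => mem_filter.2 ⟨h3 hA, hcon A hA⟩, h4⟩⟩))
      refine ⟨?_, T, mem_triangles.2 ⟨hT, h3⟩, rfl⟩
      rw [← h4, card_powersetCard, hT]; rfl
    · rintro ⟨rfl, T, hT, rfl⟩
      obtain ⟨hT, hTF⟩ := mem_triangles.1 hT
      refine mem_sdiff.2 ⟨mem_intersectingSubfamilies.2 ⟨⟨hTF, ?_⟩, ?_⟩, ?_⟩
      · rw [card_powersetCard, hT]; rfl
      · intro A hA B hB
        obtain ⟨h1, h2⟩ := mem_powersetCard.1 hA
        obtain ⟨h3, h4⟩ := mem_powersetCard.1 hB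
        exact card_union_of_subset_triple hT h1 h3 h2 h4
      · intro h
        obtain ⟨x, -, h⟩ := mem_biUnion.1 h
        obtain ⟨A, hA, hAc⟩ := exists_subset_card_eq (s := T.erase x) (n := 2)
          (by have := pred_card_le_card_erase (s := T) (a := x); omega)
        have := (mem_powersetCard.1 h).1 (mem_powersetCard.2 ⟨hA.trans (erase_subset _ _), hAc⟩)
        exact notMem_erase x T (hA (mem_filter.1 this).2)
  split_ifs with h3
  · rw [← card_image_of_injOn (s := triangles F) (f := fun T => powersetCard 2 T)]
    · congr 1
      ext G
      rw [hmem, mem_image]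
      exact ⟨fun h => h.2, fun h => ⟨h3, h⟩⟩
    · intro T hT T' hT' h
      have hsup : ∀ T ∈ triangles F, ∀ x, x ∈ T ↔ ∃ A ∈ powersetCard 2 T, x ∈ A := by
        intro T hT x
        refine ⟨fun hx => ?_, fun ⟨A, hA, hx⟩ => (mem_powersetCard.1 hA).1 hx⟩
        obtain ⟨y, hy, hyx⟩ := exists_mem_ne
          (by rw [(mem_triangles.1 hT).1]; omega : 1 < T.card) x
        exact ⟨{x, y}, mem_powersetCard.2 ⟨by simp [insert_subset_iff, hx, hy],
          card_pair hyx.symm⟩, by simp⟩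
      ext x
      have h : powersetCard 2 T = powersetCard 2 T' := h
      rw [hsup T hT, hsup T' hT', h]
  · rw [card_eq_zero, eq_empty_iff_forall_notMem]
    exact fun G hG => h3 ((hmem G).1 hG).1

theorem deg_insert {F : Finset (Finset (Fin n))} {A : Finset (Fin n)} (hA : A ∉ F) (x : Fin n) :
    deg (insert A F) x = deg F x + if x ∈ A then 1 else 0 := by
  rw [deg, filter_insert]
  split_ifs with h
  · rw [card_insert_of_notMem fun h => hA (mem_filter.1 h).1, deg]
  · rfl

theorem sum_deg_insert {F : Finset (Finset (Fin n))} {x z : Fin n} (hxz : x ≠ z)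
    (hA : {x, z} ∉ F) (f : ℕ → ℕ) :
    ∑ y, f (deg (insert {x, z} F) y) + f (deg F x) + f (deg F z) =
      ∑ y, f (deg F y) + f (deg F x + 1) + f (deg F z + 1) := by
  have h : ∀ g : Fin n → ℕ, ∑ y, g y = ∑ y ∈ univ \ {x, z}, g y + (g x + g z) := by
    intro g
    rw [← sum_pair hxz, sum_sdiff (subset_univ _)]
  rw [h fun y => f (deg (insert {x, z} F) y), h fun y => f (deg F y)]
  have h1 : ∀ y ∈ univ \ {x, z}, f (deg (insert {x, z} F) y) = f (deg F y) := by
    intro y hy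
    rw [deg_insert hA, if_neg (mem_sdiff.1 hy).2, add_zero]
  rw [sum_congr rfl h1, deg_insert hA, deg_insert hA, if_pos (by simp), if_pos (by simp)]
  ring

/-- A new triangle contains the new edge, and deleting `z` from it leaves an old edge at `x` that
determines it. By symmetry the number of new triangles is at most the smaller of the two degrees. -/
theorem card_triangles_insert_le {F : Finset (Finset (Fin n))} {x z : Fin n} (hxz : x ≠ z) :
    (triangles (insert {x, z} F)).card ≤ (triangles F).card + deg F x := by
  rw [← card_sdiff_add_card_inter _ (triangles F), add_comm]
  refine Nat.add_le_add (card_le_card inter_subset_right) ?_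
  have hmem : ∀ T ∈ triangles (insert {x, z} F) \ triangles F, T.card = 3 ∧ x ∈ T ∧ z ∈ T ∧
      ∀ A ∈ powersetCard 2 T, A ≠ {x, z} → A ∈ F := by
    intro T hT
    obtain ⟨h1, h2⟩ := mem_sdiff.1 hT
    obtain ⟨h3, h4⟩ := mem_triangles.1 h1
    have h5 : {x, z} ∈ powersetCard 2 T := by
      by_contra h
      refine h2 (mem_triangles.2 ⟨h3, fun A hA => ?_⟩)
      rcases mem_insert.1 (h4 hA) with rfl | h'
      · exact absurd hA h
      · exact h'
    have h6 := (mem_powersetCard.1 h5).1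
    exact ⟨h3, h6 (by simp), h6 (by simp), fun A hA hne =>
      (mem_insert.1 (h4 hA)).resolve_left hne⟩
  refine card_le_card_of_injOn (fun T => T.erase z) (fun T hT => ?_) ?_
  · obtain ⟨h3, hx, hz, h⟩ := hmem T hT
    refine mem_filter.2 ⟨h _ (mem_powersetCard.2 ⟨erase_subset _ _, ?_⟩) fun h => ?_,
      mem_erase.2 ⟨hxz, hx⟩⟩
    · rw [card_erase_of_mem hz, h3]
    · have h : T.erase z = {x, z} := h
      exact notMem_erase z T (by rw [h]; simp)
  · intro T hT T' hT' h
    have h : T.erase z = T'.erase z := h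
    rw [← insert_erase (hmem T hT).2.2.1, h, insert_erase (hmem T' hT').2.2.1]

theorem sized_insert {k : ℕ} {F : Finset (Finset (Fin n))} {A : Finset (Fin n)}
    (hF : (F : Set (Finset (Fin n))).Sized k) (hA : A.card = k) :
    ((insert A F : Finset (Finset (Fin n))) : Set (Finset (Fin n))).Sized k := by
  intro B hB
  rcases mem_insert.1 hB with rfl | h
  · exact hA
  · exact hF h

/-- Comparing the families obtained by adding two different edges to a graph. -/
theorem intersectingCount_insert_le_insert {F : Finset (Finset (Fin n))}
    (hF : (F : Set (Finset (Fin n))).Sized 2) {x z u v : Fin n} (hxz : x ≠ z) (huv : u ≠ v)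
    (hA : {x, z} ∉ F) (hB : {u, v} ∉ F) {t : ℕ} (ht : 2 ≤ t)
    (h : (deg F x).choose (t - 1) + (deg F z).choose (t - 1) +
        (if t = 3 then min (deg F x) (deg F z) else 0) ≤
      (deg F u).choose (t - 1) + (deg F v).choose (t - 1)) :
    intersectingCount (insert {x, z} F) t ≤ intersectingCount (insert {u, v} F) t := by
  rw [intersectingCount_eq_of_sized_two (sized_insert hF (card_pair hxz)) ht,
    intersectingCount_eq_of_sized_two (sized_insert hF (card_pair huv)) ht]
  have h1 := sum_deg_insert hxz hA fun d => d.choose t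
  have h2 := sum_deg_insert huv hB fun d => d.choose t
  obtain ⟨s, rfl⟩ : ∃ s, t = s + 1 := ⟨t - 1, by omega⟩
  simp only [Nat.choose_succ_succ', Nat.add_sub_cancel] at h1 h2 h ⊢
  have h3 : (triangles F).card ≤ (triangles (insert {u, v} F)).card := by
    refine card_le_card fun T hT => ?_
    obtain ⟨h1, h2⟩ := mem_triangles.1 hT
    exact mem_triangles.2 ⟨h1, h2.trans (subset_insert _ _)⟩
  have h4 := card_triangles_insert_le hxz (F := F)
  have h5 := card_triangles_insert_le hxz.symm (F := F)
  rw [pair_comm] at h5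
  split_ifs at h ⊢ <;> omega

theorem add_choose_two (a b : ℕ) : (a + b).choose 2 = a.choose 2 + b.choose 2 + a * b := by
  induction b with
  | zero => simp
  | succ b ih =>
    rw [← add_assoc, Nat.choose_succ_succ' (a + b) 1, Nat.choose_succ_succ' b 1, ih]
    simp only [Nat.choose_one_right, Nat.reduceAdd]
    ring

theorem choose_add_choose_le {s : ℕ} (hs : 1 ≤ s) (a b : ℕ) :
    a.choose s + b.choose s ≤ (a + b).choose s := by
  obtain ⟨s, rfl⟩ : ∃ r, s = r + 1 := ⟨s - 1, by omega⟩
  induction b with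
  | zero => simp
  | succ b ih =>
    rw [← add_assoc, Nat.choose_succ_succ' (a + b), Nat.choose_succ_succ' b]
    have := Nat.choose_le_choose s (show b ≤ a + b by omega)
    omega

/-- Superadditivity of C(·,t-1). When t = 3 the cross term ab in C(a+b,2) also pays for the
triangles through the removed edge. -/
theorem choose_add_min_le {a b d t : ℕ} (ht : 2 ≤ t) (h : a + b ≤ d) :
    a.choose (t - 1) + b.choose (t - 1) + (if t = 3 then min a b else 0) ≤ d.choose (t - 1) := by
  refine le_trans ?_ (Nat.choose_le_choose _ h)
  split_ifs with h3
  · subst h3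
    have := add_choose_two a b
    have h4 : min a b ≤ a * b := by
      rcases Nat.eq_zero_or_pos a with rfl | ha
      · simp
      · exact (min_le_right _ _).trans (Nat.le_mul_of_pos_left b ha)
    simp only [Nat.add_one_sub_one] at *
    omega
  · exact choose_add_choose_le (by omega) a b

/-- For t = 3 this is Pascal's rule: one more unit of degree pays for as many triangles as the
smaller degree allows. -/
theorem choose_add_le_of_lt {b d t : ℕ} (ht : 2 ≤ t) (h : b + 1 ≤ d) :
    b.choose (t - 1) + (if t = 3 then b else 0) ≤ d.choose (t - 1) := by
  refine le_trans ?_ (Nat.choose_le_choose _ h)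
  split_ifs with h3
  · subst h3
    have := add_choose_two b 1
    simp only [Nat.add_one_sub_one] at *
    omega
  · exact Nat.choose_le_choose _ (by omega)

/-! ### Graphs: stability under edge switching. -/

/-- No replacement of an edge that does not decrease the number of intersecting subfamilies
increases the sum of the squares of the degrees. -/
def IsStable (F : Finset (Finset (Fin n))) (t : ℕ) : Prop :=
  ∀ x z u v, x ≠ z → u ≠ v → {x, z} ∈ F → {u, v} ∉ F →
    intersectingCount F t ≤ intersectingCount (insert {u, v} (F.erase {x, z})) t →
    ∑ y, deg (insert {u, v} (F.erase {x, z})) y ^ 2 ≤ ∑ y, deg F y ^ 2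

/-- Take a graph with the largest sum of squared degrees among those with the same number of edges
and at least as large a count. -/
theorem exists_isStable {F : Finset (Finset (Fin n))} (hF : (F : Set (Finset (Fin n))).Sized 2)
    (t : ℕ) : ∃ F' : Finset (Finset (Fin n)), (F' : Set (Finset (Fin n))).Sized 2 ∧
      F'.card = F.card ∧ intersectingCount F t ≤ intersectingCount F' t ∧ IsStable F' t := by
  classical
  obtain ⟨F', hF', hmax⟩ := exists_max_image
    (univ.filter fun F' : Finset (Finset (Fin n)) => (F' : Set (Finset (Fin n))).Sized 2 ∧
      F'.card = F.card ∧ intersectingCount F t ≤ intersectingCount F' t)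
    (fun F' => ∑ y, deg F' y ^ 2) ⟨F, by simp [hF]⟩
  obtain ⟨h1, h2, h3⟩ := (mem_filter.1 hF').2
  refine ⟨F', h1, h2, h3, fun x z u v hxz huv hA hB hle => hmax _ (mem_filter.2
    ⟨mem_univ _, sized_insert (fun C hC => h1 (mem_of_mem_erase hC)) (card_pair huv), ?_,
      h3.trans hle⟩)⟩
  rw [card_insert_of_notMem fun h => hB (mem_of_mem_erase h), card_erase_of_mem hA, h2]
  have := card_pos.2 ⟨_, hA⟩
  omega

theorem deg_erase {F : Finset (Finset (Fin n))} {A : Finset (Fin n)} (hA : A ∈ F) (x : Fin n) :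
    deg F x = deg (F.erase A) x + if x ∈ A then 1 else 0 := by
  conv_lhs => rw [← insert_erase hA]
  exact deg_insert (notMem_erase A F) x

/-- Moving an edge from xz to uv changes the sum of squares by twice the change in the end-degree
sum, degrees being taken without the edge. The hypothesis `hle` ensures that the move does not lower
the count. -/
theorem IsStable.deg_add_deg_le {F : Finset (Finset (Fin n))} {t : ℕ} (h : IsStable F t)
    (hF : (F : Set (Finset (Fin n))).Sized 2) (ht : 2 ≤ t) {x z u v : Fin n} (hxz : x ≠ z)
    (huv : u ≠ v) (hA : {x, z} ∈ F) (hB : {u, v} ∉ F)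
    (hle : (deg (F.erase {x, z}) x).choose (t - 1) + (deg (F.erase {x, z}) z).choose (t - 1) +
        (if t = 3 then min (deg (F.erase {x, z}) x) (deg (F.erase {x, z}) z) else 0) ≤
      (deg (F.erase {x, z}) u).choose (t - 1) + (deg (F.erase {x, z}) v).choose (t - 1)) :
    deg (F.erase {x, z}) u + deg (F.erase {x, z}) v ≤
      deg (F.erase {x, z}) x + deg (F.erase {x, z}) z := by
  set F₀ := F.erase {x, z} with hF₀
  have hFi : insert {x, z} F₀ = F := insert_erase hA
  have hA₀ : {x, z} ∉ F₀ := notMem_erase _ _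
  have hB₀ : {u, v} ∉ F₀ := fun h => hB (mem_of_mem_erase h)
  have h1 := intersectingCount_insert_le_insert (fun C hC => hF (mem_of_mem_erase hC)) hxz huv
    hA₀ hB₀ ht hle
  rw [hFi] at h1
  have h2 := h x z u v hxz huv hA hB h1
  have h3 := sum_deg_insert hxz hA₀ fun d => d ^ 2
  have h4 := sum_deg_insert huv hB₀ fun d => d ^ 2
  rw [hFi] at h3
  simp only [add_sq, mul_one, one_pow] at h3 h4
  rw [← hF₀] at h2
  omega

/-- Otherwise the edge xz could be moved to xv, towards a vertex at least as rich, raising the sum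
of squares without lowering the count. Thus each vertex prefers neighbours of larger degree. -/
theorem IsStable.deg_lt_deg {F : Finset (Finset (Fin n))} {t : ℕ} (h : IsStable F t)
    (hF : (F : Set (Finset (Fin n))).Sized 2) (ht : 2 ≤ t) {x z v : Fin n} (hxz : x ≠ z)
    (hxv : x ≠ v) (hA : {x, z} ∈ F) (hB : {x, v} ∉ F) : deg F v < deg F z := by
  by_contra! hcon
  have hvz : v ≠ z := by rintro rfl; exact hB hA
  have hz := deg_erase hA z
  have hv := deg_erase hA v
  rw [if_pos (by simp)] at hz
  rw [if_neg (by simp [hvz, hxv.symm])] at hv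
  have := choose_add_le_of_lt (b := deg (F.erase {x, z}) z) (d := deg (F.erase {x, z}) v) ht
    (by omega)
  have := h.deg_add_deg_le hF ht hxz hxv hA hB (by split_ifs at this ⊢ <;> omega)
  omega

/-- Otherwise v alone outweighs both ends of xz, and by `choose_add_min_le` the edge could
profitably be moved to uv. -/
theorem IsStable.deg_add_two_le {F : Finset (Finset (Fin n))} {t : ℕ} (h : IsStable F t)
    (hF : (F : Set (Finset (Fin n))).Sized 2) (ht : 2 ≤ t) {x z u v : Fin n} (hxz : x ≠ z)
    (huv : u ≠ v) (hA : {x, z} ∈ F) (hB : {u, v} ∉ F) (hux : u ≠ x) (huz : u ≠ z) (hvx : v ≠ x)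
    (hvz : v ≠ z) : deg F v + 2 ≤ deg F x + deg F z := by
  by_contra! hcon
  have hx := deg_erase hA x
  have hz := deg_erase hA z
  have hu := deg_erase hA u
  have hv := deg_erase hA v
  rw [if_pos (by simp)] at hx hz
  rw [if_neg (by simp [hvz, hvx])] at hv
  rw [if_neg (by simp [huz, hux])] at hu
  have := choose_add_min_le (a := deg (F.erase {x, z}) x) (b := deg (F.erase {x, z}) z)
    (d := deg (F.erase {x, z}) v) ht (by omega)
  have := h.deg_add_deg_le hF ht hxz huv hA hB (by omega)
  omega

/-! ### Graphs whose vertex cover is a clique: concentrating the missing edges. -/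

/-- The weight of a vertex of degree `a` lying outside a vertex cover which is a clique: the number
of stars and triangles of size `t` that it accounts for. -/
def outerWeight (t a : ℕ) : ℕ := a.choose t + if t = 3 then a.choose 2 else 0

/-- The increments of `outerWeight`. -/
def outerStep (t a : ℕ) : ℕ := a.choose (t - 1) + if t = 3 then a else 0

theorem outerWeight_succ {t : ℕ} (ht : 2 ≤ t) (a : ℕ) :
    outerWeight t (a + 1) = outerWeight t a + outerStep t a := by
  obtain ⟨t, rfl⟩ : ∃ s, t = s + 1 := ⟨t - 1, by omega⟩
  simp only [outerWeight, outerStep, Nat.choose_succ_succ', Nat.add_sub_cancel,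
    Nat.choose_one_right]
  split_ifs <;> simp <;> omega

theorem outerStep_add_le {t : ℕ} (ht : 2 ≤ t) (a m : ℕ) :
    outerStep t (a + m) ≤ outerStep t a + m * (a + m).choose (t - 2) := by
  obtain ⟨t, rfl⟩ : ∃ s, t = s + 2 := ⟨t - 2, by omega⟩
  induction m with
  | zero => simp
  | succ m ih =>
    have h1 : outerStep (t + 2) (a + m + 1) ≤
        outerStep (t + 2) (a + m) + (a + m + 1).choose t := by
      rcases eq_or_ne t 1 with rfl | h
      · have := Nat.choose_succ_succ' (a + m) 1
        norm_num [outerStep] at this ⊢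
        omega
      · have := Nat.choose_succ_succ' (a + m) t
        have h2 := Nat.choose_le_choose t (show a + m ≤ a + m + 1 by omega)
        have h3 : t + 2 - 1 = t + 1 := rfl
        simp only [outerStep, h3, if_neg (show ¬ t + 2 = 3 by omega)]
        omega
    have h2 := Nat.mul_le_mul_left m (Nat.choose_le_choose t (show a + m ≤ a + m + 1 by omega))
    simp only [Nat.add_sub_cancel] at ih ⊢
    rw [← add_assoc, add_mul, one_mul]
    omega

/-- A second-order expansion: losing m edges at one outer vertex saves, compared with losing them
one each at m vertices, at most C(m,2)·C(a+m-1,t-2). The statement is doubled to avoid halves. -/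
theorem outerWeight_add_le {t : ℕ} (ht : 2 ≤ t) (m a : ℕ) :
    2 * outerWeight t a + 2 * m * outerStep t (a + m - 1) + m * (a + m - 1).choose (t - 2) ≤
      2 * outerWeight t (a + m) + m ^ 2 * (a + m - 1).choose (t - 2) := by
  induction m generalizing a with
  | zero => simp
  | succ m ih =>
    have h := ih (a + 1)
    rw [show a + 1 + m - 1 = a + m by omega, show a + 1 + m = a + (m + 1) by omega,
      outerWeight_succ ht] at h
    rw [show a + (m + 1) - 1 = a + m by omega]
    have h2 := outerStep_add_le ht a m
    nlinarith

theorem choose_add_choose_add_le {t : ℕ} (ht : 2 ≤ t) (e a b : ℕ) :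
    (e + b).choose t + (e + a).choose t + a * b * e.choose (t - 2) ≤
      (e + a + b).choose t + e.choose t := by
  obtain ⟨t, rfl⟩ : ∃ s, t = s + 2 := ⟨t - 2, by omega⟩
  have h1 : ∀ a b, (e + a).choose (t + 1) + b * e.choose t ≤ (e + a + b).choose (t + 1) := by
    intro a b
    induction b with
    | zero => simp
    | succ b ih =>
      rw [← add_assoc, Nat.choose_succ_succ' (e + a + b) t, add_mul, one_mul]
      have := Nat.choose_le_choose t (show e ≤ e + a + b by omega)
      omega
  simp only [Nat.add_sub_cancel]
  induction a with
  | zero => simp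
  | succ a ih =>
    have h2 := h1 a b
    rw [← add_assoc, show e + a + 1 + b = (e + a + b) + 1 by omega,
      Nat.choose_succ_succ' (e + a) (t + 1), Nat.choose_succ_succ' (e + a + b) (t + 1)]
    rw [add_mul, add_mul, one_mul]
    show _ + (_ + (e + a).choose (t + 2)) + _ ≤ _ + (e + a + b).choose (t + 2) + _
    omega

/-- Convexity with a quantitative remainder: concentrating all deficits at one vertex gains at least
C(D-s,t-2) times the sum of the products m_i·m_j over pairs. The induction merges one vertex at a
time, by `choose_add_choose_add_le`. -/
theorem sum_choose_sub_le {ι : Type*} {t : ℕ} (ht : 2 ≤ t) (m : ι → ℕ)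
    {s D : ℕ} (hs : s ≤ D) (W : Finset ι) (hW : ∑ j ∈ W, m j ≤ s) :
    2 * ∑ j ∈ W, (D - m j).choose t + (∑ j ∈ W, m j) ^ 2 * (D - s).choose (t - 2) +
        2 * D.choose t ≤
      2 * (W.card * D.choose t) + 2 * (D - ∑ j ∈ W, m j).choose t +
        (∑ j ∈ W, m j ^ 2) * (D - s).choose (t - 2) := by
  classical
  induction W using Finset.induction_on with
  | empty => simp
  | insert i W hi ih =>
    rw [sum_insert hi] at hW
    have h := ih (by omega)
    rw [sum_insert hi, sum_insert hi, sum_insert hi, card_insert_of_notMem hi]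
    set b := ∑ j ∈ W, m j with hb
    have h1 := choose_add_choose_add_le ht (D - (m i + b)) (m i) b
    rw [show D - (m i + b) + b = D - m i by omega, show D - (m i + b) + m i = D - b by omega,
      show D - b + b = D by omega] at h1
    have h2 := Nat.mul_le_mul_left (m i * b)
      (Nat.choose_le_choose (t - 2) (show D - s ≤ D - (m i + b) by omega))
    nlinarith

/-- The neighbours of `x` in the graph `F`. -/
def neighbors (F : Finset (Finset (Fin n))) (x : Fin n) : Finset (Fin n) :=
  univ.filter fun y => x ≠ y ∧ {x, y} ∈ F

theorem mem_neighbors {F : Finset (Finset (Fin n))} {x y : Fin n} :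
    y ∈ neighbors F x ↔ x ≠ y ∧ {x, y} ∈ F := by
  simp [neighbors]

theorem card_neighbors {F : Finset (Finset (Fin n))} (hF : (F : Set (Finset (Fin n))).Sized 2)
    (x : Fin n) : (neighbors F x).card = deg F x := by
  refine card_bij (fun y _ => {x, y}) (fun y hy => ?_) (fun y hy z hz h => ?_) (fun A hA => ?_)
  · exact mem_filter.2 ⟨(mem_neighbors.1 hy).2, by simp⟩
  · have : y ∈ ({x, z} : Finset (Fin n)) := h ▸ (by simp)
    rcases mem_insert.1 this with h' | h'
    · exact absurd h'.symm (mem_neighbors.1 hy).1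
    · exact mem_singleton.1 h'
  · obtain ⟨h1, h2⟩ := mem_filter.1 hA
    obtain ⟨y, hxy, rfl⟩ := exists_eq_pair (hF h1) h2
    exact ⟨y, mem_neighbors.2 ⟨hxy, h1⟩, rfl⟩

theorem deg_triangles {F : Finset (Finset (Fin n))} (hF : (F : Set (Finset (Fin n))).Sized 2)
    {Z : Finset (Fin n)} (hZ : powersetCard 2 Z ⊆ F) {x : Fin n} (hx : neighbors F x ⊆ Z) :
    deg (triangles F) x = (deg F x).choose 2 := by
  rw [← card_neighbors hF, ← card_powersetCard]
  have hxn : x ∉ neighbors F x := fun h => (mem_neighbors.1 h).1 rfl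
  refine (card_bij (fun U _ => insert x U) (fun U hU => ?_) (fun U hU V hV h => ?_)
    (fun T hT => ?_)).symm
  · obtain ⟨h1, h2⟩ := mem_powersetCard.1 hU
    refine mem_filter.2 ⟨mem_triangles.2 ⟨?_, fun A hA => ?_⟩, mem_insert_self x U⟩
    · rw [card_insert_of_notMem fun h => hxn (h1 h), h2]
    · obtain ⟨h3, h4⟩ := mem_powersetCard.1 hA
      by_cases hxA : x ∈ A
      · obtain ⟨y, hxy, rfl⟩ := exists_eq_pair h4 hxA
        have := (mem_insert.1 (h3 (by simp : y ∈ ({x, y} : Finset (Fin n))))).resolve_left hxy.symm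
        exact (mem_neighbors.1 (h1 this)).2
      · exact hZ (mem_powersetCard.2 ⟨((subset_insert_iff_of_notMem hxA).1 h3).trans
          (h1.trans hx), h4⟩)
  · have h1 : x ∉ U := fun h => hxn ((mem_powersetCard.1 hU).1 h)
    have h2 : x ∉ V := fun h => hxn ((mem_powersetCard.1 hV).1 h)
    have h : insert x U = insert x V := h
    rw [← erase_insert h1, h, erase_insert h2]
  · obtain ⟨h1, h2⟩ := mem_filter.1 hT
    obtain ⟨h3, h4⟩ := mem_triangles.1 h1
    refine ⟨T.erase x, mem_powersetCard.2 ⟨fun y hy => ?_, ?_⟩, insert_erase h2⟩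
    · obtain ⟨hyx, hyT⟩ := mem_erase.1 hy
      exact mem_neighbors.2 ⟨hyx.symm, h4 (mem_powersetCard.2
        ⟨by simp [insert_subset_iff, h2, hyT], card_pair hyx.symm⟩)⟩
    · rw [card_erase_of_mem h2, h3]

theorem neighbors_subset_of_touching {F : Finset (Finset (Fin n))} {Z : Finset (Fin n)}
    (h : F ⊆ touching 2 Z) {x : Fin n} (hx : x ∉ Z) : neighbors F x ⊆ Z := by
  intro y hy
  obtain ⟨w, hw, hwZ⟩ := not_disjoint_iff.1 (mem_touching.1 (h (mem_neighbors.1 hy).2)).2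
  rcases mem_insert.1 hw with rfl | hw
  · exact absurd hwZ hx
  · rwa [mem_singleton.1 hw] at hwZ

/-- Two vertices outside the cover are never adjacent, so a triangle lies inside `Z` or has exactly
one vertex outside; any two neighbours of an outside vertex lie in the clique and complete a
triangle. -/
theorem card_triangles_of_clique_cover {F : Finset (Finset (Fin n))}
    (hF : (F : Set (Finset (Fin n))).Sized 2)
    {Z : Finset (Fin n)} (hZ : powersetCard 2 Z ⊆ F) (hFZ : F ⊆ touching 2 Z) :
    (triangles F).card = Z.card.choose 3 + ∑ x ∈ Zᶜ, (deg F x).choose 2 := by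
  have h1 : ∑ x ∈ Zᶜ, (deg F x).choose 2 = ∑ T ∈ triangles F, (T ∩ Zᶜ).card := by
    rw [← sum_deg]
    exact sum_congr rfl fun x hx => (deg_triangles hF hZ
      (neighbors_subset_of_touching hFZ (mem_compl.1 hx))).symm
  have h2 : Z.card.choose 3 = ∑ T ∈ triangles F, if T ⊆ Z then 1 else 0 := by
    rw [← card_filter, ← card_powersetCard]
    congr 1
    ext T
    rw [mem_powersetCard, mem_filter, mem_triangles]
    exact ⟨fun h => ⟨⟨h.2, (powersetCard_mono h.1).trans hZ⟩, h.1⟩, fun h => ⟨h.2, h.1.1⟩⟩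
  rw [h1, h2, ← sum_add_distrib, card_eq_sum_ones]
  refine sum_congr rfl fun T hT => ?_
  split_ifs with h
  · have : T ∩ Zᶜ = ∅ := by
      rw [eq_empty_iff_forall_notMem]
      exact fun x hx => mem_compl.1 (mem_inter.1 hx).2 (h (mem_inter.1 hx).1)
    rw [this]; rfl
  · rw [zero_add, eq_comm]
    obtain ⟨x, hxT, hxZ⟩ := not_subset.1 h
    refine card_eq_one.2 ⟨x, ?_⟩
    ext y
    rw [mem_inter, mem_compl, mem_singleton]
    refine ⟨fun ⟨hyT, hyZ⟩ => ?_, by rintro rfl; exact ⟨hxT, hxZ⟩⟩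
    by_contra hyx
    refine hyZ (neighbors_subset_of_touching hFZ hxZ (mem_neighbors.2 ⟨Ne.symm hyx,
      (mem_triangles.1 hT).2 (mem_powersetCard.2 ⟨?_, card_pair (Ne.symm hyx)⟩)⟩))
    simp [insert_subset_iff, hxT, hyT]

theorem deg_touching_of_notMem {Z : Finset (Fin n)} {x : Fin n} (hx : x ∉ Z) :
    deg (touching 2 Z) x = Z.card := by
  rw [← card_neighbors fun A hA => (mem_touching.1 hA).1]
  congr 1
  refine (neighbors_subset_of_touching (subset_refl _) hx).antisymm fun y hy => ?_
  have hxy : x ≠ y := by rintro rfl; exact hx hy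
  exact mem_neighbors.2 ⟨hxy, mem_touching.2 ⟨card_pair hxy, not_disjoint_iff.2 ⟨y, by simp, hy⟩⟩⟩

theorem deg_add_deg_sdiff {F T : Finset (Finset (Fin n))} (h : F ⊆ T) (x : Fin n) :
    deg F x + deg (T \ F) x = deg T x := by
  rw [deg, deg, deg, ← card_union_of_disjoint, ← filter_union, union_sdiff_of_subset h]
  exact disjoint_filter_filter disjoint_sdiff

/-- Summing over edges A the degrees of the ends of A counts A twice and every other edge at most
once. Equality holds for stars, which is why a star of missing edges is extremal. -/
theorem sum_deg_sq_le {M : Finset (Finset (Fin n))} (hM : (M : Set (Finset (Fin n))).Sized 2) :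
    ∑ x, deg M x ^ 2 ≤ M.card ^ 2 + M.card := by
  have h1 : ∑ x, deg M x ^ 2 = ∑ A ∈ M, ∑ x ∈ A, deg M x := by
    have : ∀ x, deg M x ^ 2 = ∑ A ∈ M, if x ∈ A then deg M x else 0 := by
      intro x
      rw [← sum_filter, sum_const, smul_eq_mul, sq, deg]
    simp only [this]
    rw [sum_comm]
    exact sum_congr rfl fun A _ => by rw [sum_ite_mem, univ_inter]
  rw [h1]
  have h2 : ∀ A ∈ M, ∑ x ∈ A, deg M x ≤ M.card + 1 := by
    intro A hA
    rw [sum_deg, ← add_sum_erase _ _ hA, inter_self, hM hA]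
    have : ∑ B ∈ M.erase A, (B ∩ A).card ≤ (M.erase A).card * 1 := by
      refine sum_le_card_nsmul _ _ _ fun B hB => ?_
      obtain ⟨hBA, hB⟩ := mem_erase.1 hB
      by_contra! hcon
      refine hBA ?_
      have h3 : B ∩ A = B := eq_of_subset_of_card_le inter_subset_left (by rw [hM hB]; omega)
      exact eq_of_subset_of_card_le (h3 ▸ inter_subset_right) (by rw [hM hB, hM hA])
    rw [card_erase_of_mem hA] at this
    have := card_pos.2 ⟨A, hA⟩
    omega
  refine (sum_le_card_nsmul _ _ _ h2).trans (le_of_eq ?_)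
  rw [smul_eq_mul]; ring

theorem card_inter_of_mem_sdiff {F : Finset (Finset (Fin n))} {Z : Finset (Fin n)}
    (hZ : powersetCard 2 Z ⊆ F) {A : Finset (Fin n)} (hA : A ∈ touching 2 Z \ F) :
    (A ∩ Z).card = 1 ∧ (A ∩ Zᶜ).card = 1 := by
  obtain ⟨h1, h2⟩ := mem_sdiff.1 hA
  obtain ⟨h3, h4⟩ := mem_touching.1 h1
  have h5 : (A ∩ Z).card + (A ∩ Zᶜ).card = A.card := by
    rw [← card_union_of_disjoint, ← inter_union_distrib_left, union_compl, inter_univ]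
    exact disjoint_compl_right.mono inter_subset_right inter_subset_right
  have h6 : 0 < (A ∩ Z).card := card_pos.2 (not_disjoint_iff_nonempty_inter.1 h4)
  have h7 : (A ∩ Z).card ≠ 2 := by
    intro h
    refine h2 (hZ (mem_powersetCard.2 ⟨?_, h3⟩))
    rw [← eq_of_subset_of_card_le (inter_subset_left : A ∩ Z ⊆ A) (by omega)]
    exact inter_subset_right
  omega

theorem sum_deg_sdiff_of_clique {F : Finset (Finset (Fin n))} {Z : Finset (Fin n)}
    (hZ : powersetCard 2 Z ⊆ F) :
    ∑ x ∈ Z, deg (touching 2 Z \ F) x = (touching 2 Z \ F).card ∧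
      ∑ x ∈ Zᶜ, deg (touching 2 Z \ F) x = (touching 2 Z \ F).card := by
  rw [sum_deg, sum_deg, card_eq_sum_ones]
  exact ⟨sum_congr rfl fun A hA => (card_inter_of_mem_sdiff hZ hA).1,
    sum_congr rfl fun A hA => (card_inter_of_mem_sdiff hZ hA).2⟩

theorem intersectingCount_eq_of_clique_cover {F : Finset (Finset (Fin n))}
    (hF : (F : Set (Finset (Fin n))).Sized 2)
    {Z : Finset (Fin n)} (hZ : powersetCard 2 Z ⊆ F) (hFZ : F ⊆ touching 2 Z) {t : ℕ}
    (ht : 2 ≤ t) :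
    intersectingCount F t = ∑ x ∈ Z, (n - 1 - deg (touching 2 Z \ F) x).choose t +
      ∑ x ∈ Zᶜ, outerWeight t (Z.card - deg (touching 2 Z \ F) x) +
      if t = 3 then Z.card.choose 3 else 0 := by
  have h1 : ∀ x ∈ Z, deg F x = n - 1 - deg (touching 2 Z \ F) x := by
    intro x hx
    have := deg_add_deg_sdiff hFZ x
    rw [deg_touching (by omega) hx, Nat.choose_one_right] at this
    omega
  have h2 : ∀ x ∈ Zᶜ, deg F x = Z.card - deg (touching 2 Z \ F) x := by
    intro x hx
    have := deg_add_deg_sdiff hFZ x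
    rw [deg_touching_of_notMem (mem_compl.1 hx)] at this
    omega
  rw [intersectingCount_eq_of_sized_two hF ht, ← sum_add_sum_compl Z,
    card_triangles_of_clique_cover hF hZ hFZ]
  have e1 : ∀ r, ∑ x ∈ Z, (deg F x).choose r =
      ∑ x ∈ Z, (n - 1 - deg (touching 2 Z \ F) x).choose r :=
    fun r => sum_congr rfl fun x hx => by rw [h1 x hx]
  have e2 : ∀ r, ∑ x ∈ Zᶜ, (deg F x).choose r =
      ∑ x ∈ Zᶜ, (Z.card - deg (touching 2 Z \ F) x).choose r :=
    fun r => sum_congr rfl fun x hx => by rw [h2 x hx]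
  rw [e1, e2, e2]
  simp only [outerWeight, sum_add_distrib]
  split_ifs
  · omega
  · simp

/-- Among the graphs with a given number of edges and a given clique as a vertex cover, those in
which the missing edges form a star have the most intersecting subfamilies. -/
theorem intersectingCount_le_of_clique_cover {F L : Finset (Finset (Fin n))}
    (hF : (F : Set (Finset (Fin n))).Sized 2) (hL : (L : Set (Finset (Fin n))).Sized 2)
    {Z Y : Finset (Fin n)} (hZ : powersetCard 2 Z ⊆ F) (hFZ : F ⊆ touching 2 Z)
    (hY : powersetCard 2 Y ⊆ L) (hLY : L ⊆ touching 2 Y) (hZY : Z.card = Y.card)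
    (hcard : (touching 2 Z \ F).card = (touching 2 Y \ L).card)
    {w : Fin n} (hwY : w ∈ Y) (hw : ∀ A ∈ touching 2 Y \ L, w ∈ A)
    (hs : (touching 2 Z \ F).card + Z.card ≤ n) {t : ℕ} (ht : 2 ≤ t) :
    intersectingCount F t ≤ intersectingCount L t := by
  obtain ⟨l, hl⟩ : ∃ l, Z.card = l + 1 :=
    ⟨Z.card - 1, by have := card_pos.2 ⟨w, hwY⟩; omega⟩
  rw [intersectingCount_eq_of_clique_cover hF hZ hFZ ht,
    intersectingCount_eq_of_clique_cover hL hY hLY ht, ← hZY, hl]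
  refine Nat.add_le_add_right ?_ _
  obtain ⟨hsZ, hsZ'⟩ := sum_deg_sdiff_of_clique hZ
  obtain ⟨hsY, hsY'⟩ := sum_deg_sdiff_of_clique hY
  have hsq := sum_deg_sq_le (M := touching 2 Z \ F)
    fun A hA => (mem_touching.1 (mem_sdiff.1 hA).1).1
  rw [← sum_add_sum_compl Z] at hsq
  rw [← hcard] at hsY hsY'
  have hm : ∀ x ∈ Zᶜ, deg (touching 2 Z \ F) x ≤ l + 1 := by
    intro x hx
    have := deg_add_deg_sdiff hFZ x
    rw [deg_touching_of_notMem (mem_compl.1 hx)] at this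
    omega
  have hwdeg : deg (touching 2 Y \ L) w = (touching 2 Z \ F).card := by
    rw [hcard, deg, filter_true_of_mem hw]
  have hm' : ∀ x ∈ Yᶜ, deg (touching 2 Y \ L) x ≤ 1 := by
    intro x hx
    refine card_le_one.2 fun A hA B hB => ?_
    obtain ⟨h1, h2⟩ := mem_filter.1 hA
    obtain ⟨h3, h4⟩ := mem_filter.1 hB
    have hwx : w ≠ x := by rintro rfl; exact mem_compl.1 hx hwY
    rw [eq_pair_of_mem (mem_touching.1 (mem_sdiff.1 h1).1).1 (hw A h1) h2 hwx,
      eq_pair_of_mem (mem_touching.1 (mem_sdiff.1 h3).1).1 (hw B h3) h4 hwx]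
  set s := (touching 2 Z \ F).card with hsdef
  have hYc : Zᶜ.card = Yᶜ.card := by rw [card_compl, card_compl, hZY]
  have hYl : Y.card = l + 1 := by omega
  generalize deg (touching 2 Z \ F) = m at *
  generalize deg (touching 2 Y \ L) = m' at *
  clear_value s
  have e1 := sum_choose_sub_le ht m (show s ≤ n - 1 by omega) Z (by omega)
  rw [hsZ, hl] at e1
  -- The room assumption `hs` gives l ≤ n - 1 - s, so inner and outer second-order terms can be
  -- measured by the same coefficient c.
  have hc : l.choose (t - 2) ≤ (n - 1 - s).choose (t - 2) := Nat.choose_le_choose _ (by omega)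
  set c := (n - 1 - s).choose (t - 2)
  have e2 : 2 * ∑ x ∈ Zᶜ, outerWeight t (l + 1 - m x) + 2 * s * outerStep t l + s * c ≤
      2 * (Zᶜ.card * outerWeight t (l + 1)) + (∑ x ∈ Zᶜ, m x ^ 2) * c := by
    have : ∀ x ∈ Zᶜ, 2 * outerWeight t (l + 1 - m x) + 2 * m x * outerStep t l + m x * c ≤
        2 * outerWeight t (l + 1) + m x ^ 2 * c := by
      intro x hx
      have h1 := outerWeight_add_le ht (m x) (l + 1 - m x)
      rw [show l + 1 - m x + m x = l + 1 by have := hm x hx; omega, Nat.add_sub_cancel] at h1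
      have h2 : m x ≤ m x ^ 2 := Nat.le_self_pow (by omega) _
      obtain ⟨q, hq⟩ := Nat.exists_eq_add_of_le h2
      obtain ⟨p, hp⟩ := Nat.exists_eq_add_of_le hc
      rw [hq] at h1 ⊢
      rw [hp]
      nlinarith [Nat.zero_le (q * p)]
    have h := sum_le_sum this
    simp only [sum_add_distrib, ← mul_sum, ← sum_mul, sum_const, smul_eq_mul] at h
    rw [hsZ'] at h
    linarith
  have e3 : ∑ x ∈ Y, (n - 1 - m' x).choose t = l * (n - 1).choose t + (n - 1 - s).choose t := by
    rw [← add_sum_erase _ _ hwY, hwdeg, add_comm]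
    congr 1
    rw [← add_sum_erase _ _ hwY, hwdeg] at hsY
    have h0 : ∀ x ∈ Y.erase w, (n - 1 - m' x).choose t = (n - 1).choose t := by
      intro x hx
      have : m' x = 0 := sum_eq_zero_iff.1 (by omega : ∑ x ∈ Y.erase w, m' x = 0) x hx
      rw [this, Nat.sub_zero]
    rw [sum_congr rfl h0, sum_const, smul_eq_mul, card_erase_of_mem hwY, hYl, Nat.add_sub_cancel]
  have e4 : ∑ x ∈ Yᶜ, outerWeight t (l + 1 - m' x) + s * outerStep t l =
      Yᶜ.card * outerWeight t (l + 1) := by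
    rw [← hsY', sum_mul, ← sum_add_distrib, ← smul_eq_mul, ← sum_const]
    refine sum_congr rfl fun x hx => ?_
    have := hm' x hx
    interval_cases m' x
    · simp
    · rw [Nat.add_sub_cancel, one_mul, outerWeight_succ ht]
  rw [e3]
  rw [← hYc] at e4
  -- Concentrating at one vertex gains at least (s² - Σm²)c/2 over `Z` and loses at most (Σm² -
  -- s)c/2 outside. The total sum of squares is at most s² + s, so the gain covers the loss.
  have e5 := Nat.mul_le_mul_right c hsq
  nlinarith

theorem card_touching_two_add_one {Z X : Finset (Fin n)} (h : Z.card = X.card + 1) :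
    (touching 2 Z).card + Z.card = (touching 2 X).card + n := by
  have h1 := card_touching_add 2 Z
  have h2 := card_touching_add 2 X
  have hZ : Z.card ≤ n := by simpa using card_le_univ Z
  obtain ⟨N, hN⟩ := Nat.exists_eq_add_of_le hZ
  have h3 := Nat.choose_succ_succ' N 1
  rw [Nat.choose_one_right] at h3
  rw [show n - Z.card = N by omega] at h1
  rw [show n - X.card = N + 1 by omega] at h2
  simp only [Nat.reduceAdd] at h3
  omega

theorem deg_add_deg_le_card {M : Finset (Finset (Fin n))}
    (hM : (M : Set (Finset (Fin n))).Sized 2) {i j : Fin n} (hij : i ≠ j) :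
    deg M i + deg M j ≤ M.card + 1 := by
  rw [deg, deg, ← card_union_add_card_inter]
  refine Nat.add_le_add (card_le_card (union_subset (filter_subset _ _) (filter_subset _ _)))
    (card_le_one.2 fun A hA B hB => ?_)
  obtain ⟨h1, h2⟩ := mem_inter.1 hA
  obtain ⟨h3, h4⟩ := mem_inter.1 hB
  rw [eq_pair_of_mem (hM (mem_filter.1 h1).1) (mem_filter.1 h1).2 (mem_filter.1 h2).2 hij,
    eq_pair_of_mem (hM (mem_filter.1 h3).1) (mem_filter.1 h3).2 (mem_filter.1 h4).2 hij]

/-- Suppose i and j in `Z` are not adjacent. Few edges are missing, so i has a neighbour outside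
`Z`; by stability j has smaller degree than this neighbour, hence degree below |Z|. The same holds
for i, and then together they would miss more edges than are missing in total. -/
theorem IsStable.powersetCard_two_subset {F : Finset (Finset (Fin n))} {t : ℕ}
    (h : IsStable F t) (hF : (F : Set (Finset (Fin n))).Sized 2) (ht : 2 ≤ t) {Z : Finset (Fin n)}
    (hFZ : F ⊆ touching 2 Z) (hs : (touching 2 Z \ F).card + Z.card ≤ n) (hn : Z.card + 2 ≤ n) :
    powersetCard 2 Z ⊆ F := by
  have hdeg : ∀ i ∈ Z, deg F i + deg (touching 2 Z \ F) i = n - 1 := by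
    intro i hi
    rw [deg_add_deg_sdiff hFZ, deg_touching (by omega) hi, Nat.choose_one_right]
  have key : ∀ i ∈ Z, ∀ j ∈ Z, i ≠ j → {i, j} ∉ F → deg F j < Z.card := by
    intro i hi j hj hij hA
    obtain ⟨x, hx, hxZ⟩ : ∃ x ∈ neighbors F i, x ∉ Z := by
      by_contra! hcon
      have hsub : neighbors F i ⊆ (Z.erase i).erase j := by
        intro y hy
        refine mem_erase.2 ⟨?_, mem_erase.2 ⟨(mem_neighbors.1 hy).1.symm, hcon y hy⟩⟩
        rintro rfl
        exact hA (mem_neighbors.1 hy).2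
      have h1 := card_le_card hsub
      rw [card_neighbors hF, card_erase_of_mem (mem_erase.2 ⟨hij.symm, hj⟩),
        card_erase_of_mem hi] at h1
      have h2 : deg (touching 2 Z \ F) i ≤ (touching 2 Z \ F).card := card_filter_le _ _
      have h3 := hdeg i hi
      have h4 : 1 < Z.card := one_lt_card.2 ⟨i, hi, j, hj, hij⟩
      omega
    obtain ⟨hix, hB⟩ := mem_neighbors.1 hx
    have h1 := h.deg_lt_deg hF ht hix hij hB hA
    have h2 := deg_add_deg_sdiff hFZ x
    rw [deg_touching_of_notMem hxZ] at h2
    omega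
  intro A hA
  by_contra hAF
  obtain ⟨h1, h2⟩ := mem_powersetCard.1 hA
  obtain ⟨i, j, hij, rfl⟩ := card_eq_two.1 h2
  have hi := h1 (by simp : i ∈ ({i, j} : Finset (Fin n)))
  have hj := h1 (by simp : j ∈ ({i, j} : Finset (Fin n)))
  have e1 := key i hi j hj hij hAF
  have e2 := key j hj i hi hij.symm (by rwa [pair_comm])
  have e3 := deg_add_deg_le_card (M := touching 2 Z \ F)
    (fun A hA => (mem_touching.1 (mem_sdiff.1 hA).1).1) hij
  have e4 := hdeg i hi
  have e5 := hdeg j hj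
  omega

/-- The comparison graph is covered by the clique `X` with the kernel point w added, and its missing
edges all pass through w: it is the extremal configuration of
`intersectingCount_le_of_clique_cover`. -/
theorem IsStable.intersectingCount_le_of_cover {F : Finset (Finset (Fin n))} {t : ℕ}
    (h : IsStable F t) (hF : (F : Set (Finset (Fin n))).Sized 2) (ht : 2 ≤ t)
    {Z X K : Finset (Fin n)} {R : Finset (Finset (Fin n))} (hFZ : F ⊆ touching 2 Z)
    (hZX : Z.card = X.card + 1) (hn : X.card + 3 ≤ n) (hK : K.card = 1) (hKX : Disjoint K X)
    (hR : ∀ A ∈ R, A.card = 2 ∧ Disjoint A X ∧ K ⊆ A)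
    (hcard : F.card = (touching 2 X).card + R.card) :
    intersectingCount F t ≤ intersectingCount (touching 2 X ∪ R) t := by
  obtain ⟨w, rfl⟩ := card_eq_one.1 hK
  have hwX : w ∉ X := disjoint_singleton_left.1 hKX
  have hYX : (insert w X).card = X.card + 1 := card_insert_of_notMem hwX
  have hL : ((touching 2 X ∪ R : Finset (Finset (Fin n))) : Set (Finset (Fin n))).Sized 2 := by
    intro A hA
    rcases mem_union.1 hA with hA | hA
    · exact (mem_touching.1 hA).1
    · exact (hR A hA).1
  have hLY : touching 2 X ∪ R ⊆ touching 2 (insert w X) := by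
    intro A hA
    refine mem_touching.2 ⟨hL hA, ?_⟩
    rcases mem_union.1 hA with hA | hA
    · exact fun h => (mem_touching.1 hA).2 (h.mono_right (subset_insert _ _))
    · exact not_disjoint_iff.2 ⟨w, singleton_subset_iff.1 (hR A hA).2.2, mem_insert_self _ _⟩
  have hLc : (touching 2 X ∪ R).card = F.card := by
    rw [hcard, card_union_of_disjoint]
    exact disjoint_left.2 fun A hA hA' => (mem_touching.1 hA).2 (hR A hA').2.1
  have e1 := card_touching_two_add_one hZX
  have e2 := card_touching_two_add_one hYX
  have e3 := card_sdiff_add_card_eq_card hFZ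
  have e4 := card_sdiff_add_card_eq_card hLY
  have hs : (touching 2 Z \ F).card + Z.card ≤ n := by omega
  refine intersectingCount_le_of_clique_cover hF hL (h.powersetCard_two_subset hF ht hFZ hs
    (by omega)) hFZ (fun A hA => ?_) hLY (by omega) (by omega) (mem_insert_self w X)
    (fun A hA => ?_) hs ht
  · obtain ⟨h1, h2⟩ := mem_powersetCard.1 hA
    refine mem_union_left _ (mem_touching.2 ⟨h2, fun hd => ?_⟩)
    have h3 : A ⊆ {w} := by
      intro x hx
      refine mem_singleton.2 ((mem_insert.1 (h1 hx)).resolve_right (disjoint_left.1 hd hx))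
    have := card_le_card h3
    rw [card_singleton] at this
    omega
  · obtain ⟨h1, h2⟩ := mem_sdiff.1 hA
    obtain ⟨h3, h4⟩ := mem_touching.1 h1
    obtain ⟨x, hxA, hx⟩ := not_disjoint_iff.1 h4
    rcases mem_insert.1 hx with rfl | hx
    · exact hxA
    · exact absurd (mem_union_left _ (mem_touching.2 ⟨h3, not_disjoint_iff.2 ⟨x, hxA, hx⟩⟩)) h2

/-! ### Graphs: estimates when the degrees are spread out. -/

theorem pow_mul_choose_le_pow_mul_choose {a D s t : ℕ} (h : a ≤ D) (hst : s ≤ t) :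
    D ^ s * a.choose t ≤ a ^ s * D.choose t := by
  induction s generalizing a D t with
  | zero => simpa using Nat.choose_le_choose t h
  | succ s ih =>
    obtain ⟨t, rfl⟩ : ∃ r, t = r + 1 := ⟨t - 1, by omega⟩
    rcases a with _ | a
    · simp
    obtain ⟨D, rfl⟩ : ∃ r, D = r + 1 := ⟨D - 1, by omega⟩
    have h0 : (D + 1) ^ s * a.choose t ≤ (a + 1) ^ s * D.choose t := by
      rcases Nat.eq_zero_or_pos D with rfl | hD
      · obtain rfl : a = 0 := by omega
        exact le_rfl
      have h1 := ih (a := a) (D := D) (t := t) (by omega) (by omega)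
      have h2 : (D + 1) * a ≤ (a + 1) * D := by nlinarith
      refine Nat.le_of_mul_le_mul_left (c := D ^ s) ?_ (by positivity)
      calc D ^ s * ((D + 1) ^ s * a.choose t) = (D + 1) ^ s * (D ^ s * a.choose t) := by ring
        _ ≤ (D + 1) ^ s * (a ^ s * D.choose t) := Nat.mul_le_mul_left _ h1
        _ = ((D + 1) * a) ^ s * D.choose t := by rw [mul_pow]; ring
        _ ≤ ((a + 1) * D) ^ s * D.choose t := by gcongr
        _ = _ := by rw [mul_pow]; ring
    refine Nat.le_of_mul_le_mul_left (c := t + 1) ?_ (by omega)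
    have e1 := Nat.add_one_mul_choose_eq a t
    have e2 := Nat.add_one_mul_choose_eq D t
    calc (t + 1) * ((D + 1) ^ (s + 1) * (a + 1).choose (t + 1))
        = (D + 1) ^ (s + 1) * ((a + 1).choose (t + 1) * (t + 1)) := by ring
      _ = (D + 1) * (a + 1) * ((D + 1) ^ s * a.choose t) := by rw [← e1]; ring
      _ ≤ (D + 1) * (a + 1) * ((a + 1) ^ s * D.choose t) := Nat.mul_le_mul_left _ h0
      _ = (a + 1) ^ (s + 1) * ((D + 1) * D.choose t) := by ring
      _ = _ := by rw [e2]; ring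

theorem card_triangles_le {F : Finset (Finset (Fin n))} : (triangles F).card ≤ F.card * n := by
  have : triangles F ⊆ (F ×ˢ univ).image fun p => insert p.2 p.1 := by
    intro T hT
    obtain ⟨h1, h2⟩ := mem_triangles.1 hT
    obtain ⟨x, hx⟩ := card_pos.1 (by omega : 0 < T.card)
    refine mem_image.2 ⟨(T.erase x, x), mem_product.2 ⟨h2 (mem_powersetCard.2
      ⟨erase_subset _ _, ?_⟩), mem_univ _⟩, insert_erase hx⟩
    rw [card_erase_of_mem hx, h1]
  refine (card_le_card this).trans (card_image_le.trans ?_)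
  rw [card_product, card_univ, Fintype.card_fin]

theorem mul_card_triangles_le {l t : ℕ} {F : Finset (Finset (Fin n))} (hn : 5 ≤ n)
    (hc : F.card ≤ (l + 1) * (n - 1)) :
    (n - 1) * (if t = 3 then (triangles F).card else 0) ≤ 32 * (l + 1) * (n - 1).choose t := by
  split_ifs with h
  · subst h
    obtain ⟨a, rfl⟩ : ∃ a, n = a + 4 := ⟨n - 4, by omega⟩
    have h1 := card_triangles_le (F := F)
    have h2 : (a + 3).choose 3 * 6 = (a + 3) * ((a + 2) * (a + 1)) := by
      have e1 := Nat.add_one_mul_choose_eq (a + 2) 2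
      have e2 := Nat.add_one_mul_choose_eq (a + 1) 1
      simp only [Nat.choose_one_right, Nat.reduceAdd] at e1 e2
      rw [show a + 2 + 1 = a + 3 by omega] at e1
      rw [show a + 1 + 1 = a + 2 by omega] at e2
      calc _ = (a + 3).choose 3 * 3 * 2 := by ring
        _ = (a + 3) * ((a + 2).choose 2 * 2) := by rw [← e1]; ring
        _ = _ := by rw [← e2]
    show (a + 3) * _ ≤ 32 * (l + 1) * (a + 3).choose 3
    have hc : F.card ≤ (l + 1) * (a + 3) := hc
    calc (a + 3) * (triangles F).card ≤ (a + 3) * (((l + 1) * (a + 3)) * (a + 4)) :=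
          Nat.mul_le_mul_left _ (h1.trans (Nat.mul_le_mul_right _ hc))
      _ ≤ _ := by
        refine Nat.le_of_mul_le_mul_right (c := 6) ?_ (by omega)
        rw [mul_assoc (32 * (l + 1)), h2]
        have : 6 * ((a + 3) * (a + 4)) ≤ 32 * ((a + 2) * (a + 1)) := by nlinarith
        calc _ = (l + 1) * (a + 3) * (6 * ((a + 3) * (a + 4))) := by ring
          _ ≤ (l + 1) * (a + 3) * (32 * ((a + 2) * (a + 1))) := Nat.mul_le_mul_left _ this
          _ = _ := by ring
  · simp

theorem le_intersectingCount_touching_union {l r : ℕ} {X : Finset (Fin n)} {w : Fin n}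
    (hX : X.card = l) (hwX : w ∉ X) {R : Finset (Finset (Fin n))}
    (hR : ∀ A ∈ R, A.card = 2 ∧ Disjoint A X ∧ w ∈ A) (hr : R.card = r) {t : ℕ} (ht : 2 ≤ t) :
    l * (n - 1).choose t + r.choose t ≤ intersectingCount (touching 2 X ∪ R) t := by
  have hL : ((touching 2 X ∪ R : Finset (Finset (Fin n))) : Set (Finset (Fin n))).Sized 2 := by
    intro A hA
    rcases mem_union.1 hA with hA | hA
    · exact (mem_touching.1 hA).1
    · exact (hR A hA).1
  rw [intersectingCount_eq_of_sized_two hL ht]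
  refine le_trans ?_ (Nat.le_add_right _ _)
  refine le_trans ?_ (sum_le_sum_of_subset (subset_univ (insert w X)))
  rw [sum_insert hwX, add_comm]
  refine Nat.add_le_add (Nat.choose_le_choose _ ?_) ?_
  · rw [← hr]
    exact card_le_card fun A hA => mem_filter.2 ⟨mem_union_right _ hA, (hR A hA).2.2⟩
  · rw [← hX, ← smul_eq_mul]
    refine card_nsmul_le_sum _ _ _ fun x hx => Nat.choose_le_choose _ ?_
    have h := deg_touching (k := 2) (by omega) hx
    rw [Nat.choose_one_right] at h
    rw [← h]
    exact card_le_card (filter_subset_filter _ subset_union_left)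

/-- The estimate when all the vertices that are not full have small degree. -/
theorem intersectingCount_le_of_deg_le {l d : ℕ} {F : Finset (Finset (Fin n))}
    (hF : (F : Set (Finset (Fin n))).Sized 2) {P : Finset (Fin n)}
    (hP : P.card < l) (hd : ∀ x ∉ P, deg F x ≤ d) (hdn : 4 * (l + 1) * d ≤ n - 1)
    (hn : 64 * (l + 1) ≤ n - 1) (hc : F.card ≤ (l + 1) * (n - 1)) {t : ℕ} (ht : 2 ≤ t) :
    intersectingCount F t ≤ l * (n - 1).choose t := by
  have hD : ∀ x, deg F x ≤ n - 1 := fun x => by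
    simpa using deg_le (k := 2) (by omega) hF x
  have htri := mul_card_triangles_le (t := t) (by omega) hc
  rw [intersectingCount_eq_of_sized_two hF ht, ← sum_add_sum_compl P]
  set τ := if t = 3 then (triangles F).card else 0
  set D := n - 1
  have h1 : ∑ x ∈ P, (deg F x).choose t ≤ P.card * D.choose t :=
    sum_le_card_nsmul _ _ _ fun x _ => Nat.choose_le_choose _ (hD x)
  have h2 : D ^ 2 * ∑ x ∈ Pᶜ, (deg F x).choose t ≤ d * (F.card * 2) * D.choose t := by
    calc _ = ∑ x ∈ Pᶜ, D ^ 2 * (deg F x).choose t := mul_sum _ _ _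
      _ ≤ ∑ x ∈ Pᶜ, d * deg F x * D.choose t := by
          refine sum_le_sum fun x hx => (pow_mul_choose_le_pow_mul_choose (hD x) ht).trans
            (Nat.mul_le_mul_right _ ?_)
          rw [sq]
          exact Nat.mul_le_mul_right _ (hd x (mem_compl.1 hx))
      _ = d * (∑ x ∈ Pᶜ, deg F x) * D.choose t := by rw [mul_sum, sum_mul]
      _ ≤ d * (∑ x, deg F x) * D.choose t := by
          gcongr
          exact subset_univ _
      _ = _ := by rw [sum_deg_univ hF]
  -- Non-full vertices and triangles together are worth at most one full star, and there are at most
  -- l - 1 full vertices.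
  have h3 : ∑ x ∈ Pᶜ, (deg F x).choose t + τ ≤ D.choose t := by
    refine Nat.le_of_mul_le_mul_left (c := D ^ 2) ?_ (pow_pos (by omega) 2)
    calc D ^ 2 * (∑ x ∈ Pᶜ, (deg F x).choose t + τ)
        = D ^ 2 * ∑ x ∈ Pᶜ, (deg F x).choose t + D * (D * τ) := by ring
      _ ≤ d * (F.card * 2) * D.choose t + D * (32 * (l + 1) * D.choose t) := by gcongr
      _ ≤ d * ((l + 1) * D * 2) * D.choose t + D * (32 * (l + 1) * D.choose t) := by gcongr
      _ = D * (2 * (l + 1) * d + 32 * (l + 1)) * D.choose t := by ring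
      _ ≤ D * D * D.choose t := by
          gcongr
          linarith
      _ = _ := by ring
  calc _ ≤ P.card * D.choose t + D.choose t := by omega
    _ = (P.card + 1) * D.choose t := by ring
    _ ≤ _ := Nat.mul_le_mul_right _ hP

/-- The case t = 2. Equal degrees at κ ≥ l' + 2 vertices give at most (l'D + r + c)²/(l'+2), while
(l'+2)(l'D² + r²) - (l'D + r)² = l'(D-r)² + l'D² + r² ≥ D² leaves room for the lower-order terms. -/
theorem square_estimate {κ d l l' r c g D : ℕ} (h1 : 1 ≤ l') (hl : l' ≤ l) (hr : r ≤ D)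
    (hκ : l' + 2 ≤ κ) (hκd : κ * d ≤ l' * D + r + c)
    (hD : 2 * c * (l + 1) + c ^ 2 + 2 * (l + 2) * g + (l + 2) * (l + 1) ≤ D) (hD1 : 1 ≤ D) :
    κ * d ^ 2 + (D + 1) * g + l' * D + r ≤ l' * D ^ 2 + r ^ 2 := by
  refine Nat.le_of_mul_le_mul_left (c := l' + 2) ?_ (by omega)
  have e1 : (l' + 2) * (κ * d ^ 2) ≤ (l' * D + r + c) ^ 2 := by
    calc (l' + 2) * (κ * d ^ 2) = (l' + 2) * d * (κ * d) := by ring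
      _ ≤ κ * d * (κ * d) := by gcongr
      _ = (κ * d) ^ 2 := by ring
      _ ≤ _ := by gcongr
  have e2 : 2 * c * (l' * D + r) + c ^ 2 + (l' + 2) * ((D + 1) * g) + (l' + 2) * (l' * D + r) ≤
      D * D := by
    have a1 : l' * D + r ≤ (l + 1) * D := by nlinarith
    have a2 : c ^ 2 ≤ c ^ 2 * D := Nat.le_mul_of_pos_right _ hD1
    have a3 : (l' + 2) * ((D + 1) * g) ≤ (l + 2) * ((2 * D) * g) := by gcongr; omega
    calc _ ≤ 2 * c * ((l + 1) * D) + c ^ 2 * D + (l + 2) * ((2 * D) * g) +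
          (l + 2) * ((l + 1) * D) := by gcongr
      _ = (2 * c * (l + 1) + c ^ 2 + 2 * (l + 2) * g + (l + 2) * (l + 1)) * D := by ring
      _ ≤ _ := Nat.mul_le_mul_right _ hD
  have e3 : (l' * D + r) ^ 2 + D * D ≤ (l' + 2) * (l' * D ^ 2 + r ^ 2) := by
    obtain ⟨q, rfl⟩ := Nat.exists_eq_add_of_le hr
    obtain ⟨p, rfl⟩ := Nat.exists_eq_add_of_le h1
    nlinarith [Nat.zero_le (p * q), Nat.zero_le (p * r), Nat.zero_le (p * q * q),
      Nat.zero_le (p * (r + q) * (r + q)), Nat.zero_le (p * p), Nat.zero_le (q * q)]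
  nlinarith

/-- The case t ≥ 3. Even with r replaced by D on the left and dropped on the right, (l'+1)³ + 1 ≤
(l'+2)²·l' suffices, with equality at l' = 1. The analogous inequality for squares fails, hence the
separate estimate for t = 2. -/
theorem cube_estimate {κ d l l' r c g D : ℕ} (h1 : 1 ≤ l') (hl : l' ≤ l) (hr : r ≤ D)
    (hκ : l' + 2 ≤ κ) (hκd : κ * d ≤ l' * D + r + c)
    (hD : 3 * (l + 1) ^ 2 * c + 3 * (l + 1) * c ^ 2 + c ^ 3 +
      (l + 2) ^ 2 * (2 * g + 32 * (l + 1)) ≤ D) (hD1 : 1 ≤ D) :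
    κ * d ^ 3 + (D + 1) * g + 32 * (l + 1) * D ^ 2 ≤ l' * D ^ 3 := by
  refine Nat.le_of_mul_le_mul_left (c := (l' + 2) ^ 2) ?_ (by positivity)
  have e1 : (l' + 2) ^ 2 * (κ * d ^ 3) ≤ ((l' + 1) * D + c) ^ 3 := by
    calc (l' + 2) ^ 2 * (κ * d ^ 3) = ((l' + 2) * d) ^ 2 * (κ * d) := by ring
      _ ≤ (κ * d) ^ 2 * (κ * d) := by gcongr
      _ = (κ * d) ^ 3 := by ring
      _ ≤ _ := by gcongr; linarith
  have hDD : D ≤ D ^ 2 := Nat.le_self_pow (by omega) _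
  have hDD1 : 1 ≤ D ^ 2 := hD1.trans hDD
  have e2 : ((l' + 1) * D + c) ^ 3 ≤ (l' + 1) ^ 3 * D ^ 3 +
      (3 * (l + 1) ^ 2 * c + 3 * (l + 1) * c ^ 2 + c ^ 3) * D ^ 2 := by
    calc ((l' + 1) * D + c) ^ 3 = (l' + 1) ^ 3 * D ^ 3 +
          (3 * (l' + 1) ^ 2 * c * D ^ 2 + 3 * (l' + 1) * c ^ 2 * D + c ^ 3 * 1) := by ring
      _ ≤ (l' + 1) ^ 3 * D ^ 3 +
          (3 * (l + 1) ^ 2 * c * D ^ 2 + 3 * (l + 1) * c ^ 2 * D ^ 2 + c ^ 3 * D ^ 2) := by gcongr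
      _ = _ := by ring
  have e3 : (l' + 2) ^ 2 * ((D + 1) * g + 32 * (l + 1) * D ^ 2) ≤
      (l + 2) ^ 2 * (2 * g + 32 * (l + 1)) * D ^ 2 := by
    calc _ ≤ (l + 2) ^ 2 * ((2 * D ^ 2) * g + 32 * (l + 1) * D ^ 2) := by
          gcongr
          omega
      _ = _ := by ring
  have e4 := Nat.mul_le_mul_right (D ^ 2) hD
  have e5 : (l' + 1) ^ 3 * D ^ 3 + D * D ^ 2 ≤ (l' + 2) ^ 2 * (l' * D ^ 3) := by
    have : (l' + 1) ^ 3 + 1 ≤ (l' + 2) ^ 2 * l' := by nlinarith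
    calc _ = ((l' + 1) ^ 3 + 1) * D ^ 3 := by ring
      _ ≤ (l' + 2) ^ 2 * l' * D ^ 3 := Nat.mul_le_mul_right _ this
      _ = _ := by ring
  rw [add_assoc, mul_add]
  linarith

theorem two_mul_choose_two_add (a : ℕ) : 2 * a.choose 2 + a = a ^ 2 := by
  induction a with
  | zero => rfl
  | succ a ih =>
    have := Nat.choose_succ_succ' a 1
    simp only [Nat.choose_one_right, Nat.reduceAdd] at this
    rw [this]
    linarith

/-- A bound beyond which the estimates for graphs hold. -/
def largeBound (l γ c : ℕ) : ℕ :=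
  (2 * c * (l + 1) + c ^ 2 + 2 * (l + 2) * γ ^ 2 + (l + 2) * (l + 1)) +
    (3 * (l + 1) ^ 2 * c + 3 * (l + 1) * c ^ 2 + c ^ 3 +
      (l + 2) ^ 2 * (2 * γ ^ 3 + 32 * (l + 1)))

/-- Besides the full vertices, a degree mass of about l'D + r, where l' = l - |P|, is shared nearly
evenly among at least l' + 2 vertices; convexity favours the uneven split into l' full stars and one
star of size r. Outer vertices and triangles are of lower order. -/
theorem intersectingCount_le_of_many_centres {l r d γ c : ℕ} {F : Finset (Finset (Fin n))}
    (hF : (F : Set (Finset (Fin n))).Sized 2) {P B : Finset (Fin n)} (hPB : Disjoint P B)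
    (hP : P.card < l) (hB : l + 2 ≤ P.card + B.card) (hd : ∀ x ∈ B, deg F x ≤ d)
    (hγ : ∀ x ∉ P ∪ B, deg F x ≤ γ) (hr : r ≤ n - 1)
    (hBd : P.card * (n - 1) + B.card * d ≤ l * (n - 1) + r + c) (hn : 4 ≤ n - 1)
    (hlarge : largeBound l γ c ≤ n - 1) (hc : F.card ≤ (l + 1) * (n - 1)) {t : ℕ} (ht : 2 ≤ t) :
    intersectingCount F t ≤ l * (n - 1).choose t + r.choose t := by
  have hD : ∀ x, deg F x ≤ n - 1 := fun x => by
    simpa using deg_le (k := 2) (by omega) hF x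
  have htri := mul_card_triangles_le (t := t) (by omega) hc
  rw [intersectingCount_eq_of_sized_two hF ht, ← sum_add_sum_compl (P ∪ B),
    sum_union hPB]
  have hcompl : (P ∪ B)ᶜ.card ≤ n - 1 + 1 := by
    refine (card_le_univ _).trans ?_
    rw [Fintype.card_fin]; omega
  obtain ⟨l', rfl⟩ := Nat.exists_eq_add_of_le hP.le
  set D := n - 1
  have hBd' : B.card * d ≤ l' * D + r + c := by
    rw [add_mul] at hBd
    omega
  have h1 : ∑ x ∈ P, (deg F x).choose t ≤ P.card * D.choose t :=
    sum_le_card_nsmul _ _ _ fun x _ => Nat.choose_le_choose _ (hD x)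
  unfold largeBound at hlarge
  rcases eq_or_lt_of_le ht with rfl | ht3
  · have h2 : ∑ x ∈ B, 2 * (deg F x).choose 2 ≤ B.card * d ^ 2 := by
      refine sum_le_card_nsmul _ _ _ fun x hx => ?_
      have := two_mul_choose_two_add (deg F x)
      have := Nat.pow_le_pow_left (hd x hx) 2
      omega
    have h3 : ∑ x ∈ (P ∪ B)ᶜ, 2 * (deg F x).choose 2 ≤ (D + 1) * γ ^ 2 := by
      refine (sum_le_card_nsmul _ _ (γ ^ 2) fun x hx => ?_).trans (Nat.mul_le_mul_right _ hcompl)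
      have := two_mul_choose_two_add (deg F x)
      have := Nat.pow_le_pow_left (hγ x (mem_compl.1 hx)) 2
      omega
    rw [← mul_sum] at h2 h3
    have h4 := square_estimate (l := P.card + l') (g := γ ^ 2) (by omega) (by omega) hr
      (by omega) hBd' (le_trans (Nat.le_add_right _ _) hlarge) (by omega)
    have h5 := two_mul_choose_two_add D
    have h6 := two_mul_choose_two_add r
    rw [if_neg (by omega), add_mul]
    have h7 : l' * D ^ 2 = 2 * (l' * D.choose 2) + l' * D := by rw [← h5]; ring
    omega
  · have h2 : D ^ 3 * ∑ x ∈ B, (deg F x).choose t ≤ B.card * d ^ 3 * D.choose t := by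
      rw [mul_sum, mul_assoc]
      refine sum_le_card_nsmul _ _ _ fun x hx =>
        (pow_mul_choose_le_pow_mul_choose (hD x) ht3).trans ?_
      exact Nat.mul_le_mul_right _ (Nat.pow_le_pow_left (hd x hx) 3)
    have h3 : D ^ 3 * ∑ x ∈ (P ∪ B)ᶜ, (deg F x).choose t ≤ (D + 1) * γ ^ 3 * D.choose t := by
      rw [mul_sum, mul_assoc]
      refine (sum_le_card_nsmul _ _ (γ ^ 3 * D.choose t) fun x hx =>
        (pow_mul_choose_le_pow_mul_choose (hD x) ht3).trans ?_).trans
        (Nat.mul_le_mul_right _ hcompl)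
      exact Nat.mul_le_mul_right _ (Nat.pow_le_pow_left (hγ x (mem_compl.1 hx)) 3)
    have h4 := cube_estimate (l := P.card + l') (g := γ ^ 3) (by omega) (by omega) hr
      (by omega) hBd' (le_trans (Nat.le_add_left _ _) hlarge) (by omega)
    refine le_trans ?_ (Nat.le_add_right _ _)
    set τ := if t = 3 then (triangles F).card else 0
    have h5 : ∑ x ∈ B, (deg F x).choose t + ∑ x ∈ (P ∪ B)ᶜ, (deg F x).choose t + τ ≤
        l' * D.choose t := by
      refine Nat.le_of_mul_le_mul_left (c := D ^ 3) ?_ (pow_pos (by omega) 3)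
      calc _ = D ^ 3 * ∑ x ∈ B, (deg F x).choose t + D ^ 3 * ∑ x ∈ (P ∪ B)ᶜ, (deg F x).choose t +
            D ^ 2 * (D * τ) := by ring
        _ ≤ B.card * d ^ 3 * D.choose t + (D + 1) * γ ^ 3 * D.choose t +
            D ^ 2 * (32 * (P.card + l' + 1) * D.choose t) := by gcongr
        _ = (B.card * d ^ 3 + (D + 1) * γ ^ 3 + 32 * (P.card + l' + 1) * D ^ 2) * D.choose t := by
            ring
        _ ≤ l' * D ^ 3 * D.choose t := Nat.mul_le_mul_right _ h4
        _ = _ := by ring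
    rw [add_mul]
    omega

theorem touching_mono {k : ℕ} {X Y : Finset (Fin n)} (h : X ⊆ Y) :
    touching k X ⊆ touching k Y := by
  intro A hA
  obtain ⟨h1, h2⟩ := mem_touching.1 hA
  exact mem_touching.2 ⟨h1, fun hd => h2 (hd.mono_right h)⟩

/-! ### The structure of stable graphs and the conclusion for graphs. -/

theorem pair_mem_of_full {F : Finset (Finset (Fin n))}
    (hF : (F : Set (Finset (Fin n))).Sized 2) {x y : Fin n} (hx : deg F x = n - 1) (hxy : x ≠ y) :
    {x, y} ∈ F := by
  have hsub : neighbors F x ⊆ univ.erase x := fun y hy =>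
    mem_erase.2 ⟨(mem_neighbors.1 hy).1.symm, mem_univ _⟩
  have heq := eq_of_subset_of_card_le hsub (by
    rw [card_neighbors hF, hx, card_erase_of_mem (mem_univ _), card_univ, Fintype.card_fin])
  have : y ∈ neighbors F x := by
    rw [heq]
    exact mem_erase.2 ⟨hxy.symm, mem_univ _⟩
  exact (mem_neighbors.1 this).2

theorem exists_not_adj {F : Finset (Finset (Fin n))}
    (hF : (F : Set (Finset (Fin n))).Sized 2) {v : Fin n} (hv : deg F v ≠ n - 1) :
    ∃ u, u ≠ v ∧ {u, v} ∉ F := by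
  by_contra! hcon
  refine hv ?_
  have : neighbors F v = univ.erase v := by
    ext y
    rw [mem_neighbors, mem_erase]
    refine ⟨fun h => ⟨h.1.symm, mem_univ _⟩, fun h => ⟨h.1.symm, ?_⟩⟩
    rw [pair_comm]
    exact hcon y h.1
  rw [← card_neighbors hF, this, card_erase_of_mem (mem_univ _), card_univ, Fintype.card_fin]

/-- The structure of a stable graph: apart from the full vertices, the edges are covered by few
vertices of almost the largest degree. -/
theorem IsStable.exists_centres {F : Finset (Finset (Fin n))} {t l : ℕ}
    (h : IsStable F t) (hF : (F : Set (Finset (Fin n))).Sized 2) (ht : 2 ≤ t)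
    {P : Finset (Fin n)} (hP : ∀ x, x ∈ P ↔ deg F x = n - 1) {v : Fin n} (hv : v ∉ P)
    (hmax : ∀ x ∉ P, deg F x ≤ deg F v) (hPl : P.card < l)
    (hd : n - 1 < 4 * (l + 1) * deg F v) (hc : F.card ≤ (l + 1) * (n - 1))
    (hn : 8 * (l + 1) * (l + 16 * (l + 1) ^ 2) ≤ n - 1) :
    ∃ B : Finset (Fin n), Disjoint P B ∧ (P ∪ B).card ≤ l + 16 * (l + 1) ^ 2 ∧
      F ⊆ touching 2 (P ∪ B) ∧ (∀ x ∈ B, deg F x ≤ deg F v) ∧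
      (∀ x ∈ B, deg F v ≤ deg F x + (l + 16 * (l + 1) ^ 2)) ∧
      ∀ x ∉ P ∪ B, deg F x ≤ l + 16 * (l + 1) ^ 2 := by
  set d := deg F v with hdv
  set γ := l + 16 * (l + 1) ^ 2 with hγ
  have hdγ : 2 * γ < d := by
    by_contra! hcon
    have : 4 * (l + 1) * d ≤ 4 * (l + 1) * (2 * γ) := Nat.mul_le_mul_left _ hcon
    have e : 4 * (l + 1) * (2 * γ) = 8 * (l + 1) * γ := by ring
    omega
  have hγ1 : 1 ≤ γ := by
    have : 1 ≤ 16 * (l + 1) ^ 2 := Nat.mul_pos (by omega) (pow_pos (by omega) 2)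
    omega
  obtain ⟨u, huv, hu⟩ := exists_not_adj hF fun h => hv ((hP v).2 h)
  -- the neighbours of `u` are full
  have huP : ∀ z, z ∉ P → u ≠ z → {u, z} ∉ F := fun z hz huz hA =>
    absurd (h.deg_lt_deg hF ht huz huv hA hu) (not_lt.2 (hmax z hz))
  -- Such an edge cannot contain `u`, whose neighbours are all full. It is therefore disjoint from
  -- the non-edge uv, and stability applies.
  have hedge : ∀ x z, x ≠ z → {x, z} ∈ F → x ∉ P → z ∉ P → x ≠ v → z ≠ v →
      d + 2 ≤ deg F x + deg F z := by
    intro x z hxz hA hx hz hxv hzv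
    refine h.deg_add_two_le hF ht hxz huv hA hu ?_ ?_ hxv.symm hzv.symm
    · rintro rfl
      exact huP z hz hxz hA
    · rintro rfl
      exact huP x hx hxz.symm (by rwa [pair_comm])
  -- These are the non-full vertices with more than half the degree of `v`. An edge avoiding `P ∪ B`
  -- would violate `hedge`, and the degree sum bounds their number.
  set B := (univ.filter fun x => x ∉ P ∧ d + 2 ≤ 2 * deg F x) with hB
  have hmemB : ∀ x, x ∈ B ↔ x ∉ P ∧ d + 2 ≤ 2 * deg F x := by simp [hB]
  have hvB : v ∈ B := (hmemB v).2 ⟨hv, by omega⟩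
  have hdisj : Disjoint P B := disjoint_left.2 fun x hx hxB => ((hmemB x).1 hxB).1 hx
  have hBc : B.card ≤ 16 * (l + 1) ^ 2 := by
    have h1 : B.card * d ≤ ∑ x ∈ B, 2 * deg F x := by
      refine card_nsmul_le_sum B (fun x => 2 * deg F x) d fun x hx => ?_
      have := ((hmemB x).1 hx).2
      omega
    have h2 : ∑ x ∈ B, deg F x ≤ F.card * 2 := by
      rw [← sum_deg_univ hF]
      exact sum_le_sum_of_subset (subset_univ _)
    rw [← mul_sum] at h1
    refine Nat.le_of_mul_le_mul_right (c := d) ?_ (by omega)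
    calc B.card * d ≤ 2 * (F.card * 2) := h1.trans (Nat.mul_le_mul_left _ h2)
      _ ≤ 2 * ((l + 1) * (n - 1) * 2) := by gcongr
      _ ≤ 2 * ((l + 1) * (4 * (l + 1) * d) * 2) := by gcongr
      _ = _ := by ring
  have hPBc : (P ∪ B).card ≤ γ := by
    have := card_union_le P B
    omega
  have hcov : F ⊆ touching 2 (P ∪ B) := by
    intro A hA
    refine mem_touching.2 ⟨hF hA, fun hd' => ?_⟩
    obtain ⟨x, z, hxz, rfl⟩ := card_eq_two.1 (hF hA)
    have hx := disjoint_left.1 hd' (by simp : x ∈ ({x, z} : Finset (Fin n)))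
    have hz := disjoint_left.1 hd' (by simp : z ∈ ({x, z} : Finset (Fin n)))
    rw [mem_union, not_or] at hx hz
    have hxv : x ≠ v := by rintro rfl; exact hx.2 hvB
    have hzv : z ≠ v := by rintro rfl; exact hz.2 hvB
    have h1 := hedge x z hxz hA hx.1 hz.1 hxv hzv
    have h2 : ¬ d + 2 ≤ 2 * deg F x := fun h => hx.2 ((hmemB x).2 ⟨hx.1, h⟩)
    have h3 : ¬ d + 2 ≤ 2 * deg F z := fun h => hz.2 ((hmemB z).2 ⟨hz.1, h⟩)
    omega
  have hout : ∀ x ∉ P ∪ B, deg F x ≤ γ := by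
    intro x hx
    rw [← card_neighbors hF]
    exact (card_le_card (neighbors_subset_of_touching hcov hx)).trans hPBc
  refine ⟨B, hdisj, hPBc, hcov, fun x hx => hmax x ((hmemB x).1 hx).1, fun x hx => ?_, hout⟩
  rcases eq_or_ne x v with rfl | hxv
  · omega
  obtain ⟨hxP, hxd⟩ := (hmemB x).1 hx
  -- The degree of `x` exceeds |P ∪ B|, so `x` has a neighbour outside; that neighbour has degree at
  -- most γ, and `hedge` leaves at least d + 2 - γ for `x`.
  obtain ⟨z, hz, hzPB⟩ : ∃ z ∈ neighbors F x, z ∉ P ∪ B := by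
    by_contra! hcon
    have := (card_le_card (show neighbors F x ⊆ P ∪ B from hcon)).trans hPBc
    rw [card_neighbors hF] at this
    omega
  obtain ⟨hxz, hA⟩ := mem_neighbors.1 hz
  have hzv : z ≠ v := by rintro rfl; exact hzPB (mem_union_right _ hvB)
  have h1 := hedge x z hxz hA hxP (fun h => hzPB (mem_union_left _ h)) hxv hzv
  have h2 := hout z hzPB
  omega

/-- The case of graphs. -/
theorem intersectingCount_le_of_two (l : ℕ) :
    ∃ n₀ : ℕ, ∀ n, n₀ ≤ n → ∀ (F : Finset (Finset (Fin n))) (X K : Finset (Fin n))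
      (R : Finset (Finset (Fin n))), (F : Set (Finset (Fin n))).Sized 2 → X.card = l →
      K.card = 1 → Disjoint K X → (∀ A ∈ R, A.card = 2 ∧ Disjoint A X ∧ K ⊆ A) →
      F.card = (touching 2 X).card + R.card → ∀ t, 2 ≤ t →
      intersectingCount F t ≤ intersectingCount (touching 2 X ∪ R) t := by
  obtain ⟨n₁, hn₁⟩ := intersectingCount_touching_union_le 2 l le_rfl
  set γ := l + 16 * (l + 1) ^ 2 with hγ
  refine ⟨n₁ + 64 * (l + 1) + 8 * (l + 1) * γ + largeBound l γ (2 * γ ^ 2) + 4,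
    fun n hn F₀ X K R hF₀ hX hK hKX hR hcard₀ t ht => ?_⟩
  obtain ⟨F, hF, hFc, hle, hst⟩ := exists_isStable hF₀ t
  refine hle.trans ?_
  rw [← hFc] at hcard₀
  have hcard := hcard₀
  obtain ⟨w, hw⟩ := card_eq_one.1 hK
  have hwX : w ∉ X := disjoint_singleton_left.1 (hw ▸ hKX)
  have hR' : ∀ A ∈ R, A.card = 2 ∧ Disjoint A X ∧ w ∈ A := fun A hA =>
    ⟨(hR A hA).1, (hR A hA).2.1, (hR A hA).2.2 (by rw [hw]; exact mem_singleton_self w)⟩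
  have hr : R.card ≤ n - 1 := by
    have h1 := deg_le (k := 2) (by omega) (fun A hA => (hR A hA).1) w
    rw [deg, filter_true_of_mem fun A hA => (hR' A hA).2.2] at h1
    simpa using h1
  have hT := card_touching_le (k := 2) (by omega) X
  rw [hX, Nat.choose_one_right] at hT
  have hFD : F.card ≤ (l + 1) * (n - 1) := by
    rw [add_mul, one_mul]; omega
  have hlow := le_intersectingCount_touching_union hX hwX hR' rfl ht
  set P := univ.filter fun x => deg F x = n - 1 with hPdef
  have hP : ∀ x, x ∈ P ↔ deg F x = n - 1 := by simp [hPdef]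
  -- With `l` full vertices the graph contains all edges meeting some `l`-set, and only the
  -- remainder has to be compared with the sunflower.
  rcases le_or_gt l P.card with hPl | hPl
  · obtain ⟨X', hX'P, hX'⟩ := exists_subset_card_eq hPl
    have hsub : touching 2 X' ⊆ F := by
      intro A hA
      obtain ⟨h1, h2⟩ := mem_touching.1 hA
      obtain ⟨x, hxA, hxX⟩ := not_disjoint_iff.1 h2
      obtain ⟨y, hxy, rfl⟩ := exists_eq_pair h1 hxA
      exact pair_mem_of_full hF ((hP x).1 (hX'P hxX)) hxy
    have hcc := card_sdiff_add_card_eq_card hsub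
    have h1 := card_touching_add 2 X
    have h2 := card_touching_add 2 X'
    rw [hX] at h1
    rw [hX'] at h2
    rw [← union_sdiff_of_subset hsub]
    refine hn₁ n (by omega) X' X K (F \ touching 2 X') R hX' hX (by omega) hKX (fun A hA => ?_) hR
      (by omega) t
    obtain ⟨h3, h4⟩ := mem_sdiff.1 hA
    exact ⟨hF h3, by_contra fun h => h4 (mem_touching.2 ⟨hF h3, h⟩)⟩
  obtain ⟨v, hv, hmax⟩ := exists_max_image Pᶜ (deg F) (by
    rw [← card_pos, card_compl, Fintype.card_fin]; omega)
  rw [mem_compl] at hv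
  have hmax : ∀ x ∉ P, deg F x ≤ deg F v := fun x hx => hmax x (mem_compl.2 hx)
  rcases le_or_gt (4 * (l + 1) * deg F v) (n - 1) with hd | hd
  · exact (intersectingCount_le_of_deg_le hF hPl hmax hd (by omega) hFD ht).trans
      ((Nat.le_add_right _ _).trans hlow)
  obtain ⟨B, hPB, hPBc, hcov, hBd, hBd', hout⟩ :=
    hst.exists_centres hF ht hP hv hmax hPl hd hFD (by rw [← hγ]; omega)
  rw [← hγ] at hPBc
  have hPBu := card_union_of_disjoint hPB
  -- A cover of at most `l + 1` vertices is enlarged to exactly `l + 1`; beyond that the degree mass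
  -- is spread over too many centres.
  rcases le_or_gt (P ∪ B).card (l + 1) with hsmall | hlarge
  · obtain ⟨Z, hZ, hZc⟩ := exists_superset_card_eq hsmall (by rw [Fintype.card_fin]; omega)
    exact hst.intersectingCount_le_of_cover hF ht (hcov.trans (touching_mono hZ))
      (by omega) (by omega) hK hKX hR hcard
  refine (intersectingCount_le_of_many_centres (r := R.card) (γ := γ) (c := 2 * γ ^ 2) hF hPB hPl
    (by omega) hBd hout hr ?_ (by omega) (by omega) hFD ht).trans hlow
  -- Of the slack c = 2γ², one γ² pays for edges inside `P ∪ B` counted twice, the other for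
  -- replacing each degree in `B` by the maximum.
  have h1 := sum_deg_le (le_refl 2) hF (P ∪ B)
  rw [Nat.sub_self, Nat.choose_zero_right, mul_one, sum_union hPB] at h1
  have h2 : ∑ x ∈ P, deg F x = P.card * (n - 1) := by
    rw [← smul_eq_mul, ← sum_const]
    exact sum_congr rfl fun x hx => (hP x).1 hx
  have h3 : B.card * deg F v ≤ ∑ x ∈ B, deg F x + B.card * γ := by
    rw [← smul_eq_mul, ← smul_eq_mul, ← sum_const, ← sum_const, ← sum_add_distrib]
    exact sum_le_sum hBd'
  have h4 : (P ∪ B).card ^ 2 ≤ γ ^ 2 := Nat.pow_le_pow_left hPBc 2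
  have h5 : B.card * γ ≤ γ ^ 2 := by
    rw [sq]
    exact Nat.mul_le_mul_right _ (by omega)
  omega

/-! ### Small parameters and the final assembly. -/

theorem intersectingCount_one {k : ℕ} (hk : 1 ≤ k) {F : Finset (Finset (Fin n))}
    (hF : (F : Set (Finset (Fin n))).Sized k) : intersectingCount F 1 = F.card := by
  rw [← Nat.choose_one_right F.card, ← card_powersetCard, intersectingCount, filter_true_of_mem]
  intro G hG
  obtain ⟨h1, h2⟩ := mem_powersetCard.1 hG
  obtain ⟨A, rfl⟩ := card_eq_one.1 h2
  have hA : A.Nonempty := card_pos.1 (by rw [hF (h1 (mem_singleton_self A))]; omega)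
  obtain ⟨x, hx⟩ := hA
  exact intersecting_of_mem (x := x) fun B hB => by rwa [mem_singleton.1 hB]

theorem intersectingCount_eq_zero_of_sized_one {F : Finset (Finset (Fin n))}
    (hF : (F : Set (Finset (Fin n))).Sized 1) {t : ℕ} (ht : 2 ≤ t) : intersectingCount F t = 0 := by
  rw [← card_intersectingSubfamilies, card_eq_zero, eq_empty_iff_forall_notMem]
  intro G hG
  obtain ⟨⟨h1, h2⟩, h3⟩ := mem_intersectingSubfamilies.1 hG
  obtain ⟨A, hA, B, hB, hAB⟩ := one_lt_card.1 (by omega : 1 < G.card)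
  obtain ⟨x, hx⟩ := card_eq_one.1 (hF (h1 hA))
  obtain ⟨y, hy⟩ := card_eq_one.1 (hF (h1 hB))
  have := h3 hA hB
  rw [hx, hy, disjoint_singleton, not_not] at this
  exact hAB (by rw [hx, hy, this])

theorem sized_lexFamily (k m : ℕ) :
    ((lexFamily n k m : Finset (Finset (Fin n))) : Set (Finset (Fin n))).Sized k :=
  fun _ hA => (mem_powersetCard.1 (mem_filter.1 hA).1).2

theorem card_le_choose_of_sized {k : ℕ} {F : Finset (Finset (Fin n))}
    (hF : (F : Set (Finset (Fin n))).Sized k) : F.card ≤ n.choose k := by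
  have h : F ⊆ powersetCard k univ := fun A hA => mem_powersetCard_univ.2 (hF hA)
  simpa using card_le_card h

theorem eq_of_sized_zero {F F' : Finset (Finset (Fin n))}
    (hF : (F : Set (Finset (Fin n))).Sized 0) (hF' : (F' : Set (Finset (Fin n))).Sized 0)
    (h : F.card = F'.card) : F = F' := by
  have h1 : F ⊆ {∅} := fun A hA => mem_singleton.2 (card_eq_zero.1 (hF hA))
  have h2 : F' ⊆ {∅} := fun A hA => mem_singleton.2 (card_eq_zero.1 (hF' hA))
  rcases subset_singleton_iff.1 h1 with rfl | rfl <;>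
    rcases subset_singleton_iff.1 h2 with rfl | rfl <;> simp_all

/-- The case of uniformity at least two. -/
theorem intersectingCount_le_of_two_le (k l : ℕ) (hk : 2 ≤ k) :
    ∃ n₀ : ℕ, ∀ n, n₀ ≤ n → ∀ (F : Finset (Finset (Fin n))) (X K : Finset (Fin n))
      (R : Finset (Finset (Fin n))), (F : Set (Finset (Fin n))).Sized k → X.card = l →
      K.card + 1 = k → Disjoint K X → (∀ A ∈ R, A.card = k ∧ Disjoint A X ∧ K ⊆ A) →
      F.card = (touching k X).card + R.card → R.card ≤ n → ∀ t, 2 ≤ t →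
      intersectingCount F t ≤ intersectingCount (touching k X ∪ R) t := by
  rcases eq_or_lt_of_le hk with rfl | hk
  · obtain ⟨n₀, h⟩ := intersectingCount_le_of_two l
    exact ⟨n₀, fun n hn F X K R hF hX hK hKX hR hc _ t ht =>
      h n hn F X K R hF hX (by omega) hKX hR hc t ht⟩
  · exact intersectingCount_le_of_three_le k l hk

end MostProbablyIntersecting

theorem proposition3p3 (k l : ℕ) :
    ∃ n₀ : ℕ, ∀ n : ℕ, n₀ ≤ n → ∀ m : ℕ,
      (n.choose k : ℤ) - ((n - l).choose k : ℤ) ≤ (m : ℤ) →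
      (m : ℤ) ≤ (n.choose k : ℤ) - ((n - l).choose k : ℤ) + (n : ℤ) - (l : ℤ) - (k : ℤ) + 1 →
      ∀ F : Finset (Finset (Fin n)),
        (F : Set (Finset (Fin n))).Sized k → F.card = m →
        ∀ t : ℕ,
          MostProbablyIntersecting.intersectingCount F t ≤
            MostProbablyIntersecting.intersectingCount
              (MostProbablyIntersecting.lexFamily n k m) t := by
  open MostProbablyIntersecting in
  rcases Nat.eq_zero_or_pos k with rfl | hk
  -- The empty set is the only 0-set, so a family of 0-sets is determined by its size.
  · refine ⟨0, fun n _ m _ _ F hF hm t => le_of_eq ?_⟩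
    rw [eq_of_sized_zero hF (sized_lexFamily 0 m)
      (hm.trans (card_lexFamily (hm ▸ card_le_choose_of_sized hF)).symm)]
  obtain ⟨n₀, hn₀⟩ : ∃ n₀ : ℕ, ∀ n, n₀ ≤ n → ∀ (m : ℕ) (F : Finset (Finset (Fin n))) t,
      (n.choose k : ℤ) - ((n - l).choose k : ℤ) ≤ (m : ℤ) →
      (m : ℤ) ≤ (n.choose k : ℤ) - ((n - l).choose k : ℤ) + (n : ℤ) - (l : ℤ) - (k : ℤ) + 1 →
      (F : Set (Finset (Fin n))).Sized k → F.card = m → 2 ≤ t →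
      intersectingCount F t ≤ intersectingCount (lexFamily n k m) t := by
    -- Distinct singletons are disjoint, so for `k = 1` no two sets intersect and every count with t
    -- ≥ 2 vanishes.
    rcases eq_or_lt_of_le (show 1 ≤ k from hk) with rfl | hk2
    · refine ⟨0, fun n _ m F t _ _ hF _ ht => ?_⟩
      rw [intersectingCount_eq_zero_of_sized_one hF ht]
      exact Nat.zero_le _
    · obtain ⟨n₀, h⟩ := intersectingCount_le_of_two_le k l hk2
      refine ⟨n₀ + l + k, fun n hn m F t h1 h2 hF hm ht => ?_⟩
      obtain ⟨X, K, R, hX, hK, hKX, hR, hL, hc⟩ :=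
        lexFamily_eq_union hk (by omega) h1 h2 (hm ▸ card_le_choose_of_sized hF)
      rw [hL]
      have hT := card_touching_add k X
      rw [hX] at hT
      exact h n (by omega) F X K R hF hX hK hKX hR (by omega) (by omega) t ht
  refine ⟨n₀, fun n hn m h1 h2 F hF hm t => ?_⟩
  -- For t = 0 both counts are 1, and for t = 1 they are the equal cardinalities, since non-empty
  -- sets meet themselves.
  rcases lt_or_ge t 2 with ht | ht
  · interval_cases t
    · rw [intersectingCount_zero, intersectingCount_zero]
    · rw [intersectingCount_one hk hF, intersectingCount_one hk (sized_lexFamily k m), hm,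
        card_lexFamily (hm ▸ card_le_choose_of_sized hF)]
  · exact hn₀ n hn m F t h1 h2 hF hm ht
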